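/- Let $\mathcal C$ be a small category. A marked category is a pair $(\mathcal P,E)$ of a small category and a set $E$ of morphisms of $\mathcal P$ (the marked ones) containing the identities; marked functors are functors that preserve markings. These form a category $\mathrm{Cat}^+$; $\mathcal C^\sharp$ denotes $\mathcal C$ with all morphisms marked, and $\mathrm{Cat}^+_{/\mathcal C^\sharp}$ the slice category. Write $\mathrm{Cat}$ for the category of small categories. The marked Grothendieck construction $\int^+_{\mathcal C}\colon[\mathcal C^{op},\mathrm{Cat}]\to\mathrm{Cat}^+_{/\mathcal C^\sharp}$ sends $F$ to the category with objects the pairs $(c,x)$, $c\in\mathcal C$, $x\in Fc$, and morphisms $(c,x)\to(d,y)$ the pairs $(f\colon c\to d,\ \psi\colon x\to Ff(y))$, where $(f,\psi)$ is marked if and only if $\psi$ is an isomorphism, together with the projection to $\mathcal C$; it sends $\alpha\colon F\Rightarrow G$ to $(c,x)\mapsto(c,\alpha_c(x))$, $(f,\psi)\mapsto(f,\alpha_c(\psi))$. The functor $\mathcal T^+_{\mathcal C}\colon\mathrm{Cat}^+_{/\mathcal C^\sharp}\to[\mathcal C^{op},\mathrm{Cat}]$ sends $P\colon(\mathcal P,E)\to\mathcal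 C^\sharp$ to $c\mapsto(c\downarrow P)[E_c^{-1}]$, the localization of the comma category $c\downarrow P$ at the morphisms whose component in $\mathcal P$ lies in $E$, with the evident functoriality (pre-composition in $c$, the induced functors $c\downarrow P\to c\downarrow Q$ in $P$). Then the following hold. 1. There is a model structure on $[\mathcal C^{op},\mathrm{Cat}]$ (the projective one) whose weak equivalences are the level-wise equivalences of categories and whose fibrations are the level-wise isofibrations. 2. There is a model structure on $\mathrm{Cat}^+_{/\mathcal C^\sharp}$ whose cofibrations are the injective-on-objects functors, whose fibrant objects are the cart-marked Grothendieck fibrations (the Grothendieck fibrations $P\colon\mathcal P\to\mathcal C$ for which $E$ is exactly the set of $P$-cartesian morphisms), and in which a morphism between fibrant objects is a weak equivalence if and only if its underlying functor is an equivalence of categories, and a fibration if and only if its underlying functor is an isofibration. 3. There is an adjunction $\mathcal T^+_{\mathcal C}\dashv\int^+_{\mathcal C}$, and with respect to these two model structures it is a Quillen equivalence. -/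

import Mathlib

open CategoryTheory HomotopicalAlgebra Opposite

universe u

namespace MarkedGrothendieck

/-! ### Functors -/

section Functors

variable {A B : Type u} [Category.{u} A] [Category.{u} B]

/-- A functor `F : A ⥤ B` is an isofibration if every isomorphism `d ≅ F a` of `B` is the image
under `F` of an isomorphism `a' ≅ a` of `A`. -/
def IsIsofibration (F : A ⥤ B) : Prop :=
  ∀ ⦃a : A⦄ ⦃d : B⦄ (g : d ≅ F.obj a), ∃ (a' : A) (f : a' ≅ a), F.IsHomLift g.hom f.hom

/-- A morphism `g : a' ⟶ a` is `P`-cartesian if for every `h : b ⟶ a` and `f : P b ⟶ P a'` with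
`P h = f ≫ P g` there is a unique lift `h' : b ⟶ a'` of `f` such that `h = h' ≫ g`. -/
abbrev IsCartesianMor (P : A ⥤ B) {a' a : A} (g : a' ⟶ a) : Prop :=
  P.IsStronglyCartesian (P.map g) g

/-- `P` is a Grothendieck fibration if every `f : c ⟶ P a` has a `P`-cartesian lift with
target `a`. -/
def IsGrothendieckFibration (P : A ⥤ B) : Prop :=
  ∀ ⦃a : A⦄ ⦃c : B⦄ (f : c ⟶ P.obj a), ∃ (a' : A) (g : a' ⟶ a), P.IsStronglyCartesian f g

end Functors

/-! ### Marked categories -/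

/-- A marked category: a small category with a set of morphisms containing the identities. -/
structure MarkedCat : Type (u + 1) where
  carrier : Type u
  [str : Category.{u} carrier]
  /-- the set of marked morphisms -/
  marked : MorphismProperty carrier
  id_marked : ∀ a : carrier, marked (𝟙 a)

namespace MarkedCat

instance : CoeSort MarkedCat.{u} (Type u) := ⟨MarkedCat.carrier⟩

instance (A : MarkedCat.{u}) : Category.{u} A := A.str

/-- A marked functor: a functor that preserves the marking. -/
@[ext]
structure Hom (A B : MarkedCat.{u}) where
  toFunctor : A ⥤ B
  map_marked : ∀ ⦃a b : A⦄ (f : a ⟶ b), A.marked f → B.marked (toFunctor.map f)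

instance : Category.{u} MarkedCat.{u} where
  Hom A B := Hom A B
  id A := { toFunctor := 𝟭 A, map_marked := fun _ _ _ h => h }
  comp F G :=
    { toFunctor := F.toFunctor ⋙ G.toFunctor
      map_marked := fun _ _ f h => G.map_marked _ (F.map_marked f h) }

@[ext]
theorem hom_ext {A B : MarkedCat.{u}} {F G : A ⟶ B} (h : F.toFunctor = G.toFunctor) : F = G :=
  Hom.ext h

@[simp]
theorem id_toFunctor (A : MarkedCat.{u}) : Hom.toFunctor (𝟙 A) = 𝟭 A := rfl

@[simp]
theorem comp_toFunctor {A B D : MarkedCat.{u}} (F : A ⟶ B) (G : B ⟶ D) :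
    Hom.toFunctor (F ≫ G) = F.toFunctor ⋙ G.toFunctor := rfl

/-- The category `C` with the maximal marking: every morphism is marked. -/
abbrev sharp (C : Type u) [Category.{u} C] : MarkedCat.{u} where
  carrier := C
  marked := ⊤
  id_marked _ := trivial

/-- The functor induced on localizations at the marked morphisms by a marked functor. -/
noncomputable def locMap {A B : MarkedCat.{u}} (F : A ⟶ B) :
    A.marked.Localization ⥤ B.marked.Localization :=
  Localization.Construction.lift (F.toFunctor ⋙ B.marked.Q)
    (fun _ _ f hf => B.marked.Q_inverts _ (F.map_marked f hf))

theorem Q_locMap {A B : MarkedCat.{u}} (F : A ⟶ B) :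
    A.marked.Q ⋙ locMap F = F.toFunctor ⋙ B.marked.Q :=
  Localization.Construction.fac _ _

/-- The functor `(A, E) ↦ A[E⁻¹]` sending a marked category to its localization at the marked
morphisms. -/
noncomputable def loc : MarkedCat.{u} ⥤ Cat.{u, u} where
  obj A := Cat.of A.marked.Localization
  map F := (locMap F).toCatHom
  map_id A := by
    refine Cat.ext (Localization.Construction.uniq _ _ ?_)
    exact Q_locMap (𝟙 A)
  map_comp {A B D} F G := by
    refine Cat.ext (Localization.Construction.uniq _ _ ?_)
    change _ = (A.marked.Q ⋙ locMap F) ⋙ locMap G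
    rw [Q_locMap, Functor.assoc, Q_locMap]
    exact Q_locMap (F ≫ G)

end MarkedCat

variable {C : Type u} [Category.{u} C]

/-- The functor `P ⥤ C` underlying an object of the slice category `Cat⁺ / C♯`. -/
abbrev proj (P : Over (MarkedCat.sharp C)) : P.left ⥤ C := P.hom.toFunctor

/-- The functor underlying a morphism of the slice category `Cat⁺ / C♯`. -/
abbrev fctr {P Q : Over (MarkedCat.sharp C)} (F : P ⟶ Q) : P.left ⥤ Q.left := F.left.toFunctor

theorem fctr_comp_proj {P Q : Over (MarkedCat.sharp C)} (F : P ⟶ Q) :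
    fctr F ⋙ proj Q = proj P :=
  congrArg MarkedCat.Hom.toFunctor (Over.w F)

/-- A cart-marked Grothendieck fibration: a Grothendieck fibration whose marked morphisms are
exactly the cartesian ones. -/
structure IsCartMarkedFibration (P : Over (MarkedCat.sharp C)) : Prop where
  isGrothendieckFibration : IsGrothendieckFibration (proj P)
  marked_iff : ∀ ⦃a' a : P.left⦄ (g : a' ⟶ a), P.left.marked g ↔ IsCartesianMor (proj P) g

/-! ### The functor `T⁺` -/

/-- The marking `E_c` of the comma category `c ↓ P`: a morphism is marked if and only if its
component in `P` is marked. -/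
def commaMarked (P : Over (MarkedCat.sharp C)) (c : C) :
    MorphismProperty (StructuredArrow c (proj P)) :=
  fun _ _ g => P.left.marked (StructuredArrow.Hom.right g)

/-- The marked comma category `c ↓ P`. -/
abbrev comma (P : Over (MarkedCat.sharp C)) (c : C) : MarkedCat.{u} where
  carrier := StructuredArrow c (proj P)
  marked := commaMarked P c
  id_marked X := P.left.id_marked (StructuredArrow.right X)

/-- Pre-composition `d ↓ P ⟶ c ↓ P` with a morphism `f : c ⟶ d`. -/
def commaPre (P : Over (MarkedCat.sharp C)) {c d : C} (f : c ⟶ d) : comma P d ⟶ comma P c where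
  toFunctor := StructuredArrow.map (T := proj P) f
  map_marked _ _ _ h := h

/-- The functor `c ↓ P ⥤ c ↓ Q`, `(a, f) ↦ (F a, f)`, induced by `F : P ⟶ Q`. -/
def commaMapFunctor {P Q : Over (MarkedCat.sharp C)} (F : P ⟶ Q) (c : C) :
    StructuredArrow c (proj P) ⥤ StructuredArrow c (proj Q) where
  obj X := StructuredArrow.mk (Y := (fctr F).obj X.right)
    (X.hom ≫ eqToHom (Functor.congr_obj (fctr_comp_proj F) X.right).symm)
  map {X Y} g := StructuredArrow.homMk ((fctr F).map g.right) (by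
    have h := Functor.congr_hom (fctr_comp_proj F) g.right
    rw [Functor.comp_map] at h
    change (X.hom ≫ _) ≫ (proj Q).map ((fctr F).map g.right) = Y.hom ≫ _
    rw [h, ← StructuredArrow.w g]
    simp only [Category.assoc, eqToHom_trans_assoc, eqToHom_refl, Category.id_comp])
  map_id X := by ext; simp
  map_comp f g := by ext; simp

/-- The marked functor `c ↓ P ⟶ c ↓ Q` induced by `F : P ⟶ Q`. -/
def commaMap {P Q : Over (MarkedCat.sharp C)} (F : P ⟶ Q) (c : C) : comma P c ⟶ comma Q c where
  toFunctor := commaMapFunctor F c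
  map_marked _ _ g h := F.left.map_marked (StructuredArrow.Hom.right g) h

theorem comma_obj_ext {P : Over (MarkedCat.sharp C)} {c : C} {S T : StructuredArrow c (proj P)}
    (h : S.right = T.right) (h' : S.hom ≫ eqToHom (congrArg (proj P).obj h) = T.hom) : S = T := by
  obtain ⟨⟨⟨⟩⟩, a, s⟩ := S
  obtain ⟨⟨⟨⟩⟩, b, t⟩ := T
  obtain rfl : a = b := h
  obtain rfl : s = t := by simpa using h'
  rfl

/-- Equality of functors into a comma category. -/
theorem comma_functor_ext {A : Type u} [Category.{u} A] {P : Over (MarkedCat.sharp C)} {c : C}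
    {F G : A ⥤ StructuredArrow c (proj P)}
    (h : F ⋙ StructuredArrow.proj c (proj P) = G ⋙ StructuredArrow.proj c (proj P))
    (h' : ∀ X, (F.obj X).hom ≫ eqToHom (congrArg (proj P).obj (Functor.congr_obj h X)) =
      (G.obj X).hom) : F = G := by
  refine CategoryTheory.Functor.ext
    (fun X => comma_obj_ext (Functor.congr_obj h X) (h' X)) ?_
  intro X Y f
  ext
  simp only [StructuredArrow.comp_right, StructuredArrow.eqToHom_right]
  exact Functor.congr_hom h f

theorem comp_eqToHom_aux {x y z z' w : C} (f : x ⟶ y) (p : y = z) (q : z = w) (p' : y = z')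
    (q' : z' = w) : (f ≫ eqToHom p) ≫ eqToHom q = (f ≫ eqToHom p') ≫ eqToHom q' := by
  subst p q p'
  rfl

theorem commaMapFunctor_comp {P Q R : Over (MarkedCat.sharp C)} (F : P ⟶ Q) (G : Q ⟶ R) (c : C) :
    commaMapFunctor (F ≫ G) c = commaMapFunctor F c ⋙ commaMapFunctor G c := by
  refine comma_functor_ext (by rfl) ?_
  intro X
  exact comp_eqToHom_aux (StructuredArrow.hom X) _ _ _ _

/-- `P ↦ (c ↦ c ↓ P)` as a functor to presheaves of marked categories. -/
def commaFunctor (C : Type u) [Category.{u} C] :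
    Over (MarkedCat.sharp C) ⥤ (Cᵒᵖ ⥤ MarkedCat.{u}) where
  obj P :=
    { obj := fun c => comma P c.unop
      map := fun f => commaPre P f.unop
      map_id := fun c => by
        refine MarkedCat.hom_ext (comma_functor_ext rfl ?_)
        intro X
        change (𝟙 c.unop ≫ StructuredArrow.hom X) ≫ 𝟙 _ = StructuredArrow.hom X
        rw [Category.comp_id, Category.id_comp]
      map_comp := fun f g => by
        refine MarkedCat.hom_ext (comma_functor_ext rfl ?_)
        intro X
        change ((g.unop ≫ f.unop) ≫ StructuredArrow.hom X) ≫ 𝟙 _ =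
          g.unop ≫ f.unop ≫ StructuredArrow.hom X
        rw [Category.comp_id, Category.assoc] }
  map F :=
    { app := fun c => commaMap F c.unop
      naturality := fun c d f => by
        refine MarkedCat.hom_ext (comma_functor_ext rfl ?_)
        intro X
        change ((f.unop ≫ StructuredArrow.hom X) ≫ eqToHom _) ≫ 𝟙 _ =
          f.unop ≫ StructuredArrow.hom X ≫ eqToHom _
        rw [Category.comp_id, Category.assoc] }
  map_id P := by
    apply NatTrans.ext
    funext c
    refine MarkedCat.hom_ext (comma_functor_ext rfl ?_)
    intro X
    change (StructuredArrow.hom X ≫ 𝟙 _) ≫ 𝟙 _ = StructuredArrow.hom X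
    rw [Category.comp_id, Category.comp_id]
  map_comp F G := by
    apply NatTrans.ext
    funext c
    exact MarkedCat.hom_ext (commaMapFunctor_comp F G c.unop)

/-- The functor `T⁺`, with `T⁺ P c = (c ↓ P)[E_c⁻¹]`. -/
noncomputable def TPlus (C : Type u) [Category.{u} C] :
    Over (MarkedCat.sharp C) ⥤ (Cᵒᵖ ⥤ Cat.{u, u}) :=
  commaFunctor C ⋙ (Functor.whiskeringRight _ _ _).obj MarkedCat.loc

/-! ### The marked Grothendieck construction -/

/-- Objects of the Grothendieck construction of `F`: pairs `(c, x)` with `x : F c`. -/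
structure Groth (F : Cᵒᵖ ⥤ Cat.{u, u}) : Type u where
  base : C
  fiber : F.obj (op base)

namespace Groth

variable {F G H : Cᵒᵖ ⥤ Cat.{u, u}}

/-- Morphisms `(c, x) ⟶ (d, y)`: pairs of `f : c ⟶ d` and `ψ : x ⟶ F f y`. -/
structure Hom (X Y : Groth F) : Type u where
  base : X.base ⟶ Y.base
  fiber : X.fiber ⟶ (F.map base.op).toFunctor.obj Y.fiber

theorem hom_ext' {X Y : Groth F} {f g : Hom X Y} (h : f.base = g.base)
    (h' : f.fiber ≫ eqToHom (by rw [h]) = g.fiber) : f = g := by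
  obtain ⟨b, φ⟩ := f
  obtain ⟨b', φ'⟩ := g
  obtain rfl : b = b' := h
  obtain rfl : φ = φ' := by simpa using h'
  rfl

theorem map_id_obj {c : C} (x : F.obj (op c)) : (F.map (𝟙 c).op).toFunctor.obj x = x := by
  simp

theorem map_comp_obj {c d e : C} (f : c ⟶ d) (g : d ⟶ e) (x : F.obj (op e)) :
    (F.map f.op).toFunctor.obj ((F.map g.op).toFunctor.obj x) =
      (F.map (f ≫ g).op).toFunctor.obj x := by
  simp

instance : Category.{u} (Groth F) where
  Hom := Hom
  id X := ⟨𝟙 X.base, eqToHom (map_id_obj X.fiber).symm⟩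
  comp {X Y Z} f g :=
    ⟨f.base ≫ g.base, f.fiber ≫ (F.map f.base.op).toFunctor.map g.fiber ≫
      eqToHom (map_comp_obj f.base g.base Z.fiber)⟩
  id_comp {X Y} f := by
    refine hom_ext' (Category.id_comp _) ?_
    have h : (F.map (𝟙 X.base).op).toFunctor = 𝟭 _ := by simp
    have h' := Functor.congr_hom h f.fiber
    simp [h', -op_id]
  comp_id {X Y} f := by
    refine hom_ext' (Category.comp_id _) ?_
    simp [eqToHom_map]
  assoc {X Y Z W} f g h := by
    refine hom_ext' (Category.assoc _ _ _) ?_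
    have e : (F.map (f.base ≫ g.base).op).toFunctor =
      (F.map g.base.op).toFunctor ⋙ (F.map f.base.op).toFunctor := by simp
    have e' := Functor.congr_hom e h.fiber
    simp [e', eqToHom_map, -op_comp]

/-- The projection `(c, x) ↦ c`. -/
@[simps]
def forget (F : Cᵒᵖ ⥤ Cat.{u, u}) : Groth F ⥤ C where
  obj X := X.base
  map f := f.base

@[simp]
theorem id_base (X : Groth F) : Hom.base (𝟙 X) = 𝟙 X.base := rfl

@[simp]
theorem id_fiber (X : Groth F) : Hom.fiber (𝟙 X) = eqToHom (map_id_obj X.fiber).symm := rfl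

@[simp]
theorem comp_base {X Y Z : Groth F} (f : X ⟶ Y) (g : Y ⟶ Z) :
    Hom.base (f ≫ g) = f.base ≫ g.base := rfl

@[simp]
theorem comp_fiber {X Y Z : Groth F} (f : X ⟶ Y) (g : Y ⟶ Z) :
    Hom.fiber (f ≫ g) = f.fiber ≫ (F.map f.base.op).toFunctor.map g.fiber ≫
      eqToHom (map_comp_obj f.base g.base Z.fiber) := rfl

theorem map_obj_aux (α : F ⟶ G) {c d : C} (f : c ⟶ d) (y : F.obj (op d)) :
    (α.app (op c)).toFunctor.obj ((F.map f.op).toFunctor.obj y) =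
      (G.map f.op).toFunctor.obj ((α.app (op d)).toFunctor.obj y) :=
  Functor.congr_obj (congrArg Cat.Hom.toFunctor (α.naturality f.op)) y

/-- The functor `(c, x) ↦ (c, α_c x)` induced by a natural transformation `α`. -/
def mapFunctor (α : F ⟶ G) : Groth F ⥤ Groth G where
  obj X := ⟨X.base, (α.app (op X.base)).toFunctor.obj X.fiber⟩
  map {X Y} f := ⟨f.base, (α.app (op X.base)).toFunctor.map f.fiber ≫
    eqToHom (map_obj_aux α f.base Y.fiber)⟩
  map_id X := by
    refine hom_ext' rfl ?_
    simp [eqToHom_map]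
  map_comp {X Y Z} f g := by
    refine hom_ext' rfl ?_
    have e : (F.map f.base.op).toFunctor ⋙ (α.app (op X.base)).toFunctor =
        (α.app (op Y.base)).toFunctor ⋙ (G.map f.base.op).toFunctor :=
      congrArg Cat.Hom.toFunctor (α.naturality f.base.op)
    have e' := Functor.congr_hom e g.fiber
    simp only [Functor.comp_map] at e'
    simp [e', eqToHom_map]

/-- A morphism `(f, ψ)` is marked if and only if `ψ` is an isomorphism. -/
def marked (F : Cᵒᵖ ⥤ Cat.{u, u}) : MorphismProperty (Groth F) :=
  fun _ _ f => IsIso (Hom.fiber f)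

/-- The marked category underlying the marked Grothendieck construction. -/
abbrev toMarkedCat (F : Cᵒᵖ ⥤ Cat.{u, u}) : MarkedCat.{u} where
  carrier := Groth F
  marked := marked F
  id_marked X := by
    change IsIso (Hom.fiber (𝟙 X))
    rw [id_fiber]
    infer_instance

/-- The marked functor induced by a natural transformation. -/
def map (α : F ⟶ G) : toMarkedCat F ⟶ toMarkedCat G where
  toFunctor := mapFunctor α
  map_marked {X Y} f h := by
    have : IsIso (Hom.fiber f) := h
    have : IsIso ((α.app (op (Groth.base X))).toFunctor.map (Hom.fiber f)) :=
      Functor.map_isIso _ _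
    exact IsIso.comp_isIso' this (eqToIso (map_obj_aux α f.base Y.fiber)).isIso_hom

theorem eqToHom_aux₁ {A : Type u} [Category.{u} A] {x y z w : A} (f : x ⟶ y) (p : y = z)
    (q : z = w) (r : y = w) : (f ≫ eqToHom p) ≫ eqToHom q = f ≫ eqToHom r := by
  simp

theorem eqToHom_aux₂ {A B : Type u} [Category.{u} A] [Category.{u} B] (K : A ⥤ B) {x y z : A}
    {w v : B} (f : x ⟶ y) (p : y = z) (q : K.obj y = w) (r : w = v) (t : K.obj z = v) :
    (K.map f ≫ eqToHom q) ≫ eqToHom r = K.map (f ≫ eqToHom p) ≫ eqToHom t := by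
  simp [eqToHom_map]

theorem mapFunctor_id (F : Cᵒᵖ ⥤ Cat.{u, u}) : mapFunctor (𝟙 F) = 𝟭 (Groth F) := by
  refine CategoryTheory.Functor.hext (fun X => rfl) (fun X Y f => heq_of_eq (hom_ext' rfl ?_))
  exact (eqToHom_aux₁ (Hom.fiber f) rfl rfl rfl).trans (Category.comp_id _)

theorem mapFunctor_comp (α : F ⟶ G) (β : G ⟶ H) :
    mapFunctor (α ≫ β) = mapFunctor α ⋙ mapFunctor β := by
  refine CategoryTheory.Functor.hext (fun X => rfl) (fun X Y f => heq_of_eq (hom_ext' rfl ?_))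
  exact eqToHom_aux₂ (β.app (op X.base)).toFunctor
    ((α.app (op X.base)).toFunctor.map (Hom.fiber f)) (map_obj_aux α (Hom.base f) Y.fiber)
    _ _ (map_obj_aux β (Hom.base f) _)

end Groth

/-- The marked Grothendieck construction `∫⁺ F`, with its projection to `C♯`. -/
def grothObj (F : Cᵒᵖ ⥤ Cat.{u, u}) : Over (MarkedCat.sharp C) :=
  Over.mk (Y := Groth.toMarkedCat F)
    ({ toFunctor := Groth.forget F
       map_marked := fun _ _ _ _ => trivial } : MarkedCat.Hom _ _)

/-- The functor `∫⁺`. -/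
def groth (C : Type u) [Category.{u} C] : (Cᵒᵖ ⥤ Cat.{u, u}) ⥤ Over (MarkedCat.sharp C) where
  obj F := grothObj F
  map {F G} α := Over.homMk (U := grothObj F) (V := grothObj G) (Groth.map α) (by
    apply MarkedCat.hom_ext
    rfl)
  map_id F := Over.OverMorphism.ext (MarkedCat.hom_ext (Groth.mapFunctor_id F))
  map_comp α β := Over.OverMorphism.ext (MarkedCat.hom_ext (Groth.mapFunctor_comp α β))

/-! ### Model structures and Quillen equivalences -/

/-- The projective model structure on `[Cᵒᵖ, Cat]`: the weak equivalences are the level-wise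
equivalences of categories and the fibrations are the level-wise isofibrations. -/
structure IsProjectiveModelStructure {C : Type u} [Category.{u} C]
    (M : ModelCategory (Cᵒᵖ ⥤ Cat.{u, u})) : Prop where
  weakEquivalence_iff : ∀ {F G : Cᵒᵖ ⥤ Cat.{u, u}} (α : F ⟶ G),
    WeakEquivalence α ↔ ∀ c : Cᵒᵖ, (α.app c).toFunctor.IsEquivalence
  fibration_iff : ∀ {F G : Cᵒᵖ ⥤ Cat.{u, u}} (α : F ⟶ G),
    Fibration α ↔ ∀ c : Cᵒᵖ, IsIsofibration (α.app c).toFunctor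

/-- The model structure for Grothendieck fibrations on `Cat⁺ / C♯`: the cofibrations are the
injective-on-objects functors, the fibrant objects are the cart-marked Grothendieck fibrations, and
between fibrant objects the weak equivalences are the equivalences of categories and the fibrations
are the isofibrations. A model structure is determined by its cofibrations and fibrant objects. -/
structure IsGrfibModelStructure {C : Type u} [Category.{u} C]
    (M : ModelCategory (Over (MarkedCat.sharp C))) : Prop where
  cofibration_iff : ∀ {P Q : Over (MarkedCat.sharp C)} (F : P ⟶ Q),
    Cofibration F ↔ Function.Injective (fctr F).obj
  isFibrant_iff : ∀ P : Over (MarkedCat.sharp C), IsFibrant P ↔ IsCartMarkedFibration P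
  weakEquivalence_iff : ∀ {P Q : Over (MarkedCat.sharp C)} (F : P ⟶ Q), IsFibrant P →
    IsFibrant Q → (WeakEquivalence F ↔ (fctr F).IsEquivalence)
  fibration_iff : ∀ {P Q : Over (MarkedCat.sharp C)} (F : P ⟶ Q), IsFibrant P →
    IsFibrant Q → (Fibration F ↔ IsIsofibration (fctr F))

section Quillen

variable {D E : Type*} [Category* D] [Category* E] [ModelCategory D] [ModelCategory E]
  {L : D ⥤ E} {R : E ⥤ D}

/-- An adjunction `L ⊣ R` between model categories is a Quillen adjunction if the right
adjoint `R` preserves fibrations and trivial fibrations. -/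
structure IsQuillenAdjunction (_adj : L ⊣ R) : Prop where
  fibration : ∀ {X Y : E} (p : X ⟶ Y), Fibration p → Fibration (R.map p)
  trivialFibration : ∀ {X Y : E} (p : X ⟶ Y), Fibration p → WeakEquivalence p →
    Fibration (R.map p) ∧ WeakEquivalence (R.map p)

/-- A Quillen equivalence: a Quillen adjunction such that, for every cofibrant `X` and every
fibrant `Y`, a morphism `L X ⟶ Y` is a weak equivalence if and only if its transpose
`X ⟶ R Y` is. -/
structure IsQuillenEquivalence (adj : L ⊣ R) : Prop extends IsQuillenAdjunction adj where
  weakEquivalence_iff : ∀ (X : D) (Y : E) (f : L.obj X ⟶ Y), IsCofibrant X → IsFibrant Y →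
    (WeakEquivalence f ↔ WeakEquivalence (adj.homEquiv X Y f))

end Quillen

end MarkedGrothendieck

namespace MarkedGrothendieck

/-! ### Categories as single-sorted structures -/

/-! On presheaves everything can be built by hand. The trivial fibrations are the transformations
that are level-wise fully faithful and surjective on objects. A presheaf that is level-wise fully
faithful over a given one is determined by its presheaf of objects, so both factorizations arise by
freely adding sections of objects: all objects of the target for one, and a new object for each
isomorphism `y ≅ f x` for the other. The retract argument then identifies the trivial cofibrations
(`levelIsofib_llp`).

On marked categories over `C` the weak equivalences are defined as the morphisms sent by `TPlus` to
level-wise equivalences. The central computation is `isEquivalence_unit`: if `P` is a cart-marked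
fibration, then `𝟙 : P a ⟶ P a`, as an object of the comma category, is colocal for the marked
(cartesian) morphisms, so localizing does not change the morphisms out of it, and every object
becomes isomorphic to a pullback of such data. Hence the unit at `P` is an equivalence. Applied to
Grothendieck constructions, the triangle identities make the counit a level-wise equivalence and
every unit a weak equivalence. This already contains the Quillen equivalence (`weq_homEquiv_iff`)
and the description of weak equivalences between fibrant objects.

For the model structure, the cofibrations and the surjective, fully faithful, mark reflecting
functors form a weak factorization system by means of a mapping cylinder. By the adjunction the
trivial cofibrations are a left lifting class (`tcof_eq`). To factor through them a set of
generators is needed, namely the trivial cofibrations between objects with at most `κ` arrows. That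
these suffice is a Smith-type argument: `TPlus` preserves filtered colimits, and being an
equivalence amounts to conditions each of which involves finitely many arrows, so every small piece
of a weak equivalence lies in a small piece that is itself a weak equivalence (`exists_small_weq`).
A weak equivalence with the right lifting property against the generators is therefore a trivial
fibration (`tf_of_gen`), and the small object argument concludes (`fib_llp`).

Fibrant objects and the fibrations between them are recognized by lifting up to equivalence and
correcting along an isofibration (`exists_lift`). Conversely a fibrant object is a retract of the
mapping cylinder of its unit, which is cart-marked, and a fibration with cart-marked target lifts
isomorphisms because adding one isomorphic object is a trivial cofibration.

Throughout, categories are handled through their set of arrows: equality of arrows with varying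
endpoints replaces transports, filtered colimits become filtered colimits of sets, and small
categories can be moved into a fixed set. -/

/-- The arrows of a category, with varying source and target. -/
structure Arr (A : Type u) [Category.{u} A] : Type u where
  {src tgt : A}
  hom : src ⟶ tgt

namespace Arr

variable {A B D : Type u} [Category.{u} A] [Category.{u} B] [Category.{u} D]

theorem mk_inj {a b : A} {f g : a ⟶ b} : Arr.mk f = Arr.mk g ↔ f = g :=
  ⟨fun h => by injection h, fun h => by rw [h]⟩

/-- The bridge between equality of arrows with free endpoints, used almost everywhere below, and
equality up to `eqToHom`. -/
theorem mk_eq_mk_iff {a b a' b' : A} (f : a ⟶ b) (g : a' ⟶ b') :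
    Arr.mk f = Arr.mk g ↔ ∃ (h : a = a') (h' : b = b'), f = eqToHom h ≫ g ≫ eqToHom h'.symm := by
  constructor
  · intro h
    injection h with h₁ h₂ h₃
    subst h₁ h₂
    exact ⟨rfl, rfl, by simpa using h₃⟩
  · rintro ⟨rfl, rfl, h⟩
    simpa [mk_inj] using h

theorem mk_eqToHom_comp {a b c d : A} (p : a = b) (f : b ⟶ c) (q : c = d) :
    Arr.mk (eqToHom p ≫ f ≫ eqToHom q) = Arr.mk f := by
  subst p q
  simp

/-- The identity arrow. -/
abbrev id (a : A) : Arr A := ⟨𝟙 a⟩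

theorem id_inj {a b : A} : id a = id b ↔ a = b :=
  ⟨fun h => congrArg Arr.src h, fun h => by rw [h]⟩

/-- The action of a functor on arrows. -/
abbrev map (F : A ⥤ B) (m : Arr A) : Arr B := ⟨F.map m.hom⟩

theorem map_id (F : A ⥤ B) (a : A) : map F (id a) = id (F.obj a) := by
  simp [map, id]

/-- Identities are arrows, so the action on arrows already determines the action on objects, and no
transports appear in the hypothesis. -/
theorem functor_ext {F G : A ⥤ B} (h : ∀ m, map F m = map G m) : F = G := by
  refine CategoryTheory.Functor.ext (fun a => congrArg Arr.src (h (id a))) fun a b f => ?_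
  obtain ⟨h₁, h₂, h₃⟩ := (mk_eq_mk_iff _ _).1 (h ⟨f⟩)
  exact h₃

/-- The composition relation on arrows. -/
inductive Comp : Arr A → Arr A → Arr A → Prop
  | mk {a b c : A} (f : a ⟶ b) (g : b ⟶ c) : Comp ⟨f⟩ ⟨g⟩ ⟨f ≫ g⟩

theorem Comp.map {m n p : Arr A} (h : Comp m n p) (F : A ⥤ B) :
    Comp (map F m) (map F n) (map F p) := by
  obtain ⟨f, g⟩ := h
  simpa [Arr.map] using Comp.mk (F.map f) (F.map g)

theorem Comp.tgt_eq {m n p : Arr A} (h : Comp m n p) : m.tgt = n.src := by cases h; rfl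

theorem Comp.src_eq {m n p : Arr A} (h : Comp m n p) : p.src = m.src := by cases h; rfl

theorem Comp.tgt_eq' {m n p : Arr A} (h : Comp m n p) : p.tgt = n.tgt := by cases h; rfl

theorem Comp.exists {m n : Arr A} (h : m.tgt = n.src) : ∃ p, Comp m n p := by
  obtain ⟨f⟩ := m
  obtain ⟨g⟩ := n
  cases h
  exact ⟨_, .mk f g⟩

theorem Comp.iff_of_hom {a b c : A} (f : a ⟶ b) (g : b ⟶ c) (p : Arr A) :
    Comp ⟨f⟩ ⟨g⟩ p ↔ p = ⟨f ≫ g⟩ := by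
  constructor
  · generalize hm : Arr.mk f = m
    generalize hn : Arr.mk g = n
    rintro ⟨f', g'⟩
    cases hm
    cases hn
    rfl
  · rintro rfl
    exact .mk f g

theorem Comp.unique {m n p p' : Arr A} (h : Comp m n p) (h' : Comp m n p') : p = p' := by
  obtain ⟨f, g⟩ := h
  exact ((iff_of_hom _ _ _).1 h').symm

end Arr

/-- A small category presented by its set of arrows, with identities serving as objects. -/
structure SSCat (M : Type u) where
  s : M → M
  t : M → M
  comp : M → M → M → Prop
  ss : ∀ m, s (s m) = s m
  ts : ∀ m, t (s m) = s m
  st : ∀ m, s (t m) = t m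
  tt : ∀ m, t (t m) = t m
  comp_t : ∀ {m n p}, comp m n p → t m = s n
  comp_s : ∀ {m n p}, comp m n p → s p = s m
  comp_t' : ∀ {m n p}, comp m n p → t p = t n
  comp_exists : ∀ {m n}, t m = s n → ∃ p, comp m n p
  comp_unique : ∀ {m n p p'}, comp m n p → comp m n p' → p = p'
  s_comp : ∀ m, comp (s m) m m
  comp_id : ∀ m, comp m (t m) m
  assoc : ∀ {m n p q r x}, comp m n p → comp p q r → comp n q x → comp m x r

namespace SSCat

variable {M N : Type u} (S : SSCat M) (T : SSCat N)

/-- The objects of the category presented by `S`. -/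
@[ext]
structure Obj : Type u where
  val : M
  prop : S.s val = val

variable {S}

theorem Obj.t_val (x : S.Obj) : S.t x.val = x.val := by
  rw [← x.prop, S.ts]

noncomputable instance : Category.{u} S.Obj where
  Hom x y := { m : M // S.s m = x.val ∧ S.t m = y.val }
  id x := ⟨x.val, x.prop, x.t_val⟩
  comp {x y z} f g := by
    have h := S.comp_exists (f.2.2.trans g.2.1.symm)
    exact ⟨h.choose, (S.comp_s h.choose_spec).trans f.2.1, (S.comp_t' h.choose_spec).trans g.2.2⟩
  id_comp {x y} f := by
    refine Subtype.ext (S.comp_unique (S.comp_exists (x.t_val.trans f.2.1.symm)).choose_spec ?_)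
    have h := S.s_comp f.1
    rwa [f.2.1] at h
  comp_id {x y} f := by
    refine Subtype.ext (S.comp_unique (S.comp_exists (f.2.2.trans y.prop.symm)).choose_spec ?_)
    have h := S.comp_id f.1
    rwa [f.2.2] at h
  assoc {x y z w} f g h := by
    refine Subtype.ext (S.comp_unique
      (S.assoc (S.comp_exists (f.2.2.trans g.2.1.symm)).choose_spec (Exists.choose_spec _)
      (S.comp_exists (g.2.2.trans h.2.1.symm)).choose_spec) (Exists.choose_spec _))

theorem comp_val {x y z : S.Obj} (f : x ⟶ y) (g : y ⟶ z) : S.comp f.1 g.1 (f ≫ g).1 :=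
  (S.comp_exists (f.2.2.trans g.2.1.symm)).choose_spec

variable (S) in
/-- Morphisms of single-sorted categories. -/
structure IsMap (φ : M → N) : Prop where
  s : ∀ m, φ (S.s m) = T.s (φ m)
  t : ∀ m, φ (S.t m) = T.t (φ m)
  comp : ∀ {m n p}, S.comp m n p → T.comp (φ m) (φ n) (φ p)

/-- The action of a morphism of single-sorted categories on objects. -/
def IsMap.obj {T : SSCat N} {φ : M → N} (h : IsMap S T φ) (x : S.Obj) : T.Obj :=
  ⟨φ x.val, by rw [← h.s, x.prop]⟩

/-- The action of a morphism of single-sorted categories on morphisms. -/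
def IsMap.hom {T : SSCat N} {φ : M → N} (h : IsMap S T φ) {x y : S.Obj} (f : x ⟶ y) :
    h.obj x ⟶ h.obj y :=
  ⟨φ f.1, by rw [← h.s, f.2.1]; rfl, by rw [← h.t, f.2.2]; rfl⟩

/-- The functor induced by a morphism of single-sorted categories. -/
noncomputable def IsMap.functor {T : SSCat N} {φ : M → N} (h : IsMap S T φ) : S.Obj ⥤ T.Obj where
  obj := h.obj
  map := h.hom
  map_id _ := rfl
  map_comp f g := Subtype.ext (T.comp_unique (h.comp (comp_val f g)) (comp_val (h.hom f) (h.hom g)))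

theorem IsMap.functor_map {T : SSCat N} {φ : M → N} (h : IsMap S T φ) {x y : S.Obj} (f : x ⟶ y) :
    (h.functor.map f).1 = φ f.1 := rfl

variable (S) in
/-- The arrows of the category presented by `S`. -/
def arrEquiv : Arr S.Obj ≃ M where
  toFun m := m.hom.1
  invFun m := ⟨(⟨m, rfl, rfl⟩ : (⟨S.s m, S.ss m⟩ : S.Obj) ⟶ ⟨S.t m, S.st m⟩)⟩
  left_inv := by
    rintro ⟨⟨m, h₁, h₂⟩⟩
    rename_i x y
    obtain ⟨x, hx⟩ := x
    obtain ⟨y, hy⟩ := y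
    dsimp only at h₁ h₂
    subst h₁ h₂
    rfl
  right_inv m := rfl

/-- The single-sorted category of the arrows of a category. -/
@[simps]
def ofCat (A : Type u) [Category.{u} A] : SSCat (Arr A) where
  s m := .id m.src
  t m := .id m.tgt
  comp := Arr.Comp
  ss _ := rfl
  ts _ := rfl
  st _ := rfl
  tt _ := rfl
  comp_t h := congrArg Arr.id h.tgt_eq
  comp_s h := congrArg Arr.id h.src_eq
  comp_t' h := congrArg Arr.id h.tgt_eq'
  comp_exists h := Arr.Comp.exists (Arr.id_inj.1 h)
  comp_unique h h' := h.unique h'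
  s_comp m := (Arr.Comp.iff_of_hom _ _ _).2 (by rw [Category.id_comp])
  comp_id m := (Arr.Comp.iff_of_hom _ _ _).2 (by rw [Category.comp_id])
  assoc {m n p q r x} h h' h'' := by
    obtain ⟨f, g⟩ := h
    obtain ⟨k⟩ := q
    obtain rfl : _ = _ := h'.tgt_eq
    rw [Arr.Comp.iff_of_hom] at h' h''
    rw [h', h'', Arr.Comp.iff_of_hom, Category.assoc]

section

variable (A : Type u) [Category.{u} A]

/-- A category is isomorphic to the category presented by its arrows. -/
noncomputable def pack : A ⥤ (ofCat A).Obj where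
  obj a := ⟨.id a, rfl⟩
  map f := ⟨⟨f⟩, rfl, rfl⟩
  map_id _ := rfl
  map_comp f g := Subtype.ext
    (((Arr.Comp.iff_of_hom _ _ _).1 (comp_val (S := ofCat A) ⟨⟨f⟩, rfl, rfl⟩ ⟨⟨g⟩, rfl, rfl⟩)).symm)

variable {A} in
theorem src_eq {x y : (ofCat A).Obj} (f : x ⟶ y) : x.val.src = f.1.src :=
  (congrArg Arr.src f.2.1).symm

variable {A} in
theorem tgt_eq {x y : (ofCat A).Obj} (f : x ⟶ y) : f.1.tgt = y.val.src :=
  congrArg Arr.src f.2.2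

variable {A} in
theorem mk_unpack {x y : (ofCat A).Obj} (f : x ⟶ y) :
    Arr.mk (eqToHom (src_eq f) ≫ f.1.hom ≫ eqToHom (tgt_eq f)) = f.1 :=
  Arr.mk_eqToHom_comp _ _ _

/-- The inverse of `pack`. -/
noncomputable def unpack : (ofCat A).Obj ⥤ A where
  obj x := x.val.src
  map f := eqToHom (src_eq f) ≫ f.1.hom ≫ eqToHom (tgt_eq f)
  map_id x := Arr.mk_inj.1 ((mk_unpack (𝟙 x)).trans x.prop.symm)
  map_comp {x y z} f g := by
    refine Arr.mk_inj.1 ((mk_unpack (f ≫ g)).trans ?_)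
    refine (comp_val f g).unique ?_
    conv => arg 1; rw [← mk_unpack f]
    conv => arg 2; rw [← mk_unpack g]
    exact .mk _ _

variable {A}

theorem map_unpack {x y : (ofCat A).Obj} (f : x ⟶ y) : Arr.mk ((unpack A).map f) = f.1 :=
  mk_unpack f

end

end SSCat

section

variable {A B : Type u} [Category.{u} A] [Category.{u} B]

/-- The functor given by its action on arrows. -/
noncomputable def functorOfArr (φ : Arr A → Arr B) (h : SSCat.IsMap (.ofCat A) (.ofCat B) φ) :
    A ⥤ B :=
  SSCat.pack A ⋙ h.functor ⋙ SSCat.unpack B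

theorem functorOfArr_map (φ : Arr A → Arr B) (h) (m : Arr A) :
    Arr.map (functorOfArr φ h) m = φ m :=
  (SSCat.map_unpack (h.functor.map ((SSCat.pack A).map m.hom))).trans
    (SSCat.IsMap.functor_map h _)

theorem isMap_map (F : A ⥤ B) : SSCat.IsMap (.ofCat A) (.ofCat B) (Arr.map F) where
  s m := Arr.map_id F m.src
  t m := Arr.map_id F m.tgt
  comp h := h.map F

end

open Limits

/-! ### Filtered colimits of categories -/

section FilteredColimit

/-- The action of a morphism of `Cat` on arrows. -/
def arrMap {A B : Cat.{u, u}} (f : A ⟶ B) : Arr A → Arr B := Arr.map f.toFunctor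

theorem arrMap_comp {A B D : Cat.{u, u}} (f : A ⟶ B) (g : B ⟶ D) (m : Arr A) :
    arrMap (f ≫ g) m = arrMap g (arrMap f m) := rfl

theorem arrMap_id {A : Cat.{u, u}} (m : Arr A) : arrMap (𝟙 A) m = m := rfl

theorem arrMap_mk_id {A B : Cat.{u, u}} (f : A ⟶ B) (a : A) :
    arrMap f (.id a) = .id (f.toFunctor.obj a) := Arr.map_id _ _

theorem Arr.Comp.arrMap {A B : Cat.{u, u}} {m n p : Arr A} (h : Arr.Comp m n p) (f : A ⟶ B) :
    Arr.Comp (arrMap f m) (arrMap f n) (arrMap f p) := h.map _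

theorem cat_hom_ext {A B : Cat.{u, u}} {f g : A ⟶ B} (h : ∀ m, arrMap f m = arrMap g m) : f = g :=
  Cat.ext (Arr.functor_ext h)

variable {J : Type u} [SmallCategory J] {F : J ⥤ Cat.{u, u}}

/-- The action on arrows of a cocone leg. -/
def arrι (c : Cocone F) (j : J) : Arr (F.obj j) → Arr c.pt :=
  arrMap (A := F.obj j) (B := c.pt) (c.ι.app j)

/-- The action on objects of a cocone leg. -/
def objι (c : Cocone F) (j : J) (a : F.obj j) : c.pt := (c.ι.app j).toFunctor.obj a

theorem arrι_mk_id (c : Cocone F) (j : J) (a : F.obj j) : arrι c j (.id a) = .id (objι c j a) :=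
  arrMap_mk_id (A := F.obj j) (B := c.pt) (c.ι.app j) a

theorem Arr.Comp.arrι {j : J} {m n p : Arr (F.obj j)} (h : Arr.Comp m n p) (c : Cocone F) :
    Arr.Comp (arrι c j m) (arrι c j n) (arrι c j p) :=
  h.arrMap (A := F.obj j) (B := c.pt) (c.ι.app j)

/-- On arrows, the cocone `c` is a filtered colimit cocone of sets. -/
structure IsArrColimit (c : Cocone F) : Prop where
  surj : ∀ m : Arr c.pt, ∃ (j : J) (n : Arr (F.obj j)), arrι c j n = m
  inj : ∀ (j : J) (m n : Arr (F.obj j)), arrι c j m = arrι c j n →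
    ∃ (k : J) (h : j ⟶ k), arrMap (F.map h) m = arrMap (F.map h) n

theorem arrι_w (c : Cocone F) {j k : J} (h : j ⟶ k) (m : Arr (F.obj j)) :
    arrι c k (arrMap (F.map h) m) = arrι c j m := by
  exact congrArg (fun f : F.obj j ⟶ c.pt => arrMap f m) (c.w h)

theorem arrMap_map_comp (F : J ⥤ Cat.{u, u}) {j k l : J} (h : j ⟶ k) (h' : k ⟶ l)
    (m : Arr (F.obj j)) :
    arrMap (F.map (h ≫ h')) m = arrMap (F.map h') (arrMap (F.map h) m) := by
  rw [F.map_comp, arrMap_comp]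

theorem isMap_arrι (c : Cocone F) (j : J) :
    SSCat.IsMap (.ofCat (F.obj j)) (.ofCat c.pt) (arrι c j) :=
  isMap_map (c.ι.app j).toFunctor

variable {c : Cocone F}

namespace IsArrColimit

theorem obj_stage (hc : IsArrColimit c) {j : J} {a b : F.obj j}
    (e : objι c j a = objι c j b) :
    ∃ (k : J) (h : j ⟶ k), (F.map h).toFunctor.obj a = (F.map h).toFunctor.obj b := by
  obtain ⟨k, h, e'⟩ := hc.inj j (.id a) (.id b) (by rw [arrι_mk_id, arrι_mk_id, e])
  exact ⟨k, h, congrArg Arr.src e'⟩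

/-- Once the endpoints agree at a stage, a composite exists there. It has the same image in the
colimit as `p`, by uniqueness of composites, and hence equals `p` at a later stage. -/
theorem comp_stage (hc : IsArrColimit c) {j : J} {m n p : Arr (F.obj j)}
    (e : Arr.Comp (arrι c j m) (arrι c j n) (arrι c j p)) :
    ∃ (k : J) (h : j ⟶ k),
      Arr.Comp (arrMap (F.map h) m) (arrMap (F.map h) n) (arrMap (F.map h) p) := by
  obtain ⟨k, h, e₁⟩ := hc.obj_stage e.tgt_eq
  obtain ⟨q, hq⟩ := Arr.Comp.exists (m := arrMap (F.map h) m) (n := arrMap (F.map h) n) e₁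
  have hq' := hq.arrι c
  rw [arrι_w, arrι_w] at hq'
  obtain ⟨l, h', e₂⟩ := hc.inj k q (arrMap (F.map h) p) (by rw [arrι_w]; exact hq'.unique e)
  refine ⟨l, h ≫ h', ?_⟩
  rw [arrMap_map_comp, arrMap_map_comp, arrMap_map_comp, ← e₂]
  exact hq.arrMap _

variable [IsFiltered J]

theorem eq_stage (hc : IsArrColimit c) {j k : J} {m : Arr (F.obj j)} {n : Arr (F.obj k)}
    (e : arrι c j m = arrι c k n) :
    ∃ (l : J) (h : j ⟶ l) (h' : k ⟶ l), arrMap (F.map h) m = arrMap (F.map h') n := by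
  obtain ⟨l, h, e'⟩ := hc.inj (IsFiltered.max j k) (arrMap (F.map (IsFiltered.leftToMax j k)) m)
    (arrMap (F.map (IsFiltered.rightToMax j k)) n) (by rw [arrι_w, arrι_w, e])
  exact ⟨l, _ ≫ h, _ ≫ h, by rw [arrMap_map_comp, e', arrMap_map_comp]⟩

theorem exists_comp (hc : IsArrColimit c) {m n p : Arr c.pt} (e : Arr.Comp m n p) :
    ∃ (j : J) (m' n' p' : Arr (F.obj j)), Arr.Comp m' n' p' ∧ arrι c j m' = m ∧
      arrι c j n' = n ∧ arrι c j p' = p := by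
  obtain ⟨j, m, rfl⟩ := hc.surj m
  obtain ⟨k, n, rfl⟩ := hc.surj n
  have e₁ : arrι c j (.id m.tgt) = arrι c k (.id n.src) := by
    rw [arrι_mk_id, arrι_mk_id]
    exact congrArg Arr.id e.tgt_eq
  obtain ⟨l, h, h', e₂⟩ := hc.eq_stage e₁
  obtain ⟨q, hq⟩ := Arr.Comp.exists (m := arrMap (F.map h) m) (n := arrMap (F.map h') n)
    (congrArg Arr.src e₂)
  refine ⟨l, _, _, q, hq, arrι_w _ _ _, arrι_w _ _ _, ?_⟩
  have := hq.arrι c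
  rw [arrι_w, arrι_w] at this
  exact this.unique e

section Desc

variable (hc : IsArrColimit c) (d : Cocone F)

/-- The action on arrows of the functor induced by a cocone. -/
noncomputable def descArr (m : Arr c.pt) : Arr d.pt :=
  arrι d (hc.surj m).choose (hc.surj m).choose_spec.choose

theorem descArr_map (j : J) (m : Arr (F.obj j)) :
    hc.descArr d (arrι c j m) = arrι d j m := by
  obtain ⟨l, h, h', e⟩ := hc.eq_stage (hc.surj (arrι c j m)).choose_spec.choose_spec
  rw [descArr, ← arrι_w d h, e, arrι_w]

theorem isMap_descArr : SSCat.IsMap (.ofCat c.pt) (.ofCat d.pt) (hc.descArr d) where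
  s m := by
    obtain ⟨j, m, rfl⟩ := hc.surj m
    have h := (isMap_arrι c j).s m
    rw [← h, descArr_map, descArr_map]
    exact (isMap_arrι d j).s m
  t m := by
    obtain ⟨j, m, rfl⟩ := hc.surj m
    have h := (isMap_arrι c j).t m
    rw [← h, descArr_map, descArr_map]
    exact (isMap_arrι d j).t m
  comp {m n p} h := by
    obtain ⟨j, m, n, p, h', rfl, rfl, rfl⟩ := hc.exists_comp h
    rw [descArr_map, descArr_map, descArr_map]
    exact h'.arrι d

/-- The functor induced by a cocone. -/
noncomputable def descHom : c.pt ⟶ d.pt :=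
  (functorOfArr (hc.descArr d) (hc.isMap_descArr d)).toCatHom

theorem arrMap_descHom (m : Arr c.pt) : arrMap (hc.descHom d) m = hc.descArr d m :=
  functorOfArr_map _ _ _

/-- A cocone which is a colimit on arrows is a colimit. -/
noncomputable def isColimit : IsColimit c where
  desc d := hc.descHom d
  fac d j := cat_hom_ext fun m => by
    exact (hc.arrMap_descHom d (arrι c j m)).trans (hc.descArr_map d j m)
  uniq d f hf := cat_hom_ext fun m => by
    obtain ⟨j, m, rfl⟩ := hc.surj m
    rw [arrMap_descHom, descArr_map]
    exact congrArg (fun f : F.obj j ⟶ d.pt => arrMap f m) (hf j)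

end Desc

end IsArrColimit

variable [IsFiltered J]

section Construction

variable (F)

/-- Equality of arrows at a later stage. -/
def arrSetoid : Setoid (Σ j, Arr (F.obj j)) where
  r x y := ∃ (l : J) (h : x.1 ⟶ l) (h' : y.1 ⟶ l), arrMap (F.map h) x.2 = arrMap (F.map h') y.2
  iseqv :=
    { refl := fun x => ⟨x.1, 𝟙 _, 𝟙 _, rfl⟩
      symm := fun ⟨l, h, h', e⟩ => ⟨l, h', h, e.symm⟩
      trans := by
        rintro ⟨i, x⟩ ⟨j, y⟩ ⟨k, z⟩ ⟨l, h, h', e⟩ ⟨l', g, g', e'⟩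
        dsimp only at *
        obtain ⟨o, a, b, w⟩ := IsFiltered.span h' g
        refine ⟨o, h ≫ a, g' ≫ b, ?_⟩
        rw [arrMap_map_comp, e, ← arrMap_map_comp, w, arrMap_map_comp, e', ← arrMap_map_comp] }

/-- The filtered colimit of the sets of arrows. -/
def ArrColim : Type u := Quotient (arrSetoid F)

variable {F}

/-- The image in the colimit of an arrow. -/
def ArrColim.mk {j : J} (m : Arr (F.obj j)) : ArrColim F := Quotient.mk (arrSetoid F) ⟨j, m⟩

namespace ArrColim

theorem mk_eq_iff {j k : J} {m : Arr (F.obj j)} {n : Arr (F.obj k)} : mk m = mk n ↔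
    ∃ (l : J) (h : j ⟶ l) (h' : k ⟶ l), arrMap (F.map h) m = arrMap (F.map h') n :=
  Quotient.eq (r := arrSetoid F)

theorem exists_rep (x : ArrColim F) : ∃ (j : J) (m : Arr (F.obj j)), mk m = x := by
  obtain ⟨⟨j, m⟩, h⟩ := Quotient.exists_rep x
  exact ⟨j, m, h⟩

theorem mk_map {j k : J} (h : j ⟶ k) (m : Arr (F.obj j)) : mk (arrMap (F.map h) m) = mk m :=
  mk_eq_iff.2 ⟨k, 𝟙 k, h, by rw [← arrMap_map_comp, Category.comp_id]⟩

/-- The source, as an identity arrow. -/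
def src (x : ArrColim F) : ArrColim F :=
  Quotient.liftOn (s := arrSetoid F) x (fun m => mk (.id m.2.src)) (by
    rintro ⟨i, x⟩ ⟨j, y⟩ ⟨l, h, h', e⟩
    refine mk_eq_iff.2 ⟨l, h, h', ?_⟩
    rw [arrMap_mk_id, arrMap_mk_id]
    exact congrArg (fun m => Arr.id m.src) e)

/-- The target, as an identity arrow. -/
def tgt (x : ArrColim F) : ArrColim F :=
  Quotient.liftOn (s := arrSetoid F) x (fun m => mk (.id m.2.tgt)) (by
    rintro ⟨i, x⟩ ⟨j, y⟩ ⟨l, h, h', e⟩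
    refine mk_eq_iff.2 ⟨l, h, h', ?_⟩
    rw [arrMap_mk_id, arrMap_mk_id]
    exact congrArg (fun m => Arr.id m.tgt) e)

theorem src_mk {j : J} (m : Arr (F.obj j)) : src (mk m) = mk (.id m.src) := rfl

theorem tgt_mk {j : J} (m : Arr (F.obj j)) : tgt (mk m) = mk (.id m.tgt) := rfl

/-- The composition relation. -/
inductive Comp : ArrColim F → ArrColim F → ArrColim F → Prop
  | mk {j : J} {m n p : Arr (F.obj j)} (h : Arr.Comp m n p) : Comp (.mk m) (.mk n) (.mk p)

theorem exists_composable {j k : J} {m : Arr (F.obj j)} {n : Arr (F.obj k)}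
    (e : tgt (mk m) = src (mk n)) : ∃ (l : J) (h : j ⟶ l) (h' : k ⟶ l),
      (arrMap (F.map h) m).tgt = (arrMap (F.map h') n).src := by
  obtain ⟨l, h, h', e⟩ := mk_eq_iff.1 e
  exact ⟨l, h, h', congrArg Arr.src e⟩

theorem Comp.exists {x y : ArrColim F} (e : tgt x = src y) : ∃ z, Comp x y z := by
  obtain ⟨j, m, rfl⟩ := exists_rep x
  obtain ⟨k, n, rfl⟩ := exists_rep y
  obtain ⟨l, h, h', e⟩ := exists_composable e
  obtain ⟨p, hp⟩ := Arr.Comp.exists e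
  rw [← mk_map h, ← mk_map h']
  exact ⟨_, .mk hp⟩

theorem Comp.tgt_eq {x y z : ArrColim F} (h : Comp x y z) : tgt x = src y := by
  obtain ⟨h⟩ := h
  rw [tgt_mk, src_mk, h.tgt_eq]

theorem Comp.unique {x y z z' : ArrColim F} (h : Comp x y z) (h' : Comp x y z') : z = z' := by
  obtain @⟨j, m, n, p, h⟩ := h
  generalize hx : ArrColim.mk m = x at h'
  generalize hy : ArrColim.mk n = y at h'
  obtain @⟨k, m', n', p', h'⟩ := h'
  obtain ⟨l, f, f', e⟩ := mk_eq_iff.1 hx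
  obtain ⟨l', g, g', e'⟩ := mk_eq_iff.1 hy
  -- The first factors agree at stage `l` and the second ones at stage `l'`; the bowtie supplies one
  -- stage where both agreements hold along the same transition maps.
  obtain ⟨o, a, b, w, w'⟩ := IsFiltered.bowtie f g f' g'
  have h₁ := h.arrMap (F.map (f ≫ a))
  have h₂ := h'.arrMap (F.map (f' ≫ a))
  have e₁ : arrMap (F.map (f ≫ a)) m = arrMap (F.map (f' ≫ a)) m' := by
    rw [arrMap_map_comp, e, arrMap_map_comp]
  have e₂ : arrMap (F.map (f ≫ a)) n = arrMap (F.map (f' ≫ a)) n' := by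
    rw [w, w', arrMap_map_comp, e', arrMap_map_comp]
  rw [← mk_map (f ≫ a) p, ← mk_map (f' ≫ a) p']
  refine congrArg _ (Arr.Comp.unique h₁ ?_)
  rw [e₁, e₂]
  exact h₂

theorem Comp.assoc {m n p q r x : ArrColim F} (h₁ : Comp m n p) (h₂ : Comp p q r)
    (h₃ : Comp n q x) : Comp m x r := by
  obtain @⟨j, m, n, p, h⟩ := h₁
  obtain ⟨k, q, rfl⟩ := exists_rep q
  obtain ⟨l, f, f', e⟩ := exists_composable h₂.tgt_eq
  have h' := h.arrMap (F.map f)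
  obtain ⟨r', hr⟩ := Arr.Comp.exists e
  obtain ⟨x', hx⟩ := Arr.Comp.exists (h'.tgt_eq'.symm.trans e)
  have h₂' := Comp.mk hr
  have h₃' := Comp.mk hx
  rw [mk_map, mk_map] at h₂' h₃'
  obtain rfl := h₂.unique h₂'
  obtain rfl := h₃.unique h₃'
  rw [← mk_map f m]
  exact .mk ((SSCat.ofCat _).assoc h' hr hx)

variable (F) in
/-- The filtered colimit as a single-sorted category. -/
def ssCat : SSCat (ArrColim F) where
  s := src
  t := tgt
  comp := Comp
  ss x := by obtain ⟨j, m, rfl⟩ := exists_rep x; rfl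
  ts x := by obtain ⟨j, m, rfl⟩ := exists_rep x; rfl
  st x := by obtain ⟨j, m, rfl⟩ := exists_rep x; rfl
  tt x := by obtain ⟨j, m, rfl⟩ := exists_rep x; rfl
  comp_t h := h.tgt_eq
  comp_s h := by
    obtain ⟨h⟩ := h
    rw [src_mk, src_mk, h.src_eq]
  comp_t' h := by
    obtain ⟨h⟩ := h
    rw [tgt_mk, tgt_mk, h.tgt_eq']
  comp_exists h := Comp.exists h
  comp_unique h h' := h.unique h'
  s_comp x := by obtain ⟨j, m, rfl⟩ := exists_rep x; exact .mk ((SSCat.ofCat _).s_comp m)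
  comp_id x := by obtain ⟨j, m, rfl⟩ := exists_rep x; exact .mk ((SSCat.ofCat _).comp_id m)
  assoc h h' h'' := h.assoc h' h''

theorem isMap_mk (j : J) : SSCat.IsMap (.ofCat (F.obj j)) (ssCat F) mk where
  s _ := rfl
  t _ := rfl
  comp h := .mk h

/-- The functor from a stage to the filtered colimit. -/
noncomputable def ι (j : J) : F.obj j ⥤ (ssCat F).Obj :=
  SSCat.pack _ ⋙ (isMap_mk j).functor

variable (F) in
/-- The filtered colimit cocone. -/
noncomputable def cocone : Cocone F where
  pt := Cat.of (ssCat F).Obj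
  ι :=
    { app := fun j => (ι j).toCatHom
      naturality := fun _ _ h => cat_hom_ext fun m => (ssCat F).arrEquiv.injective (mk_map h m) }

theorem isArrColimit_cocone : IsArrColimit (cocone F) where
  surj m := by
    obtain ⟨j, n, h⟩ := exists_rep ((ssCat F).arrEquiv m)
    exact ⟨j, n, (ssCat F).arrEquiv.injective h⟩
  inj j m n h := by
    have h : mk m = mk n := congrArg (ssCat F).arrEquiv h
    obtain ⟨l, h, h', e⟩ := mk_eq_iff.1 h
    obtain ⟨o, a, w⟩ := IsFilteredOrEmpty.cocone_maps h h'
    refine ⟨o, h ≫ a, ?_⟩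
    rw [arrMap_map_comp, e, ← arrMap_map_comp, ← w]

end ArrColim

end Construction

/-- The explicit cocone is a colimit with the required properties on arrows, and these pass along
the comparison isomorphism. -/
theorem IsArrColimit.of_isColimit (hc : IsColimit c) : IsArrColimit c := by
  let e := hc.coconePointUniqueUpToIso (ArrColim.isArrColimit_cocone (F := F)).isColimit
  have he (j : J) (m : Arr (F.obj j)) : arrι (ArrColim.cocone F) j m =
      arrMap e.hom (arrι c j m) := by
    exact congrArg (fun f : F.obj j ⟶ (ArrColim.cocone F).pt => arrMap f m)
      (hc.comp_coconePointUniqueUpToIso_hom ArrColim.isArrColimit_cocone.isColimit j).symm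
  constructor
  · intro m
    obtain ⟨j, n, h⟩ := ArrColim.isArrColimit_cocone.surj (arrMap e.hom m)
    refine ⟨j, n, ?_⟩
    rw [he] at h
    have := congrArg (arrMap e.inv) h
    rwa [← arrMap_comp, ← arrMap_comp, e.hom_inv_id] at this
  · intro j m n h
    refine ArrColim.isArrColimit_cocone.inj j m n ?_
    rw [he, he, h]

end FilteredColimit

open Limits

/-! ### Limits and colimits of marked categories -/

namespace MarkedCat

/-- A morphism of marked categories acts on arrows. -/
def arrMap {A B : MarkedCat.{u}} (F : A ⟶ B) : Arr A → Arr B := Arr.map F.toFunctor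

theorem arrMap_comp {A B D : MarkedCat.{u}} (F : A ⟶ B) (G : B ⟶ D) (m : Arr A) :
    arrMap (F ≫ G) m = arrMap G (arrMap F m) := rfl

theorem hom_ext_arr {A B : MarkedCat.{u}} {F G : A ⟶ B} (h : ∀ m, arrMap F m = arrMap G m) :
    F = G :=
  hom_ext (Arr.functor_ext h)

theorem cat_arr_congr {A B : Cat.{u, u}} {f g : A ⟶ B} (h : f = g) (m : Arr A) :
    Arr.map f.toFunctor m = Arr.map g.toFunctor m := by rw [h]

/-- The marking on arrows. -/
def IsMarked {A : MarkedCat.{u}} (m : Arr A) : Prop := A.marked m.hom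

theorem isMarked_id {A : MarkedCat.{u}} (a : A) : IsMarked (Arr.id a) := A.id_marked a

theorem IsMarked.map {A B : MarkedCat.{u}} {m : Arr A} (h : IsMarked m) (F : A ⟶ B) :
    IsMarked (arrMap F m) := F.map_marked _ h

/-- The forgetful functor to small categories. -/
def toCat : MarkedCat.{u} ⥤ Cat.{u, u} where
  obj A := Cat.of A
  map F := F.toFunctor.toCatHom

variable {J : Type u} [SmallCategory J] (F : J ⥤ MarkedCat.{u})

section Limit

variable (c : Cone (F ⋙ toCat))

/-- The action on arrows of a leg of a cone. -/
def arrπ (j : J) (m : Arr c.pt) : Arr (F.obj j) := Arr.map (B := F.obj j) (c.π.app j).toFunctor m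

/-- The initial marking on the point of a cone. -/
def limitMarked : MarkedCat.{u} where
  carrier := c.pt
  marked _ _ f := ∀ j, IsMarked (arrπ F c j ⟨f⟩)
  id_marked a j := by
    have h : arrπ F c j (.id a) = .id _ := Arr.map_id _ _
    rw [h]
    exact isMarked_id _

/-- The cone with the initial marking. -/
def limitCone : Cone F where
  pt := limitMarked F c
  π :=
    { app := fun j => { toFunctor := (c.π.app j).toFunctor, map_marked := fun _ _ _ h => h j }
      naturality := fun _ _ f => hom_ext (congrArg Cat.Hom.toFunctor (c.π.naturality f)) }

variable {F c} in
/-- The cone with the initial marking is a limit cone. -/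
def isLimitLimitCone (hc : IsLimit c) : IsLimit (limitCone F c) where
  lift s :=
    { toFunctor := (hc.lift (toCat.mapCone s)).toFunctor
      map_marked := fun a b f hf j => by
        have h : arrπ F c j (Arr.map (hc.lift (toCat.mapCone s)).toFunctor ⟨f⟩) =
            arrMap (s.π.app j) ⟨f⟩ :=
          cat_arr_congr (hc.fac (toCat.mapCone s) j) ⟨f⟩
        exact (congrArg IsMarked h).mpr (IsMarked.map (m := ⟨f⟩) hf _) }
  fac s j := hom_ext (congrArg Cat.Hom.toFunctor (hc.fac (toCat.mapCone s) j))
  uniq s f hf := hom_ext (congrArg Cat.Hom.toFunctor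
    (hc.uniq (toCat.mapCone s) (toCat.map f) fun j => congrArg toCat.map (hf j)))

instance : HasLimits MarkedCat.{u} where
  has_limits_of_shape _ _ :=
    { has_limit := fun F => ⟨⟨_, isLimitLimitCone (limit.isLimit (F ⋙ toCat))⟩⟩ }

end Limit

section Colimit

variable (c : Cocone (F ⋙ toCat))

/-- The final marking on the point of a cocone. -/
def colimitMarked : MarkedCat.{u} where
  carrier := c.pt
  marked _ _ f := (∃ (j : J) (m : Arr (F.obj j)), IsMarked m ∧ arrι c j m = ⟨f⟩) ∨
    -- Identities are added by hand, which avoids proving that every object of a colimit of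
    -- categories comes from a stage.
    ∃ a, Arr.mk f = .id a
  id_marked a := Or.inr ⟨a, rfl⟩

/-- The cocone with the final marking. -/
def colimitCocone : Cocone F where
  pt := colimitMarked F c
  ι :=
    { app := fun j =>
        { toFunctor := (c.ι.app j).toFunctor
          map_marked := fun _ _ f h => Or.inl ⟨j, ⟨f⟩, h, rfl⟩ }
      naturality := fun _ _ f => hom_ext (congrArg Cat.Hom.toFunctor (c.ι.naturality f)) }

variable {F c} in
/-- The cocone with the final marking is a colimit cocone. -/
def isColimitColimitCocone (hc : IsColimit c) : IsColimit (colimitCocone F c) where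
  desc s :=
    { toFunctor := (hc.desc (toCat.mapCocone s)).toFunctor
      map_marked := fun a b f hf => by
        change IsMarked (A := s.pt) (MarkedGrothendieck.arrMap (hc.desc (toCat.mapCocone s)) ⟨f⟩)
        obtain ⟨j, m, hm, h⟩ | ⟨a, h⟩ := hf
        · rw [← h]
          have h : MarkedGrothendieck.arrMap (hc.desc (toCat.mapCocone s)) (arrι c j m) =
              arrMap (s.ι.app j) m :=
            cat_arr_congr (A := (F ⋙ toCat).obj j) (hc.fac (toCat.mapCocone s) j) m
          exact (congrArg (IsMarked (A := s.pt)) h).mpr (hm.map _)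
        · rw [h, arrMap_mk_id]
          exact isMarked_id (A := s.pt) _ }
  fac s j := hom_ext (congrArg Cat.Hom.toFunctor (hc.fac (toCat.mapCocone s) j))
  uniq s f hf := hom_ext (congrArg Cat.Hom.toFunctor
    (hc.uniq (toCat.mapCocone s) (toCat.map f) fun j => congrArg toCat.map (hf j)))

instance : HasColimits MarkedCat.{u} where
  has_colimits_of_shape _ _ :=
    { has_colimit := fun F => ⟨⟨_, isColimitColimitCocone (colimit.isColimit (F ⋙ toCat))⟩⟩ }

instance : PreservesColimits toCat.{u} where
  preservesColimitsOfShape :=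
    { preservesColimit := fun {F} => preservesColimit_of_preserves_colimit_cocone
        (isColimitColimitCocone (colimit.isColimit (F ⋙ toCat))) (colimit.isColimit (F ⋙ toCat)) }

end Colimit

variable {F} in
/-- A cocone of marked categories is a filtered colimit on arrows and on marked arrows. -/
structure IsArrColimit (c : Cocone F) : Prop where
  arr : MarkedGrothendieck.IsArrColimit (toCat.mapCocone c)
  marked : ∀ m : Arr c.pt, IsMarked m →
    ∃ (j : J) (n : Arr (F.obj j)), IsMarked n ∧ arrMap (c.ι.app j) n = m

variable {F} {c : Cocone F} [IsFiltered J]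

theorem IsArrColimit.of_isColimit (hc : IsColimit c) : IsArrColimit c where
  arr := .of_isColimit (isColimitOfPreserves toCat hc)
  marked m hm := by
    let hc' := isColimitOfPreserves toCat hc
    let e := hc.coconePointUniqueUpToIso (isColimitColimitCocone hc')
    have he (j : J) (m : Arr (F.obj j)) : arrMap e.inv (arrι (toCat.mapCocone c) j m) =
        arrMap (c.ι.app j) m :=
      congrArg (fun f : F.obj j ⟶ c.pt => arrMap f m)
        (hc.comp_coconePointUniqueUpToIso_inv (isColimitColimitCocone hc') j)
    have he' : arrMap e.inv (arrMap e.hom m) = m := by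
      rw [← arrMap_comp, e.hom_inv_id]
      rfl
    obtain ⟨j, n, hn, h⟩ | ⟨a, h⟩ := hm.map e.hom
    · refine ⟨j, n, hn, ?_⟩
      rw [← he, h]
      exact he'
    -- For a filtered diagram every object does come from a stage, so an identity marked by
    -- definition is the image of an identity.
    · obtain ⟨j, n, hn⟩ := (MarkedGrothendieck.IsArrColimit.of_isColimit hc').surj (.id a)
      let x : F.obj j := n.src
      refine ⟨j, .id x, isMarked_id _, ?_⟩
      have h₂ : arrι (toCat.mapCocone c) j (.id x) = .id a :=
        (arrι_mk_id _ _ _).trans (congrArg (fun m => Arr.id m.src) hn)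
      exact (he _ _).symm.trans ((congrArg (arrMap e.inv) (h₂.trans h.symm)).trans he')

/-- A cocone which is a colimit on arrows and on marked arrows is a colimit. -/
noncomputable def IsArrColimit.isColimit (hc : IsArrColimit c) : IsColimit c where
  desc s :=
    { toFunctor := (hc.arr.isColimit.desc (toCat.mapCocone s)).toFunctor
      map_marked := fun a b f hf => by
        obtain ⟨j, n, hn, h⟩ := hc.marked ⟨f⟩ hf
        have h' : Arr.map (hc.arr.isColimit.desc (toCat.mapCocone s)).toFunctor
            (arrMap (c.ι.app j) n) = arrMap (s.ι.app j) n :=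
          cat_arr_congr (A := (F ⋙ toCat).obj j) (hc.arr.isColimit.fac (toCat.mapCocone s) j) n
        exact (congrArg (IsMarked (A := s.pt)) ((congrArg (Arr.map (hc.arr.isColimit.desc
          (toCat.mapCocone s)).toFunctor) h.symm).trans h')).mpr (hn.map _) }
  fac s j := hom_ext (congrArg Cat.Hom.toFunctor (hc.arr.isColimit.fac (toCat.mapCocone s) j))
  uniq s f hf := hom_ext (congrArg Cat.Hom.toFunctor
    (hc.arr.isColimit.uniq (toCat.mapCocone s) (toCat.map f) fun j => congrArg toCat.map (hf j)))

end MarkedCat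

section

variable (C : Type u) [Category.{u} C]

instance : HasFiniteLimits (Over (MarkedCat.sharp C)) := Over.hasFiniteLimits

end

/-! ### The adjunction `T⁺ ⊣ ∫⁺` -/

section Arrows

variable {A B : Type u} [Category.{u} A] [Category.{u} B]

theorem Arr.mk_comp_eqToHom {a b c : A} (f : a ⟶ b) (p : b = c) :
    Arr.mk (f ≫ eqToHom p) = Arr.mk f := by
  subst p
  simp

theorem Arr.mk_eqToHom {a b : A} (h : a = b) : Arr.mk (eqToHom h) = .id a := by
  subst h
  rfl

theorem Arr.map_congr {F G : A ⥤ B} (h : F = G) (m : Arr A) : Arr.map F m = Arr.map G m := by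
  rw [h]

theorem loc_functor_ext {W : MorphismProperty A} {F G : W.Localization ⥤ B}
    (h : ∀ m : Arr A, Arr.map F (Arr.map W.Q m) = Arr.map G (Arr.map W.Q m)) : F = G :=
  Localization.Construction.uniq _ _ (Arr.functor_ext h)

theorem arr_map_lift {W : MorphismProperty A} (F : A ⥤ B) (hF : W.IsInvertedBy F) (m : Arr A) :
    Arr.map (Localization.Construction.lift F hF) (Arr.map W.Q m) = Arr.map F m :=
  Arr.map_congr (Localization.Construction.fac F hF) m

theorem arr_map_locMap {A B : MarkedCat.{u}} (F : A ⟶ B) (m : Arr A) :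
    Arr.map (MarkedCat.locMap F) (Arr.map A.marked.Q m) = Arr.map B.marked.Q (Arr.map F.toFunctor m) :=
  Arr.map_congr (MarkedCat.Q_locMap F) m

end Arrows

variable {C : Type u} [Category.{u} C]

/-- The structure map of the target is the structure map of the source composed with the image of
the component, so source and component determine the whole arrow. -/
theorem comma_arr_ext {P : Over (MarkedCat.sharp C)} {c : C}
    {X Y X' Y' : StructuredArrow c (proj P)} {g : X ⟶ Y} {g' : X' ⟶ Y'}
    (h : Arr.mk g.right = Arr.mk g'.right)
    (h' : Arr.mk (src := c) (tgt := (proj P).obj X.right) X.hom =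
      Arr.mk (src := c) (tgt := (proj P).obj X'.right) X'.hom) : Arr.mk g = Arr.mk g' := by
  obtain ⟨h₁, h₂, h₃⟩ := (Arr.mk_eq_mk_iff _ _).1 h
  obtain ⟨h₄, h₅, h₆⟩ := (Arr.mk_eq_mk_iff _ _).1 h'
  have e : X = X' := comma_obj_ext h₁ (by rw [h₆]; simp)
  subst e
  have e : Y = Y' := by
    refine comma_obj_ext h₂ ?_
    rw [← StructuredArrow.w g, ← StructuredArrow.w g', h₃]
    simp [eqToHom_map]
  subst e
  rw [Arr.mk_inj]
  ext
  simpa using h₃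

theorem groth_arr_ext {F : Cᵒᵖ ⥤ Cat.{u, u}} {c d : C} (b : c ⟶ d) {x x' : F.obj (op c)}
    {y y' : F.obj (op d)} (φ : x ⟶ (F.map b.op).toFunctor.obj y)
    (φ' : x' ⟶ (F.map b.op).toFunctor.obj y') (hy : y = y') (h : Arr.mk φ = Arr.mk φ') :
    Arr.mk (src := (⟨c, x⟩ : Groth F)) (tgt := ⟨d, y⟩) (Groth.Hom.mk b φ) =
      Arr.mk (src := (⟨c, x'⟩ : Groth F)) (tgt := ⟨d, y'⟩) (Groth.Hom.mk b φ') := by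
  subst hy
  obtain rfl : x = x' := congrArg Arr.src h
  rw [Arr.mk_inj] at h
  rw [h]

theorem groth_hom_ext {F : Cᵒᵖ ⥤ Cat.{u, u}} {X Y : Groth F} {f g : X ⟶ Y}
    (h : Groth.Hom.base f = Groth.Hom.base g)
    (h' : Arr.mk (Groth.Hom.fiber f) = Arr.mk (Groth.Hom.fiber g)) : f = g :=
  Groth.hom_ext' h (Arr.mk_inj.1 ((Arr.mk_comp_eqToHom _ _).trans h'))

/-! #### The unit -/

section Unit

variable (P : Over (MarkedCat.sharp C))

/-- The localization functor `c ↓ P ⥤ (c ↓ P)[E_c⁻¹]`. -/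
noncomputable def locQ (c : C) :
    StructuredArrow c (proj P) ⥤ ((TPlus C).obj P).obj (op c) :=
  (comma P c).marked.Q

theorem arr_map_TPlus_map {c d : C} (f : c ⟶ d) (m : Arr (StructuredArrow d (proj P))) :
    Arr.map (((TPlus C).obj P).map f.op).toFunctor (Arr.map (locQ P d) m) =
      Arr.map (locQ P c) (Arr.map (StructuredArrow.map f) m) :=
  arr_map_locMap (commaPre P f) m

theorem TPlus_map_map {c d : C} (f : c ⟶ d) {X Y : StructuredArrow d (proj P)} (g : X ⟶ Y) :
    (((TPlus C).obj P).map f.op).toFunctor.map ((locQ P d).map g) =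
      (locQ P c).map ((StructuredArrow.map f).map g) :=
  Arr.mk_inj.1 (arr_map_TPlus_map P f ⟨g⟩)

/-- The initial object of the fibre over `a`. -/
abbrev idArrow (a : P.left) : StructuredArrow ((proj P).obj a) (proj P) := StructuredArrow.mk (𝟙 _)

/-- The morphism of `P a ↓ P` induced by `f : a ⟶ b`. -/
def idArrowHom {a b : P.left} (f : a ⟶ b) :
    idArrow P a ⟶ (StructuredArrow.map ((proj P).map f)).obj (idArrow P b) :=
  StructuredArrow.homMk f (by simp)

/-- The action of the unit on morphisms. -/
noncomputable def unitMap {a b : P.left} (f : a ⟶ b) :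
    (⟨(proj P).obj a, (locQ P _).obj (idArrow P a)⟩ : Groth ((TPlus C).obj P)) ⟶
      ⟨(proj P).obj b, (locQ P _).obj (idArrow P b)⟩ :=
  ⟨(proj P).map f, (locQ P _).map (idArrowHom P f)⟩

/-- The unit of the adjunction, as a functor. -/
noncomputable def unitFunctor : P.left ⥤ Groth ((TPlus C).obj P) where
  obj a := ⟨(proj P).obj a, (locQ P _).obj (idArrow P a)⟩
  map f := unitMap P f
  map_id a := by
    refine groth_hom_ext ((proj P).map_id a) ?_
    rw [Groth.id_fiber, Arr.mk_eqToHom]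
    refine Eq.trans ?_ (Arr.map_id (locQ P _) (idArrow P a))
    have h : Arr.mk (idArrowHom P (𝟙 a)) = Arr.id (idArrow P a) := comma_arr_ext rfl rfl
    exact congrArg (Arr.map (locQ P _)) h
  map_comp {a b c} f g := by
    refine groth_hom_ext ((proj P).map_comp f g) ?_
    rw [Groth.comp_fiber, ← Category.assoc, Arr.mk_comp_eqToHom]
    have e : (((TPlus C).obj P).map ((proj P).map f).op).toFunctor.map
        ((locQ P ((proj P).obj b)).map (idArrowHom P g)) = _ := TPlus_map_map P _ _
    change _ = Arr.mk ((locQ P _).map (idArrowHom P f) ≫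
      (((TPlus C).obj P).map ((proj P).map f).op).toFunctor.map
        ((locQ P ((proj P).obj b)).map (idArrowHom P g)))
    rw [e]
    refine Eq.trans ?_ (congrArg Arr.mk ((locQ P _).map_comp _ _))
    have h : Arr.mk (idArrowHom P (f ≫ g)) = Arr.mk (idArrowHom P f ≫
        (StructuredArrow.map ((proj P).map f)).map (idArrowHom P g)) := comma_arr_ext rfl rfl
    exact congrArg (Arr.map (locQ P _)) h

theorem isIso_locQ_map {c : C} {X Y : StructuredArrow c (proj P)} (g : X ⟶ Y)
    (hg : P.left.marked g.right) : IsIso ((locQ P c).map g) :=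
  MorphismProperty.Q_inverts _ g hg

/-- The unit of the adjunction. -/
noncomputable def unit : P ⟶ (groth C).obj ((TPlus C).obj P) :=
  Over.homMk
    { toFunctor := unitFunctor P
      map_marked := fun _ _ f hf => isIso_locQ_map P (idArrowHom P f) hf }
    (MarkedCat.hom_ext rfl)

end Unit

/-- The compatibility with the projections is a hypothesis about a free variable `p`, so it can be
eliminated. The `eqToHom` inside `commaMapFunctor` then become identities by computation. -/
theorem unit_naturality_aux {A : MarkedCat.{u}} (p : A ⟶ MarkedCat.sharp C)
    (Q : Over (MarkedCat.sharp C)) (F : A ⟶ Q.left) (e : F ≫ Q.hom = p) :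
    (Over.homMk F e : Over.mk p ⟶ Q) ≫ unit Q =
      unit _ ≫ (groth C).map ((TPlus C).map (Over.homMk F e)) := by
  subst e
  let F' : Over.mk (F ≫ Q.hom) ⟶ Q := Over.homMk F
  refine Over.OverMorphism.ext (MarkedCat.hom_ext_arr fun m => ?_)
  obtain ⟨f⟩ := m
  rename_i a b
  have hQ : Arr.map (locQ Q _) (Arr.map (commaMapFunctor F' _) ⟨idArrowHom (Over.mk (F ≫ Q.hom)) f⟩) =
      Arr.map (locQ Q _) ⟨idArrowHom Q (F.toFunctor.map f)⟩ :=
    congrArg (Arr.map (locQ Q _)) (comma_arr_ext rfl (Arr.mk_comp_eqToHom _ _))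
  have key (a : A) : (commaMapFunctor F' _).obj (idArrow (Over.mk (F ≫ Q.hom)) a) =
      idArrow Q (F.toFunctor.obj a) :=
    comma_obj_ext rfl (by
      change (𝟙 ((proj Q).obj (F.toFunctor.obj a)) ≫ 𝟙 _) ≫ 𝟙 _ = 𝟙 _
      simp)
  refine groth_arr_ext (F := (TPlus C).obj Q) ((proj Q).map (F.toFunctor.map f))
    (x := (locQ Q _).obj (idArrow Q _)) (x' := (locQ Q _).obj ((commaMapFunctor F' _).obj (idArrow _ a)))
    (y := (locQ Q _).obj (idArrow Q _)) (y' := (locQ Q _).obj ((commaMapFunctor F' _).obj (idArrow _ b)))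
    _ _ (congrArg _ (key b).symm) ?_
  refine Eq.trans hQ.symm ?_
  refine Eq.trans ?_ (Arr.mk_comp_eqToHom _ _).symm
  exact (arr_map_locMap (commaMap F' _) ⟨idArrowHom (Over.mk (F ≫ Q.hom)) f⟩).symm

/-- The unit is natural. -/
theorem unit_naturality {P Q : Over (MarkedCat.sharp C)} (F : P ⟶ Q) :
    F ≫ unit Q = unit P ≫ (groth C).map ((TPlus C).map F) :=
  unit_naturality_aux P.hom Q F.left (Over.w F)

/-! ### The counit and the triangle identities -/

section Counit

variable (F : Cᵒᵖ ⥤ Cat.{u, u})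

/-- The action of `F f` on arrows. -/
def pull {c d : C} (f : c ⟶ d) : Arr (F.obj (op d)) → Arr (F.obj (op c)) := arrMap (F.map f.op)

variable {F} in
theorem pull_pull {c d e : C} (f : c ⟶ d) (g : d ⟶ e) (m : Arr (F.obj (op e))) :
    pull F f (pull F g m) = pull F (f ≫ g) m := by
  rw [pull, pull, pull, op_comp, F.map_comp, arrMap_comp]

theorem pull_id {c : C} (m : Arr (F.obj (op c))) : pull F (𝟙 c) m = m := by
  rw [pull, op_id, F.map_id, arrMap_id]

variable {F} in
theorem Comp.pull {c d : C} {m n p : Arr (F.obj (op d))} (h : Arr.Comp m n p) (f : c ⟶ d) :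
    Arr.Comp (pull F f m) (pull F f n) (pull F f p) := h.arrMap _

theorem mk_id_fiber (X : Groth F) : Arr.mk (Groth.Hom.fiber (𝟙 X)) = Arr.id X.fiber :=
  Arr.mk_eqToHom (Groth.map_id_obj X.fiber).symm

variable {F} in
theorem comp_mk_fiber {X Y Z : Groth F} (f : X ⟶ Y) (g : Y ⟶ Z) :
    Arr.Comp (Arr.mk (Groth.Hom.fiber f)) (pull F (Groth.Hom.base f) ⟨Groth.Hom.fiber g⟩)
      ⟨Groth.Hom.fiber (f ≫ g)⟩ := by
  rw [Groth.comp_fiber, ← Category.assoc, Arr.mk_comp_eqToHom]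
  exact .mk _ _

/-- The structure morphism of an object of `c ↓ ∫ F`. -/
def baseHom {c : C} (X : StructuredArrow c (Groth.forget F)) : c ⟶ X.right.base := X.hom

variable {F} in
theorem baseHom_comp {c : C} {X Y : StructuredArrow c (Groth.forget F)} (g : X ⟶ Y) :
    baseHom F X ≫ Groth.Hom.base g.right = baseHom F Y := StructuredArrow.w g

theorem pullbackFunctor_aux {c : C} {X Y : StructuredArrow c (Groth.forget F)} (g : X ⟶ Y) :
    (F.map (baseHom F X).op).toFunctor.obj
        ((F.map (Groth.Hom.base g.right).op).toFunctor.obj Y.right.fiber) =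
      (F.map (baseHom F Y).op).toFunctor.obj Y.right.fiber := by
  rw [← baseHom_comp g]
  exact congrArg Arr.src (pull_pull (baseHom F X) (Groth.Hom.base g.right) (.id Y.right.fiber))

theorem mk_pullback_map {c : C} {X Y : StructuredArrow c (Groth.forget F)} (g : X ⟶ Y) :
    Arr.mk ((F.map (baseHom F X).op).toFunctor.map (Groth.Hom.fiber g.right) ≫
      eqToHom (pullbackFunctor_aux F g)) = pull F (baseHom F X) ⟨Groth.Hom.fiber g.right⟩ :=
  Arr.mk_comp_eqToHom _ _

/-- The functor `c ↓ ∫ F ⥤ F c`, `(f, (d, y)) ↦ F f y`. -/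
def pullbackFunctor (c : C) : StructuredArrow c (Groth.forget F) ⥤ F.obj (op c) where
  obj X := (F.map (baseHom F X).op).toFunctor.obj X.right.fiber
  map {X Y} g := (F.map (baseHom F X).op).toFunctor.map (Groth.Hom.fiber g.right) ≫
    eqToHom (pullbackFunctor_aux F g)
  map_id X := by
    refine Arr.mk_inj.1 ((mk_pullback_map F (𝟙 X)).trans ?_)
    rw [StructuredArrow.id_right, mk_id_fiber]
    exact arrMap_mk_id _ _
  map_comp {X Y Z} f g := by
    refine Arr.mk_inj.1 ((mk_pullback_map F (f ≫ g)).trans ?_)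
    refine (Comp.pull (comp_mk_fiber f.right g.right) (baseHom F X)).unique ?_
    rw [pull_pull, baseHom_comp, ← mk_pullback_map F g, ← mk_pullback_map F f]
    exact .mk _ _

theorem mk_pullbackFunctor_map {c : C} {X Y : StructuredArrow c (Groth.forget F)} (g : X ⟶ Y) :
    Arr.mk ((pullbackFunctor F c).map g) = pull F (baseHom F X) ⟨Groth.Hom.fiber g.right⟩ :=
  mk_pullback_map F g

theorem pullbackFunctor_inverts (c : C) :
    (comma ((groth C).obj F) c).marked.IsInvertedBy (pullbackFunctor F c) := by
  intro X Y g hg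
  have : IsIso (Groth.Hom.fiber g.right) := hg
  exact IsIso.comp_isIso' (Functor.map_isIso (F.map (baseHom F X).op).toFunctor _)
    (eqToIso (pullbackFunctor_aux F g)).isIso_hom

/-- The counit at an object of `C`. -/
noncomputable def counitApp (c : C) : ((TPlus C).obj ((groth C).obj F)).obj (op c) ⥤ F.obj (op c) :=
  Localization.Construction.lift (pullbackFunctor F c) (pullbackFunctor_inverts F c)

theorem arr_map_counitApp {c : C} (m : Arr (StructuredArrow c (Groth.forget F))) :
    Arr.map (counitApp F c) (Arr.map (locQ ((groth C).obj F) c) m) =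
      pull F (baseHom F m.src) ⟨Groth.Hom.fiber m.hom.right⟩ :=
  (arr_map_lift _ _ _).trans (mk_pullbackFunctor_map F m.hom)

theorem TPlus_functor_ext {P : Over (MarkedCat.sharp C)} {c : C} {D : Type u} [Category.{u} D]
    {G H : ((TPlus C).obj P).obj (op c) ⥤ D}
    (h : ∀ m : Arr (StructuredArrow c (proj P)),
      Arr.map G (Arr.map (locQ P c) m) = Arr.map H (Arr.map (locQ P c) m)) : G = H :=
  loc_functor_ext h

/-- The counit of the adjunction. -/
noncomputable def counit : (TPlus C).obj ((groth C).obj F) ⟶ F where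
  app c := (counitApp F c.unop).toCatHom
  naturality c d f := by
    refine Cat.ext (TPlus_functor_ext fun m => ?_)
    have h₁ := arr_map_TPlus_map ((groth C).obj F) f.unop m
    have h₂ := arr_map_counitApp F (Arr.map (StructuredArrow.map f.unop) m)
    refine ((congrArg (Arr.map (counitApp F d.unop)) h₁).trans h₂).trans ?_
    have h₃ := arr_map_counitApp F m
    refine Eq.trans ?_ (congrArg (pull F f.unop) h₃).symm
    rw [pull_pull]
    rfl

end Counit

theorem arr_map_TPlus_map_app {P Q : Over (MarkedCat.sharp C)} (F : P ⟶ Q) (c : C)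
    (m : Arr (StructuredArrow c (proj P))) :
    Arr.map (((TPlus C).map F).app (op c)).toFunctor (Arr.map (locQ P c) m) =
      Arr.map (locQ Q c) (Arr.map (commaMapFunctor F c) m) :=
  arr_map_locMap (commaMap F c) m

theorem pull_map {F G : Cᵒᵖ ⥤ Cat.{u, u}} (α : F ⟶ G) {c d : C} (f : c ⟶ d)
    (m : Arr (F.obj (op d))) :
    arrMap (α.app (op c)) (pull F f m) = pull G f (arrMap (α.app (op d)) m) := by
  rw [pull, pull, ← arrMap_comp, ← arrMap_comp, α.naturality]

theorem mk_fiber_map {F G : Cᵒᵖ ⥤ Cat.{u, u}} (α : F ⟶ G) {X Y : Groth F} (g : X ⟶ Y) :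
    Arr.mk (Groth.Hom.fiber ((Groth.mapFunctor α).map g)) =
      arrMap (α.app (op X.base)) ⟨Groth.Hom.fiber g⟩ :=
  Arr.mk_comp_eqToHom _ _

/-- The counit is natural. -/
theorem counit_naturality {F G : Cᵒᵖ ⥤ Cat.{u, u}} (α : F ⟶ G) :
    (TPlus C).map ((groth C).map α) ≫ counit G = counit F ≫ α := by
  apply NatTrans.ext
  funext c
  refine Cat.ext (TPlus_functor_ext fun m => ?_)
  have h₁ := arr_map_TPlus_map_app ((groth C).map α) c.unop m
  have h₂ := arr_map_counitApp G (Arr.map (commaMapFunctor ((groth C).map α) c.unop) m)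
  refine ((congrArg (Arr.map (counitApp G c.unop)) h₁).trans h₂).trans ?_
  refine Eq.trans ?_ (congrArg (arrMap (α.app c)) (arr_map_counitApp F m)).symm
  obtain ⟨g⟩ := m
  rename_i X Y
  have h₃ := pull_map α (baseHom F _) ⟨Groth.Hom.fiber g.right⟩
  refine Eq.trans ?_ h₃.symm
  refine Eq.trans ?_ (congrArg (pull G _) (mk_fiber_map α g.right))
  have e : baseHom G ((commaMapFunctor ((groth C).map α) c.unop).obj X) = baseHom F X :=
    Category.comp_id (X := c.unop) (Y := (X.right : Groth F).base) _
  exact congrArg (fun h => pull G h _) e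

/-- An arrow `g` of the comma category with source `X` is sent by the unit to the class of
`idArrowHom P g.right`, which the counit pulls back along `X.hom`. Pre-composing an identity
structure map with `X.hom` returns `g`. -/
theorem left_triangle (P : Over (MarkedCat.sharp C)) :
    (TPlus C).map (unit P) ≫ counit ((TPlus C).obj P) = 𝟙 _ := by
  apply NatTrans.ext
  funext c
  refine Cat.ext (TPlus_functor_ext fun m => ?_)
  have h₁ := arr_map_TPlus_map_app (unit P) c.unop m
  have h₂ := arr_map_counitApp _ (Arr.map (commaMapFunctor (unit P) c.unop) m)
  refine ((congrArg (Arr.map (counitApp _ c.unop)) h₁).trans h₂).trans ?_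
  change _ = Arr.map (locQ P _) m
  obtain ⟨g⟩ := m
  rename_i X Y
  have h₃ := arr_map_TPlus_map P X.hom ⟨idArrowHom P g.right⟩
  have e : baseHom _ ((commaMapFunctor (unit P) c.unop).obj X) = X.hom :=
    Category.comp_id _
  have h₄ : Arr.map (StructuredArrow.map X.hom) ⟨idArrowHom P g.right⟩ = Arr.mk g :=
    comma_arr_ext rfl (congrArg Arr.mk (Category.comp_id X.hom))
  refine Eq.trans ?_ (h₃.trans (congrArg (Arr.map (locQ P _)) h₄))
  exact congrArg (fun h => pull _ h _) e

theorem right_triangle (F : Cᵒᵖ ⥤ Cat.{u, u}) :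
    unit ((groth C).obj F) ≫ (groth C).map (counit F) = 𝟙 _ := by
  refine Over.OverMorphism.ext (MarkedCat.hom_ext_arr fun m => ?_)
  obtain ⟨f⟩ := m
  rename_i a b
  have h (a : Groth F) : (F.map (𝟙 a.base).op).toFunctor.obj a.fiber = a.fiber :=
    Groth.map_id_obj _
  refine groth_arr_ext (F := F) (Groth.Hom.base f) _ _ (h b) ?_
  refine (Arr.mk_comp_eqToHom _ _).trans ?_
  refine (arr_map_counitApp F ⟨idArrowHom ((groth C).obj F) f⟩).trans ?_
  exact pull_id F ⟨Groth.Hom.fiber f⟩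

/-- The adjunction between `T⁺` and the marked Grothendieck construction. -/
noncomputable def adjunction (C : Type u) [Category.{u} C] : TPlus C ⊣ groth C :=
  Adjunction.mkOfUnitCounit
    { unit := { app := unit, naturality := fun _ _ F => unit_naturality F }
      counit := { app := counit, naturality := fun _ _ α => counit_naturality α }
      left_triangle := by
        ext P : 2
        refine Eq.trans ?_ (left_triangle P)
        simp
      right_triangle := by
        ext F : 2
        refine Eq.trans ?_ (right_triangle F)
        simp }

/-! ### Constructions of functors -/

section FunctorTools

variable {A B H : Type u} [Category.{u} A] [Category.{u} B] [Category.{u} H]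

theorem Arr.mk_comp_congr {a b c a' b' c' : A} {f : a ⟶ b} {g : b ⟶ c} {f' : a' ⟶ b'}
    {g' : b' ⟶ c'} (hf : Arr.mk f = Arr.mk f') (hg : Arr.mk g = Arr.mk g') :
    Arr.mk (f ≫ g) = Arr.mk (f' ≫ g') :=
  ((hf ▸ hg ▸ Comp.mk f g : Comp ⟨f'⟩ ⟨g'⟩ ⟨f ≫ g⟩)).unique (.mk _ _)

theorem Arr.mk_inv_congr {a b a' b' : A} {e : a ≅ b} {e' : a' ≅ b'}
    (h : Arr.mk e.hom = Arr.mk e'.hom) : Arr.mk e.inv = Arr.mk e'.inv := by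
  obtain rfl : a = a' := congrArg Arr.src h
  obtain rfl : b = b' := congrArg Arr.tgt h
  obtain rfl : e = e' := Iso.ext (Arr.mk_inj.1 h)
  rfl

theorem isIsofibration_iff {F : A ⥤ B} : IsIsofibration F ↔ ∀ ⦃a : A⦄ ⦃d : B⦄ (g : d ≅ F.obj a),
    ∃ (a' : A) (f : a' ≅ a), Arr.mk (F.map f.hom) = Arr.mk g.hom := by
  refine ⟨fun h a d g => ?_, fun h a d g => ?_⟩
  · obtain ⟨a', f, hf⟩ := h g
    exact ⟨a', f, (Arr.mk_eq_mk_iff _ _).2 ⟨IsHomLift.domain_eq F g.hom f.hom, rfl,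
      IsHomLift.fac' F g.hom f.hom⟩⟩
  · obtain ⟨a', f, hf⟩ := h g
    obtain ⟨h₁, h₂, h₃⟩ := (Arr.mk_eq_mk_iff _ _).1 hf
    exact ⟨a', f, IsHomLift.of_fac' _ _ _ h₁ h₂.symm h₃⟩

theorem faithful_functor_ext (p : A ⥤ B) [p.Faithful] {F G : H ⥤ A} (h : ∀ a, F.obj a = G.obj a)
    (h' : F ⋙ p = G ⋙ p) : F = G := by
  refine CategoryTheory.Functor.ext h fun a b f => p.map_injective ?_
  have := Functor.congr_hom h' f
  simpa [eqToHom_map] using this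

/-- The lift of a functor through a fully faithful functor, with prescribed object map. -/
noncomputable def liftFF (p : A ⥤ B) [p.Full] [p.Faithful] (v : H ⥤ B) (l : H → A)
    (hl : ∀ a, p.obj (l a) = v.obj a) : H ⥤ A where
  obj := l
  map f := p.preimage (eqToHom (hl _) ≫ v.map f ≫ eqToHom (hl _).symm)
  map_id a := p.map_injective (by simp)
  map_comp f g := p.map_injective (by simp)

theorem liftFF_comp (p : A ⥤ B) [p.Full] [p.Faithful] (v : H ⥤ B) (l : H → A)
    (hl : ∀ a, p.obj (l a) = v.obj a) : liftFF p v l hl ⋙ p = v :=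
  CategoryTheory.Functor.ext hl fun _ _ _ => p.map_preimage _

/-- The conjugate of a functor by isomorphisms with prescribed source. -/
def conj (R : H ⥤ A) (l : H → A) (κ : ∀ a, l a ≅ R.obj a) : H ⥤ A where
  obj := l
  map {a b} f := (κ a).hom ≫ R.map f ≫ (κ b).inv

/-- The category with objects `X` and morphisms those of `B` between the images by `e`. -/
def Ind {X : Type u} (_e : X → B) : Type u := X

instance {X : Type u} (e : X → B) : Category.{u} (Ind e) where
  Hom x y := e x ⟶ e y
  id x := 𝟙 (e x)
  comp f g := CategoryStruct.comp (obj := B) f g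
  id_comp _ := Category.id_comp (obj := B) _
  comp_id _ := Category.comp_id (obj := B) _
  assoc _ _ _ := Category.assoc (obj := B) _ _ _

/-- The fully faithful functor given by `e`. -/
def Ind.π {X : Type u} (e : X → B) : Ind e ⥤ B where
  obj := e
  map f := f

instance {X : Type u} (e : X → B) : (Ind.π e).Full := ⟨fun f => ⟨f, rfl⟩⟩

instance {X : Type u} (e : X → B) : (Ind.π e).Faithful := ⟨fun h => h⟩

/-- Lifting the isomorphism `b ≅ F a` of essential surjectivity turns it into strict surjectivity.
Conversely, an isomorphism whose source is some `F a'` lifts by full faithfulness. -/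
theorem isIsofibration_and_isEquivalence_iff {F : A ⥤ B} :
    IsIsofibration F ∧ F.IsEquivalence ↔ Function.Surjective F.obj ∧ F.Full ∧ F.Faithful := by
  refine ⟨fun ⟨h, h'⟩ => ⟨fun b => ?_, inferInstance, inferInstance⟩, fun ⟨h, h₁, h₂⟩ => ⟨?_, ?_⟩⟩
  · obtain ⟨a, f, hf⟩ := isIsofibration_iff.1 h (F.objObjPreimageIso b).symm
    exact ⟨a, congrArg Arr.src hf⟩
  · refine isIsofibration_iff.2 fun a d g => ?_
    obtain ⟨a', rfl⟩ := h d
    exact ⟨a', F.preimageIso g, by simp⟩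
  · have : F.EssSurj := ⟨fun b => ⟨_, ⟨eqToIso (h b).choose_spec⟩⟩⟩
    exact { }

end FunctorTools

variable {C : Type u} [Category.{u} C]

/-! ### The projective model structure -/

section Presheaves

variable {F G : Cᵒᵖ ⥤ Cat.{u, u}}

theorem psh_naturality (α : F ⟶ G) {c d : Cᵒᵖ} (f : c ⟶ d) :
    (F.map f).toFunctor ⋙ (α.app d).toFunctor = (α.app c).toFunctor ⋙ (G.map f).toFunctor :=
  congrArg Cat.Hom.toFunctor (α.naturality f)

theorem psh_naturality_obj (α : F ⟶ G) {c d : Cᵒᵖ} (f : c ⟶ d) (x : F.obj c) :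
    (α.app d).toFunctor.obj ((F.map f).toFunctor.obj x) =
      (G.map f).toFunctor.obj ((α.app c).toFunctor.obj x) :=
  Functor.congr_obj (psh_naturality α f) x

theorem psh_naturality_arr (α : F ⟶ G) {c d : Cᵒᵖ} (f : c ⟶ d) (x : Arr (F.obj c)) :
    Arr.map (α.app d).toFunctor (Arr.map (F.map f).toFunctor x) =
      Arr.map (G.map f).toFunctor (Arr.map (α.app c).toFunctor x) :=
  Arr.map_congr (psh_naturality α f) x

theorem psh_map_comp {c d e : Cᵒᵖ} (f : c ⟶ d) (g : d ⟶ e) :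
    (F.map (f ≫ g)).toFunctor = (F.map f).toFunctor ⋙ (F.map g).toFunctor := by
  rw [F.map_comp]
  rfl

theorem psh_map_comp_obj {c d e : Cᵒᵖ} (f : c ⟶ d) (g : d ⟶ e) (x : F.obj c) :
    (F.map (f ≫ g)).toFunctor.obj x = (F.map g).toFunctor.obj ((F.map f).toFunctor.obj x) := by
  rw [psh_map_comp]
  rfl

theorem psh_map_id (c : Cᵒᵖ) : (F.map (𝟙 c)).toFunctor = 𝟭 _ := by
  rw [F.map_id]
  rfl

theorem psh_map_id_obj {c : Cᵒᵖ} (x : F.obj c) : (F.map (𝟙 c)).toFunctor.obj x = x := by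
  rw [psh_map_id]
  rfl

theorem psh_hom_ext {α β : F ⟶ G} (h : ∀ c, (α.app c).toFunctor = (β.app c).toFunctor) : α = β :=
  NatTrans.ext (funext fun c => Cat.ext (h c))

variable (G) in
/-- A presheaf of sets of objects over a presheaf of categories. -/
structure ObjPsh where
  X : Cᵒᵖ → Type u
  map : ∀ {c d : Cᵒᵖ}, (c ⟶ d) → X c → X d
  map_id : ∀ {c : Cᵒᵖ} (x : X c), map (𝟙 c) x = x
  map_comp : ∀ {c d e : Cᵒᵖ} (f : c ⟶ d) (g : d ⟶ e) (x : X c), map (f ≫ g) x = map g (map f x)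
  e : ∀ c : Cᵒᵖ, X c → G.obj c
  e_map : ∀ {c d : Cᵒᵖ} (f : c ⟶ d) (x : X c), e d (map f x) = (G.map f).toFunctor.obj (e c x)

/-- The restriction functors of `X.full`. -/
noncomputable def ObjPsh.restrict (X : ObjPsh G) {c d : Cᵒᵖ} (f : c ⟶ d) :
    Ind (X.e c) ⥤ Ind (X.e d) :=
  liftFF (Ind.π (X.e d)) (Ind.π (X.e c) ⋙ (G.map f).toFunctor) (X.map f) (X.e_map f)

theorem ObjPsh.restrict_π (X : ObjPsh G) {c d : Cᵒᵖ} (f : c ⟶ d) :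
    X.restrict f ⋙ Ind.π (X.e d) = Ind.π (X.e c) ⋙ (G.map f).toFunctor :=
  liftFF_comp _ _ _ _

/-- The presheaf of categories with objects given by `X` and morphisms given by `G`. -/
noncomputable def ObjPsh.full (X : ObjPsh G) : Cᵒᵖ ⥤ Cat.{u, u} where
  obj c := Cat.of (Ind (X.e c))
  map f := (X.restrict f).toCatHom
  map_id c := Cat.ext (faithful_functor_ext (Ind.π (X.e c)) X.map_id (by
    refine (X.restrict_π _).trans ?_
    rw [psh_map_id]
    rfl))
  map_comp {c d e} f g := Cat.ext (faithful_functor_ext (Ind.π (X.e e)) (X.map_comp f g) (by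
    refine (X.restrict_π _).trans ?_
    change _ = X.restrict f ⋙ X.restrict g ⋙ Ind.π (X.e e)
    rw [restrict_π, ← Functor.assoc, restrict_π, psh_map_comp]
    rfl))

/-- The projection from `X.full`. -/
noncomputable def ObjPsh.π (X : ObjPsh G) : X.full ⟶ G where
  app c := (Ind.π (X.e c)).toCatHom
  naturality _ _ f := Cat.ext (X.restrict_π f)

/-- Level-wise fully faithful transformations. -/
def LevelFF (p : F ⟶ G) : Prop :=
  ∀ c, (p.app c).toFunctor.Full ∧ (p.app c).toFunctor.Faithful

theorem ObjPsh.levelFF_π (X : ObjPsh G) : LevelFF X.π := fun c =>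
  ⟨inferInstanceAs (Ind.π (X.e c)).Full, inferInstanceAs (Ind.π (X.e c)).Faithful⟩

theorem LevelFF.hom_ext {p : F ⟶ G} (hp : LevelFF p) {H : Cᵒᵖ ⥤ Cat.{u, u}} {α β : H ⟶ F}
    (h : ∀ c x, (α.app c).toFunctor.obj x = (β.app c).toFunctor.obj x) (h' : α ≫ p = β ≫ p) :
    α = β := psh_hom_ext fun c =>
  have := (hp c).2
  faithful_functor_ext (p.app c).toFunctor (h c)
    (congrArg (fun α : H ⟶ G => (α.app c).toFunctor) h')

section Lift

variable {p : F ⟶ G} (hp : LevelFF p) {H : Cᵒᵖ ⥤ Cat.{u, u}} (v : H ⟶ G)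
  (l : ∀ c, H.obj c → F.obj c) (hl : ∀ c x, (p.app c).toFunctor.obj (l c x) = (v.app c).toFunctor.obj x)
  (hl' : ∀ {c d : Cᵒᵖ} (f : c ⟶ d) x, l d ((H.map f).toFunctor.obj x) =
    (F.map f).toFunctor.obj (l c x))

include hl' in
/-- The lift of a transformation through a level-wise fully faithful one, with prescribed
object maps. -/
noncomputable def LevelFF.lift : H ⟶ F :=
  have := fun c => (hp c).1
  have := fun c => (hp c).2
  { app := fun c => (liftFF (p.app c).toFunctor (v.app c).toFunctor (l c) (hl c)).toCatHom
    naturality := by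
      intro c d f
      refine Cat.ext (faithful_functor_ext (p.app d).toFunctor (hl' f) ?_)
      change (H.map f).toFunctor ⋙ liftFF (p.app d).toFunctor (v.app d).toFunctor (l d) (hl d) ⋙ _ =
        liftFF (p.app c).toFunctor (v.app c).toFunctor (l c) (hl c) ⋙ (F.map f).toFunctor ⋙ _
      rw [liftFF_comp, psh_naturality, psh_naturality, ← Functor.assoc, liftFF_comp] }

theorem LevelFF.lift_comp : hp.lift v l hl hl' ≫ p = v :=
  have := fun c => (hp c).1
  have := fun c => (hp c).2
  psh_hom_ext fun _ => liftFF_comp _ _ _ _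

end Lift

section Conj

variable {H : Cᵒᵖ ⥤ Cat.{u, u}} (R : H ⟶ F) (l : ∀ c, H.obj c → F.obj c)
  (hl : ∀ {c d : Cᵒᵖ} (f : c ⟶ d) x, l d ((H.map f).toFunctor.obj x) =
    (F.map f).toFunctor.obj (l c x))
  (κ : ∀ c x, l c x ≅ (R.app c).toFunctor.obj x)
  (hκ : ∀ {c d : Cᵒᵖ} (f : c ⟶ d) x, Arr.mk (κ d ((H.map f).toFunctor.obj x)).hom =
    Arr.map (F.map f).toFunctor ⟨(κ c x).hom⟩)

include hκ in
/-- The conjugate of a transformation by isomorphisms. -/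
def conjPsh : H ⟶ F where
  app c := (conj (R.app c).toFunctor (l c) (κ c)).toCatHom
  naturality c d f := by
    refine Cat.ext (Arr.functor_ext fun ⟨φ⟩ => ?_)
    rename_i a b
    have h : Arr.mk ((F.map f).toFunctor.map ((κ c a).hom ≫ (R.app c).toFunctor.map φ ≫
        (κ c b).inv)) = Arr.mk ((F.map f).toFunctor.map (κ c a).hom ≫
          (F.map f).toFunctor.map ((R.app c).toFunctor.map φ) ≫
            (F.map f).toFunctor.map (κ c b).inv) := by
      rw [Functor.map_comp, Functor.map_comp]
    refine Eq.trans ?_ h.symm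
    refine Arr.mk_comp_congr (hκ f a) (Arr.mk_comp_congr (psh_naturality_arr R f ⟨φ⟩) ?_)
    exact Arr.mk_inv_congr (e' := (F.map f).toFunctor.mapIso (κ c b)) (hκ f b)

end Conj

end Presheaves

/-! ### Properties of functors in terms of arrows, and their stability under retracts -/

section ArrCharacterizations

variable {A B : Type u} [Category.{u} A] [Category.{u} B] {F : A ⥤ B}

theorem full_iff_arr : F.Full ↔ ∀ (a b : A) (m : Arr B), F.obj a = m.src → F.obj b = m.tgt →
    ∃ n : Arr A, n.src = a ∧ n.tgt = b ∧ Arr.map F n = m := by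
  constructor
  · rintro h a b ⟨f⟩ rfl rfl
    exact ⟨⟨F.preimage f⟩, rfl, rfl, by simp⟩
  · intro h
    refine ⟨fun {a b} f => ?_⟩
    obtain ⟨⟨g⟩, rfl, rfl, h⟩ := h a b ⟨f⟩ rfl rfl
    exact ⟨g, Arr.mk_inj.1 h⟩

theorem faithful_iff_arr : F.Faithful ↔ ∀ m n : Arr A, m.src = n.src → m.tgt = n.tgt →
    Arr.map F m = Arr.map F n → m = n := by
  constructor
  · rintro h ⟨f⟩ ⟨g⟩ h₁ h₂ h₃
    dsimp only at h₁ h₂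
    subst h₁ h₂
    exact Arr.mk_inj.2 (F.map_injective (Arr.mk_inj.1 h₃))
  · intro h
    exact ⟨fun {a b} f g e => Arr.mk_inj.1 (h ⟨f⟩ ⟨g⟩ rfl rfl (Arr.mk_inj.2 e))⟩

theorem isIsofibration_iff_arr : IsIsofibration F ↔ ∀ (a : A) (m : Arr B), IsIso m.hom →
    F.obj a = m.tgt → ∃ n : Arr A, IsIso n.hom ∧ n.tgt = a ∧ Arr.map F n = m := by
  rw [isIsofibration_iff]
  constructor
  · rintro h a ⟨f⟩ hf rfl
    have : IsIso f := hf
    obtain ⟨a', g, hg⟩ := h (asIso f)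
    exact ⟨⟨g.hom⟩, inferInstanceAs (IsIso g.hom), rfl, hg⟩
  · intro h a d g
    obtain ⟨⟨f⟩, hf, rfl, hf'⟩ := h a ⟨g.hom⟩ (inferInstanceAs (IsIso g.hom)) rfl
    have : IsIso f := hf
    exact ⟨_, asIso f, hf'⟩

theorem isIso_arr_map (F : A ⥤ B) {m : Arr A} (h : IsIso m.hom) : IsIso (Arr.map F m).hom :=
  Functor.map_isIso F m.hom

/-- A functor is an equivalence if it becomes a split monomorphism after a retraction of an
equivalence. -/
theorem isEquivalence_of_section {Z : Type u} [Category.{u} Z] (i : A ⥤ B) (s : B ⥤ Z) (q : Z ⥤ B)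
    (h : (i ⋙ s).IsEquivalence) (h' : s ⋙ q = 𝟭 B) : i.IsEquivalence := by
  -- `k` is a right inverse of `s` up to isomorphism and `q` is a left inverse, so they are
  -- isomorphic and `s` is an equivalence; then so is `i`, by cancellation.
  let k := (i ⋙ s).inv ⋙ i
  have e : k ⋙ s ≅ 𝟭 Z := (i ⋙ s).asEquivalence.counitIso
  have e' : q ≅ k := (Functor.leftUnitor q).symm ≪≫ Functor.isoWhiskerRight e.symm q ≪≫
    Functor.associator k s q ≪≫ Functor.isoWhiskerLeft k (eqToIso h') ≪≫ Functor.rightUnitor k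
  have : s.IsEquivalence :=
    Functor.IsEquivalence.mk' q (eqToIso h'.symm) (Functor.isoWhiskerRight e' s ≪≫ e)
  exact Functor.isEquivalence_of_comp_right i s

variable {A' B' : Type u} [Category.{u} A'] [Category.{u} B'] {G : A' ⥤ B'} (i : A ⥤ A') (r :
    A' ⥤ A)
  (i' : B ⥤ B') (r' : B' ⥤ B) (h : i ⋙ r = 𝟭 A) (h' : i' ⋙ r' = 𝟭 B) (hi : i ⋙ G = F ⋙ i')
  (hr : r ⋙ F = G ⋙ r')

include h' hr in
theorem surjective_of_retract (hG : Function.Surjective G.obj) : Function.Surjective F.obj := by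
  intro b
  obtain ⟨a, ha⟩ := hG (i'.obj b)
  refine ⟨r.obj a, ?_⟩
  exact (Functor.congr_obj hr a).trans ((congrArg r'.obj ha).trans (Functor.congr_obj h' b))

include h h' hi hr in
theorem full_of_retract (hG : G.Full) : F.Full := by
  rw [full_iff_arr] at hG ⊢
  intro a b m ha hb
  obtain ⟨n, hn₁, hn₂, hn₃⟩ := hG (i.obj a) (i.obj b) (Arr.map i' m)
    ((Functor.congr_obj hi a).trans (congrArg i'.obj ha))
    ((Functor.congr_obj hi b).trans (congrArg i'.obj hb))
  refine ⟨Arr.map r n, (congrArg r.obj hn₁).trans (Functor.congr_obj h a),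
    (congrArg r.obj hn₂).trans (Functor.congr_obj h b), ?_⟩
  exact (Arr.map_congr hr n).trans ((congrArg (Arr.map r') hn₃).trans (Arr.map_congr h' m))

include h hi in
theorem faithful_of_retract (hG : G.Faithful) : F.Faithful := by
  rw [faithful_iff_arr] at hG ⊢
  intro m n h₁ h₂ h₃
  have e := hG (Arr.map i m) (Arr.map i n) (congrArg i.obj h₁) (congrArg i.obj h₂)
    ((Arr.map_congr hi m).trans ((congrArg (Arr.map i') h₃).trans (Arr.map_congr hi n).symm))
  exact (Arr.map_congr h m).symm.trans ((congrArg (Arr.map r) e).trans (Arr.map_congr h n))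

include h h' hi hr in
theorem isIsofibration_of_retract (hG : IsIsofibration G) : IsIsofibration F := by
  rw [isIsofibration_iff_arr] at hG ⊢
  intro a m hm ha
  obtain ⟨n, hn, hn', hn''⟩ := hG (i.obj a) (Arr.map i' m) (isIso_arr_map i' hm)
    ((Functor.congr_obj hi a).trans (congrArg i'.obj ha))
  exact ⟨Arr.map r n, isIso_arr_map r hn, (congrArg r.obj hn').trans (Functor.congr_obj h a),
    (Arr.map_congr hr n).trans ((congrArg (Arr.map r') hn'').trans (Arr.map_congr h' m))⟩

end ArrCharacterizations

variable {C : Type u} [Category.{u} C]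

/-- Level-wise equivalences. -/
def levelEq (C : Type u) [Category.{u} C] : MorphismProperty (Cᵒᵖ ⥤ Cat.{u, u}) :=
  fun _ _ α => ∀ c, (α.app c).toFunctor.IsEquivalence

/-- Level-wise isofibrations. -/
def levelIsofib (C : Type u) [Category.{u} C] : MorphismProperty (Cᵒᵖ ⥤ Cat.{u, u}) :=
  fun _ _ α => ∀ c, IsIsofibration (α.app c).toFunctor

theorem levelTF_iff {F G : Cᵒᵖ ⥤ Cat.{u, u}} {p : F ⟶ G} :
    (levelIsofib C ⊓ levelEq C) p ↔
      (∀ c, Function.Surjective (p.app c).toFunctor.obj) ∧ LevelFF p := by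
  have h := fun c => isIsofibration_and_isEquivalence_iff (F := (p.app c).toFunctor)
  exact ⟨fun ⟨h₁, h₂⟩ => ⟨fun c => ((h c).1 ⟨h₁ c, h₂ c⟩).1, fun c => ((h c).1 ⟨h₁ c, h₂ c⟩).2⟩,
    fun ⟨h₁, h₂⟩ => ⟨fun c => ((h c).2 ⟨h₁ c, h₂ c⟩).1, fun c => ((h c).2 ⟨h₁ c, h₂ c⟩).2⟩⟩

instance : (levelEq C).HasTwoOutOfThreeProperty where
  comp_mem f g hf hg c := by
    have := hf c
    have := hg c
    exact inferInstanceAs ((f.app c).toFunctor ⋙ (g.app c).toFunctor).IsEquivalence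
  of_postcomp f g hg h c := by
    have := hg c
    have : ((f.app c).toFunctor ⋙ (g.app c).toFunctor).IsEquivalence := h c
    exact Functor.isEquivalence_of_comp_right _ (g.app c).toFunctor
  of_precomp f g hf h c := by
    have := hf c
    have : ((f.app c).toFunctor ⋙ (g.app c).toFunctor).IsEquivalence := h c
    exact Functor.isEquivalence_of_comp_left (f.app c).toFunctor _

section Retracts

variable {F G F' G' : Cᵒᵖ ⥤ Cat.{u, u}} {f : F ⟶ G} {g : F' ⟶ G'} (h : RetractArrow f g) (c : Cᵒᵖ)

theorem retract_functor {F G : Cᵒᵖ ⥤ Cat.{u, u}} {α β : F ⟶ G} (h : α = β) (c : Cᵒᵖ) :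
    (α.app c).toFunctor = (β.app c).toFunctor := by rw [h]

instance : (levelIsofib C).IsStableUnderRetracts where
  of_retract h hg c := isIsofibration_of_retract _ _ _ _
    (retract_functor h.retract_left c) (retract_functor h.retract_right c)
    (retract_functor h.i_w c) (retract_functor h.r_w c) (hg c)

instance : (levelIsofib C ⊓ levelEq C).IsStableUnderRetracts where
  of_retract h hg := by
    rw [levelTF_iff] at hg ⊢
    exact ⟨fun c => surjective_of_retract _ _ _
      (retract_functor h.retract_right c) (retract_functor h.r_w c) (hg.1 c), fun c =>
      ⟨full_of_retract _ _ _ _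
      (retract_functor h.retract_left c) (retract_functor h.retract_right c)
      (retract_functor h.i_w c) (retract_functor h.r_w c) (hg.2 c).1, faithful_of_retract _ _ _
      (retract_functor h.retract_left c) (retract_functor h.i_w c) (hg.2 c).2⟩⟩

end Retracts

variable {C : Type u} [Category.{u} C]

theorem Arr.mk_mapIso_trans_eqToIso {A B : Type u} [Category.{u} A] [Category.{u} B] (F : A ⥤ B)
    {a a' : A} {b : B} (σ : a ≅ a') (h : F.obj a' = b) :
    Arr.mk (F.mapIso σ ≪≫ eqToIso h).hom = Arr.map F ⟨σ.hom⟩ :=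
  Arr.mk_comp_eqToHom _ h

theorem psh_map_id_arr {F : Cᵒᵖ ⥤ Cat.{u, u}} {c : Cᵒᵖ} (m : Arr (F.obj c)) :
    Arr.map (F.map (𝟙 c)).toFunctor m = m :=
  Arr.map_congr (psh_map_id c) m

theorem psh_map_comp_arr {F : Cᵒᵖ ⥤ Cat.{u, u}} {c d e : Cᵒᵖ} (f : c ⟶ d) (g : d ⟶ e)
    (m : Arr (F.obj c)) : Arr.map (F.map (f ≫ g)).toFunctor m =
      Arr.map (F.map g).toFunctor (Arr.map (F.map f).toFunctor m) :=
  Arr.map_congr (psh_map_comp f g) m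

/-! ### Freely adding sections of objects to a presheaf of categories -/

section FreeAdd

variable {F G : Cᵒᵖ ⥤ Cat.{u, u}} (f : F ⟶ G) {Gen : C → Type u}
  (val : ∀ c, Gen c → G.obj (op c))

/-- The presheaf of objects obtained from that of `F` by freely adding sections. -/
def freeAdd : ObjPsh G where
  X d := F.obj d ⊕ Σ c : C, (d.unop ⟶ c) × Gen c
  map g := Sum.map (F.map g).toFunctor.obj (fun x => ⟨x.1, g.unop ≫ x.2.1, x.2.2⟩)
  map_id := by
    rintro c (x | ⟨c, k, y⟩)
    · exact congrArg Sum.inl (psh_map_id_obj x)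
    · simp
  map_comp := by
    rintro c d e g h (x | ⟨c, k, y⟩)
    · exact congrArg Sum.inl (psh_map_comp_obj g h x)
    · simp
  e d := Sum.elim (f.app d).toFunctor.obj (fun x => (G.map x.2.1.op).toFunctor.obj (val x.1 x.2.2))
  e_map := by
    rintro c d g (x | ⟨c, k, y⟩)
    · exact psh_naturality_obj f g x
    · exact psh_map_comp_obj k.op g (val c y)

/-- The inclusion of the old objects. -/
noncomputable def freeIncl : F ⟶ (freeAdd f val).full :=
  (freeAdd f val).levelFF_π.lift f (fun _ => Sum.inl) (fun _ _ => rfl) (fun _ _ => rfl)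

theorem freeIncl_π : freeIncl f val ≫ (freeAdd f val).π = f :=
  LevelFF.lift_comp _ _ _ _ (fun _ _ => rfl)

/-- The freely added objects. -/
def freeGen {c : C} (y : Gen c) : (freeAdd f val).full.obj (op c) := Sum.inr ⟨c, 𝟙 c, y⟩

variable {f val}

theorem map_freeGen {d : Cᵒᵖ} {c : C} (k : d.unop ⟶ c) (y : Gen c) :
    ((freeAdd f val).full.map k.op).toFunctor.obj (freeGen f val y) = Sum.inr ⟨c, k, y⟩ := by
  change Sum.inr (⟨c, k ≫ 𝟙 c, y⟩ : Σ c : C, (d.unop ⟶ c) × Gen c) = _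
  rw [Category.comp_id]

variable {A : Cᵒᵖ ⥤ Cat.{u, u}}

/-- The extension of an object map to the freely added objects. -/
def freeObj (u : F ⟶ A) (s : ∀ c, Gen c → A.obj (op c)) (d : Cᵒᵖ) :
    (freeAdd f val).full.obj d → A.obj d :=
  Sum.elim (u.app d).toFunctor.obj (fun x => (A.map x.2.1.op).toFunctor.obj (s x.1 x.2.2))

theorem freeObj_map (u : F ⟶ A) (s : ∀ c, Gen c → A.obj (op c)) {c d : Cᵒᵖ} (g : c ⟶ d)
    (x : (freeAdd f val).full.obj c) :
    freeObj u s d (((freeAdd f val).full.map g).toFunctor.obj x) =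
      (A.map g).toFunctor.obj (freeObj u s c x) := by
  obtain (x | ⟨c, k, y⟩) := x
  · exact psh_naturality_obj u g x
  · exact psh_map_comp_obj k.op g (s c y)

/-- By Yoneda, a natural extension of an object map to the added sections is a free choice of one
value per generator. Surjectivity of `p` provides these values, and full faithfulness extends the
object map uniquely to morphisms. -/
theorem freeIncl_llp : (levelIsofib C ⊓ levelEq C).llp (freeIncl f val) := by
  intro A B p hp
  rw [levelTF_iff] at hp
  obtain ⟨hp, hp'⟩ := hp
  constructor
  intro u v sq
  choose s hs using fun (c : C) (y : Gen c) => hp (op c) ((v.app (op c)).toFunctor.obj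
    (freeGen f val y))
  have hl : ∀ c (x : (freeAdd f val).full.obj c),
      (p.app c).toFunctor.obj (freeObj u s c x) = (v.app c).toFunctor.obj x := by
    rintro d (x | ⟨c, k, y⟩)
    · exact Functor.congr_obj (congrArg (fun α : F ⟶ B => (α.app d).toFunctor) sq.w) x
    · refine (psh_naturality_obj p k.op (s c y)).trans ?_
      rw [hs]
      refine (psh_naturality_obj v k.op (freeGen f val y)).symm.trans ?_
      exact congrArg (v.app d).toFunctor.obj (map_freeGen k y)
  have e := hp'.lift_comp v _ hl (freeObj_map u s)
  refine ⟨⟨⟨hp'.lift v _ hl (freeObj_map u s), ?_, e⟩⟩⟩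
  refine hp'.hom_ext (fun _ _ => rfl) ?_
  rw [Category.assoc, e, sq.w]

section Conj

variable (R : (freeAdd f val).full ⟶ A) (s : ∀ c, Gen c → A.obj (op c))
  (σ : ∀ c (y : Gen c), s c y ≅ (R.app (op c)).toFunctor.obj (freeGen f val y))

/-- The isomorphisms given on freely added objects by restriction of `σ`. -/
noncomputable def freeIso (d : Cᵒᵖ) : ∀ x : (freeAdd f val).full.obj d,
    freeObj (freeIncl f val ≫ R) s d x ≅ (R.app d).toFunctor.obj x
  | Sum.inl _ => Iso.refl _
  | Sum.inr ⟨c, k, y⟩ => (A.map k.op).toFunctor.mapIso (σ c y) ≪≫ eqToIso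
      ((psh_naturality_obj R k.op (freeGen f val y)).symm.trans
        (congrArg (R.app d).toFunctor.obj (map_freeGen k y)))

theorem mk_freeIso_inl (d : Cᵒᵖ) (x : F.obj d) :
    Arr.mk (freeIso R s σ d (Sum.inl x)).hom =
      Arr.id (((freeIncl f val ≫ R).app d).toFunctor.obj x) := rfl

theorem mk_freeIso_inr {d : Cᵒᵖ} {c : C} (k : d.unop ⟶ c) (y : Gen c) :
    Arr.mk (freeIso R s σ d (Sum.inr ⟨c, k, y⟩)).hom =
      Arr.map (A.map k.op).toFunctor ⟨(σ c y).hom⟩ :=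
  Arr.mk_mapIso_trans_eqToIso _ _ _

theorem freeIso_map {c d : Cᵒᵖ} (g : c ⟶ d) (x : (freeAdd f val).full.obj c) :
    Arr.mk (freeIso R s σ d (((freeAdd f val).full.map g).toFunctor.obj x)).hom =
      Arr.map (A.map g).toFunctor ⟨(freeIso R s σ c x).hom⟩ := by
  obtain (x | ⟨c, k, y⟩) := x
  · refine (mk_freeIso_inl R s σ d _).trans ?_
    refine Eq.trans ?_ (congrArg (Arr.map (A.map g).toFunctor) (mk_freeIso_inl R s σ c x)).symm
    refine Eq.trans ?_ (Arr.map_id _ _).symm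
    exact congrArg Arr.id (psh_naturality_obj _ g x)
  · refine (mk_freeIso_inr R s σ (g.unop ≫ k) y).trans ?_
    refine Eq.trans ?_ (congrArg (Arr.map (A.map g).toFunctor) (mk_freeIso_inr R s σ k y)).symm
    exact psh_map_comp_arr k.op g _

/-- The conjugate of `R` by `freeIso`. -/
noncomputable def freeConj : (freeAdd f val).full ⟶ A :=
  conjPsh R (freeObj (freeIncl f val ≫ R) s) (freeIso R s σ) (freeIso_map R s σ)

theorem freeConj_map {d : Cᵒᵖ} {x y : (freeAdd f val).full.obj d} (φ : x ⟶ y) :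
    ((freeConj R s σ).app d).toFunctor.map φ =
      (freeIso R s σ d x).hom ≫ (R.app d).toFunctor.map φ ≫ (freeIso R s σ d y).inv := rfl

theorem freeIncl_freeConj : freeIncl f val ≫ freeConj R s σ = freeIncl f val ≫ R := by
  refine psh_hom_ext fun d => Arr.functor_ext fun ⟨φ⟩ => ?_
  rename_i x y
  change Arr.mk (𝟙 _ ≫ (R.app d).toFunctor.map _ ≫ 𝟙 _) = Arr.mk _
  rw [Category.id_comp, Category.comp_id]
  rfl

end Conj

end FreeAdd

variable {C : Type u} [Category.{u} C]

theorem Arr.map_comp₃ {A B : Type u} [Category.{u} A] [Category.{u} B] (F : A ⥤ B) {a b c d : A}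
    (f : a ⟶ b) (g : b ⟶ c) (h : c ⟶ d) :
    Arr.map F ⟨f ≫ g ≫ h⟩ = ⟨F.map f ≫ F.map g ≫ F.map h⟩ := by
  simp

/-! ### Freely adding isomorphic copies of objects -/

section FreeIso

variable {F A B : Cᵒᵖ ⥤ Cat.{u, u}} {Gen : C → Type u} {val : ∀ c, Gen c → F.obj (op c)}

/-- Every object of `(freeAdd (𝟙 F) val).full` is isomorphic to one coming from `F`. -/
noncomputable def freeRetr {d : Cᵒᵖ} (x : (freeAdd (𝟙 F) val).full.obj d) :
    x ≅ ((freeIncl (𝟙 F) val).app d).toFunctor.obj (((freeAdd (𝟙 F) val).π.app d).toFunctor.obj x) :=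
  have h := (freeAdd (𝟙 F) val).levelFF_π d
  have := h.1
  have := h.2
  Functor.preimageIso ((freeAdd (𝟙 F) val).π.app d).toFunctor
    (Iso.refl (((freeAdd (𝟙 F) val).π.app d).toFunctor.obj x))

theorem map_mk_freeRetr {d : Cᵒᵖ} (x : (freeAdd (𝟙 F) val).full.obj d) :
    Arr.map ((freeAdd (𝟙 F) val).π.app d).toFunctor ⟨(freeRetr x).hom⟩ =
      Arr.id (((freeAdd (𝟙 F) val).π.app d).toFunctor.obj x) :=
  have h := (freeAdd (𝟙 F) val).levelFF_π d
  have := h.1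
  have := h.2
  congrArg (Arr.mk (A := F.obj d))
    (Functor.map_preimage ((freeAdd (𝟙 F) val).π.app d).toFunctor (𝟙 _))

/-- Since the projection is faithful, `freeRetr x` is pinned down by its endpoints and by lying over
an identity. Its compatibility with restriction follows from this. -/
theorem mk_freeRetr_unique {d : Cᵒᵖ} {x : (freeAdd (𝟙 F) val).full.obj d}
    {m : Arr ((freeAdd (𝟙 F) val).full.obj d)} (h₁ : m.src = x)
    (h₂ : m.tgt = ((freeIncl (𝟙 F) val).app d).toFunctor.obj
      (((freeAdd (𝟙 F) val).π.app d).toFunctor.obj x))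
    (h : Arr.map ((freeAdd (𝟙 F) val).π.app d).toFunctor m =
      Arr.id (((freeAdd (𝟙 F) val).π.app d).toFunctor.obj x)) :
    Arr.mk (freeRetr x).hom = m :=
  (faithful_iff_arr.1 ((freeAdd (𝟙 F) val).levelFF_π d).2 m ⟨(freeRetr x).hom⟩ h₁ h₂
    (h.trans (map_mk_freeRetr x).symm)).symm

theorem mk_freeRetr_inl {d : Cᵒᵖ} (x : F.obj d) :
    Arr.mk (freeRetr (val := val) (d := d) (Sum.inl x)).hom =
      Arr.id (A := (freeAdd (𝟙 F) val).full.obj d) (Sum.inl x) :=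
  mk_freeRetr_unique rfl rfl (Arr.map_id _ _)

theorem freeRetr_map {c d : Cᵒᵖ} (g : c ⟶ d) (x : (freeAdd (𝟙 F) val).full.obj c) :
    Arr.mk (freeRetr (((freeAdd (𝟙 F) val).full.map g).toFunctor.obj x)).hom =
      Arr.map ((freeAdd (𝟙 F) val).full.map g).toFunctor ⟨(freeRetr x).hom⟩ := by
  have h := psh_naturality_obj (freeAdd (𝟙 F) val).π g x
  refine mk_freeRetr_unique rfl ?_ ?_
  · refine (psh_naturality_obj (freeIncl (𝟙 F) val) g _).symm.trans ?_
    exact congrArg ((freeIncl (𝟙 F) val).app d).toFunctor.obj h.symm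
  · refine (psh_naturality_arr (freeAdd (𝟙 F) val).π g _).trans ?_
    rw [map_mk_freeRetr]
    exact (Arr.map_id _ _).trans (congrArg Arr.id h.symm)

theorem freeRetr_naturality {d : Cᵒᵖ} {x y : (freeAdd (𝟙 F) val).full.obj d} (φ : x ⟶ y) :
    φ = (freeRetr x).hom ≫ ((freeIncl (𝟙 F) val).app d).toFunctor.map
      (((freeAdd (𝟙 F) val).π.app d).toFunctor.map φ) ≫ (freeRetr y).inv := by
  have h := (freeAdd (𝟙 F) val).levelFF_π d
  have := h.2
  rw [← Category.assoc, Iso.eq_comp_inv]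
  refine ((freeAdd (𝟙 F) val).π.app d).toFunctor.map_injective (Arr.mk_inj.1 ?_)
  rw [Functor.map_comp, Functor.map_comp]
  refine (Arr.mk_comp_congr (A := F.obj d) 
    (f' := ((freeAdd (𝟙 F) val).π.app d).toFunctor.map φ) (g' := 𝟙 _) rfl
    (map_mk_freeRetr y)).trans ?_
  refine Eq.trans ?_ (Arr.mk_comp_congr (A := F.obj d) (f' := 𝟙 _) (map_mk_freeRetr x) rfl).symm
  refine (congrArg (Arr.mk (A := F.obj d)) (Category.comp_id (obj := F.obj d) _)).trans ?_
  refine Eq.trans ?_ (congrArg (Arr.mk (A := F.obj d)) (Category.id_comp (obj := F.obj d) _)).symm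
  exact (Arr.map_congr (congrArg (fun α : F ⟶ F => (α.app d).toFunctor) (freeIncl_π (𝟙 F) val))
    ⟨((freeAdd (𝟙 F) val).π.app d).toFunctor.map φ⟩).symm

/-- The inclusion is a section of the fully faithful projection, which makes the projection
essentially surjective, hence an equivalence; two-out-of-three does the rest. -/
theorem freeIncl_id_levelEq (val : ∀ c, Gen c → F.obj (op c)) :
    levelEq C (freeIncl (𝟙 F) val) := by
  intro d
  have hff := (freeAdd (𝟙 F) val).levelFF_π d
  have e : ((freeIncl (𝟙 F) val).app d).toFunctor ⋙ ((freeAdd (𝟙 F) val).π.app d).toFunctor =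
      𝟭 (F.obj d) := congrArg (fun α : F ⟶ F => (α.app d).toFunctor) (freeIncl_π (𝟙 F) val)
  have h : ((freeAdd (𝟙 F) val).π.app d).toFunctor.IsEquivalence :=
    { faithful := hff.2
      full := hff.1
      essSurj := ⟨fun x => ⟨((freeIncl (𝟙 F) val).app d).toFunctor.obj x,
        ⟨eqToIso (Functor.congr_obj e x)⟩⟩⟩ }
  have : (((freeIncl (𝟙 F) val).app d).toFunctor ⋙
      ((freeAdd (𝟙 F) val).π.app d).toFunctor).IsEquivalence := by
    rw [e]
    exact inferInstanceAs (𝟭 (F.obj d)).IsEquivalence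
  exact Functor.isEquivalence_of_comp_right _ ((freeAdd (𝟙 F) val).π.app d).toFunctor

/-- An added object is isomorphic to an old one by `freeRetr`. The image of this isomorphism under
`v` lifts along the isofibration; lifts are chosen on generators only and extended by restriction,
which makes them natural. Conjugating the composite of the projection with `u` by these isomorphisms
solves the lifting problem. -/
theorem freeIncl_id_llp : (levelIsofib C).llp (freeIncl (𝟙 F) val) := by
  intro A B p hp
  constructor
  intro u v sq
  have hw : ∀ d, ((freeIncl (𝟙 F) val).app d).toFunctor ⋙ (v.app d).toFunctor =
      (u.app d).toFunctor ⋙ (p.app d).toFunctor := fun d =>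
    congrArg (fun α : F ⟶ B => (α.app d).toFunctor) sq.w.symm
  have hσ : ∀ (c : C) (y : Gen c), ∃ (s : A.obj (op c)) (σ : s ≅
      ((((freeAdd (𝟙 F) val).π ≫ u).app (op c))).toFunctor.obj (freeGen (𝟙 F) val y)),
      Arr.map (p.app (op c)).toFunctor ⟨σ.hom⟩ =
        Arr.map (v.app (op c)).toFunctor ⟨(freeRetr (freeGen (𝟙 F) val y)).hom⟩ := by
    intro c y
    obtain ⟨m, h₁, h₂, h₃⟩ := isIsofibration_iff_arr.1 (hp (op c))
      ((((freeAdd (𝟙 F) val).π ≫ u).app (op c)).toFunctor.obj (freeGen (𝟙 F) val y))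
      (Arr.map (v.app (op c)).toFunctor ⟨(freeRetr (freeGen (𝟙 F) val y)).hom⟩)
      (isIso_arr_map _ (inferInstanceAs (IsIso (Iso.hom _))))
      (Functor.congr_obj (hw (op c)) _).symm
    obtain ⟨m⟩ := m
    dsimp only at h₁ h₂
    subst h₂
    exact ⟨_, asIso m, h₃⟩
  choose s σ hσ using hσ
  -- The chosen isomorphisms lie over the images of `freeRetr` at all objects: both are identities
  -- on old objects, and on added ones both are restrictions from a generator.
  have key : ∀ (d : Cᵒᵖ) x,
      Arr.map (p.app d).toFunctor ⟨(freeIso ((freeAdd (𝟙 F) val).π ≫ u) s σ d x).hom⟩ =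
        Arr.map (v.app d).toFunctor ⟨(freeRetr x).hom⟩ := by
    rintro d (x | ⟨c, k, y⟩)
    · refine (congrArg _ (mk_freeIso_inl _ _ _ _ x)).trans ?_
      refine Eq.trans ?_ (congrArg (Arr.map (v.app d).toFunctor) (mk_freeRetr_inl x)).symm
      refine (Arr.map_id _ _).trans (Eq.trans ?_ (Arr.map_id _ _).symm)
      exact congrArg Arr.id (Functor.congr_obj (hw d) x).symm
    · refine (congrArg _ (mk_freeIso_inr _ _ _ k y)).trans ?_
      refine (psh_naturality_arr p k.op _).trans ((congrArg _ (hσ c y)).trans ?_)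
      refine (psh_naturality_arr v k.op _).symm.trans (congrArg _ ?_)
      refine (freeRetr_map _ _).symm.trans ?_
      rw [map_freeGen]
  have e : freeIncl (𝟙 F) val ≫ (freeAdd (𝟙 F) val).π ≫ u = u := by
    rw [← Category.assoc, freeIncl_π, Category.id_comp]
  refine ⟨⟨⟨freeConj ((freeAdd (𝟙 F) val).π ≫ u) s σ, (freeIncl_freeConj _ _ _).trans e, ?_⟩⟩⟩
  refine psh_hom_ext fun d => Arr.functor_ext fun ⟨φ⟩ => ?_
  rename_i x y
  refine (congrArg (Arr.map (p.app d).toFunctor) (congrArg Arr.mk (freeConj_map _ _ _ φ))).trans ?_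
  refine (Arr.map_comp₃ (p.app d).toFunctor _ _ _).trans ?_
  refine Eq.trans ?_ ((congrArg (fun ψ => Arr.map (v.app d).toFunctor ⟨ψ⟩)
    (freeRetr_naturality φ)).trans (Arr.map_comp₃ _ _ _ _)).symm
  refine Arr.mk_comp_congr (key d x) (Arr.mk_comp_congr ?_ ?_)
  · exact Arr.map_congr (hw d).symm ⟨((freeAdd (𝟙 F) val).π.app d).toFunctor.map φ⟩
  · exact Arr.mk_inv_congr
      (e := (p.app d).toFunctor.mapIso (freeIso ((freeAdd (𝟙 F) val).π ≫ u) s σ d y))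
      (e' := (v.app d).toFunctor.mapIso (freeRetr y)) (key d y)

end FreeIso

/-! ### The mapping path factorization -/

section Factorization

variable {F G : Cᵒᵖ ⥤ Cat.{u, u}} (f : F ⟶ G)

/-- Generators of the mapping path presheaf: isomorphisms `y ≅ f x`. -/
def IsoGen (c : C) : Type u :=
  Σ (x : F.obj (op c)) (y : G.obj (op c)), y ≅ (f.app (op c)).toFunctor.obj x

/-- The fibration of the factorization of `f` through its mapping path presheaf. -/
noncomputable def pathFib : (freeAdd (𝟙 F) (Gen := IsoGen f) (fun _ y => y.1)).full ⟶ G :=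
  freeConj ((freeAdd (𝟙 F) (Gen := IsoGen f) (fun _ y => y.1)).π ≫ f) (fun _ y => y.2.1)
    (fun _ y => y.2.2 ≪≫ eqToIso (congrArg (f.app _).toFunctor.obj (psh_map_id_obj y.1).symm))

theorem freeIncl_pathFib : freeIncl (𝟙 F) (Gen := IsoGen f) (fun _ y => y.1) ≫ pathFib f = f := by
  refine (freeIncl_freeConj _ _ _).trans ?_
  rw [← Category.assoc, freeIncl_π, Category.id_comp]

/-- An isomorphism `g` from `z` to the image of `a`, followed by the conjugating isomorphism at `a`,
is an isomorphism from `z` to `f x`, where `x` is the object of `F` underlying `a`. It therefore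
names a generator, whose image is `z`, and the isomorphism to `a` lying over the identity of `x`
maps to `g`. -/
theorem pathFib_levelIsofib : levelIsofib C (pathFib f) := by
  intro d
  rw [isIsofibration_iff]
  intro a z g
  let R := (freeAdd (𝟙 F) (Gen := IsoGen f) (fun _ y => y.1)).π ≫ f
  let s : ∀ c, IsoGen f c → G.obj (op c) := fun _ y => y.2.1
  let σ : ∀ c (y : IsoGen f c), s c y ≅ (R.app (op c)).toFunctor.obj (freeGen _ _ y) :=
    (fun _ y => y.2.2 ≪≫ eqToIso (congrArg (f.app _).toFunctor.obj (psh_map_id_obj y.1).symm))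
  let κ := freeIso R s σ
  let x := ((freeAdd (𝟙 F) (Gen := IsoGen f) (fun _ y => y.1)).π.app d).toFunctor.obj a
  let y : IsoGen f d.unop := ⟨x, z, g ≪≫ κ d a⟩
  have hff := (freeAdd (𝟙 F) (Gen := IsoGen f) (fun _ y => y.1)).levelFF_π d
  have := hff.1
  have := hff.2
  let e := Functor.preimageIso
    ((freeAdd (𝟙 F) (Gen := IsoGen f) (fun _ y => y.1)).π.app d).toFunctor
    (X := freeGen (𝟙 F) (fun _ y => y.1) y) (Y := a) (eqToIso (psh_map_id_obj x))
  have he : Arr.map (R.app d).toFunctor ⟨e.hom⟩ = Arr.id ((R.app d).toFunctor.obj a) := by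
    have : Arr.map ((freeAdd (𝟙 F) (Gen := IsoGen f) (fun _ y => y.1)).π.app d).toFunctor ⟨e.hom⟩ =
        Arr.id x :=
      (congrArg (Arr.mk (A := F.obj d)) (Functor.map_preimage
        ((freeAdd (𝟙 F) (Gen := IsoGen f) (fun _ y => y.1)).π.app d).toFunctor _)).trans
        ((Arr.mk_eqToHom (psh_map_id_obj x)).trans (congrArg Arr.id (psh_map_id_obj x)))
    exact (congrArg (Arr.map (f.app d).toFunctor) this).trans (Arr.map_id _ _)
  refine ⟨freeGen _ _ y, e, ?_⟩
  have h : Arr.mk (κ d (freeGen _ _ y)).hom = ⟨g.hom ≫ (κ d a).hom⟩ := by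
    refine (mk_freeIso_inr R s σ (𝟙 d.unop) y).trans ((psh_map_id_arr _).trans ?_)
    exact Arr.mk_comp_eqToHom (g ≪≫ κ d a).hom
      (congrArg (f.app d).toFunctor.obj (psh_map_id_obj x).symm)
  refine (congrArg Arr.mk (freeConj_map R s σ e.hom)).trans ?_
  refine (Arr.mk_comp_congr h (Arr.mk_comp_congr he (g' := (κ d a).inv) rfl)).trans ?_
  refine (congrArg Arr.mk (congrArg _ (Category.id_comp _))).trans ?_
  exact Arr.mk_inj.2 ((Category.assoc _ _ _).trans
    ((congrArg _ (κ d a).hom_inv_id).trans (Category.comp_id _)))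

/-- Left lifting against level-wise isofibrations implies being a level-wise equivalence. -/
theorem levelEq_of_llp (h : (levelIsofib C).llp f) : levelEq C f := by
  -- Lifting `𝟙 G` against `pathFib f` gives a section `s` of it for which `f ≫ s` is the inclusion,
  -- already known to be a level-wise equivalence.
  have sq : CommSq (freeIncl (𝟙 F) (Gen := IsoGen f) (fun _ y => y.1)) f (pathFib f) (𝟙 G) :=
    ⟨by rw [freeIncl_pathFib, Category.comp_id]⟩
  have := h _ (pathFib_levelIsofib f)
  intro d
  refine isEquivalence_of_section _ (sq.lift.app d).toFunctor ((pathFib f).app d).toFunctor ?_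
    (congrArg (fun α : G ⟶ G => (α.app d).toFunctor) sq.fac_right)
  have e := congrArg (fun α : F ⟶ _ => (α.app d).toFunctor) sq.fac_left
  exact (congrArg Functor.IsEquivalence e).mpr (freeIncl_id_levelEq _ d)

end Factorization

/-! ### Weak factorization systems of the projective model structure -/

/-- The cofibrations of the projective model structure. -/
abbrev projCof (C : Type u) [Category.{u} C] : MorphismProperty (Cᵒᵖ ⥤ Cat.{u, u}) :=
  (levelIsofib C ⊓ levelEq C).llp

theorem levelIsofib_llp : (levelIsofib C).llp = projCof C ⊓ levelEq C := by
  refine le_antisymm (fun F G f h => ⟨MorphismProperty.antitone_llp inf_le_left _ h,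
    levelEq_of_llp f h⟩) fun F G f h => ?_
  -- Retract argument: `pathFib f` is a trivial fibration by two-out-of-three, so `f` lifts against
  -- it and is a retract of the inclusion.
  have hp : levelEq C (pathFib f) := (levelEq C).of_precomp
    (freeIncl (𝟙 F) (Gen := IsoGen f) (fun _ y => y.1)) _ (freeIncl_id_levelEq _)
    ((freeIncl_pathFib f).symm ▸ h.2)
  have := h.1 _ ⟨pathFib_levelIsofib f, hp⟩
  have r : RetractArrow f (freeIncl (𝟙 F) (Gen := IsoGen f) (fun _ y => y.1)) :=
    .ofLeftLiftingProperty (freeIncl_pathFib f)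
  exact MorphismProperty.of_retract r freeIncl_id_llp

instance : (projCof C).HasFactorization (levelIsofib C ⊓ levelEq C) where
  nonempty_mapFactorizationData {_ G} f := ⟨
    { Z := (freeAdd f (Gen := fun c => G.obj (op c)) (fun _ y => y)).full
      i := freeIncl f _
      p := ObjPsh.π _
      fac := freeIncl_π _ _
      hi := freeIncl_llp
      hp := levelTF_iff.2 ⟨fun _ x => ⟨freeGen f _ x, psh_map_id_obj x⟩, ObjPsh.levelFF_π _⟩ }⟩

instance : (projCof C ⊓ levelEq C).HasFactorization (levelIsofib C) where
  nonempty_mapFactorizationData f := ⟨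
    { Z := _
      i := _
      p := pathFib f
      fac := freeIncl_pathFib f
      hi := levelIsofib_llp.le _ freeIncl_id_llp
      hp := pathFib_levelIsofib f }⟩

instance : (projCof C).IsWeakFactorizationSystem (levelIsofib C ⊓ levelEq C) :=
  MorphismProperty.IsWeakFactorizationSystem.mk' _ _ fun _ _ hi hp => hi _ hp

instance : (projCof C ⊓ levelEq C).IsStableUnderRetracts := by
  rw [← levelIsofib_llp]
  infer_instance

instance : (projCof C ⊓ levelEq C).IsWeakFactorizationSystem (levelIsofib C) :=
  MorphismProperty.IsWeakFactorizationSystem.mk' _ _ 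
    fun _ _ hi hp => levelIsofib_llp.ge _ hi _ hp

/-- The projective model structure on `[Cᵒᵖ, Cat]`. -/
abbrev projModel (C : Type u) [Category.{u} C] : ModelCategory (Cᵒᵖ ⥤ Cat.{u, u}) :=
  letI : CategoryWithFibrations (Cᵒᵖ ⥤ Cat.{u, u}) := ⟨levelIsofib C⟩
  letI : CategoryWithCofibrations (Cᵒᵖ ⥤ Cat.{u, u}) := ⟨projCof C⟩
  letI : CategoryWithWeakEquivalences (Cᵒᵖ ⥤ Cat.{u, u}) := ⟨levelEq C⟩
  haveI : (weakEquivalences (Cᵒᵖ ⥤ Cat.{u, u})).HasTwoOutOfThreeProperty :=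
    inferInstanceAs (levelEq C).HasTwoOutOfThreeProperty
  haveI : MorphismProperty.IsWeakFactorizationSystem (cofibrations (Cᵒᵖ ⥤ Cat.{u, u}))
      (trivialFibrations (Cᵒᵖ ⥤ Cat.{u, u})) :=
    inferInstanceAs ((projCof C).IsWeakFactorizationSystem (levelIsofib C ⊓ levelEq C))
  haveI : MorphismProperty.IsWeakFactorizationSystem (trivialCofibrations (Cᵒᵖ ⥤ Cat.{u, u}))
      (fibrations (Cᵒᵖ ⥤ Cat.{u, u})) :=
    inferInstanceAs ((projCof C ⊓ levelEq C).IsWeakFactorizationSystem (levelIsofib C))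
  .mk' _

theorem isProjectiveModelStructure_projModel :
    IsProjectiveModelStructure (projModel C) where
  weakEquivalence_iff α :=
    letI := projModel C
    weakEquivalence_iff α
  fibration_iff α :=
    letI := projModel C
    fibration_iff α

/-! ### Colocal objects -/

section Colocal

variable {A : Type u} [Category.{u} A] (W : MorphismProperty A)

/-- Morphisms out of a colocal object are not changed by localization. -/
theorem bijective_map_of_colocal {X : A}
    (h : ∀ ⦃Y Z : A⦄ (w : Y ⟶ Z), W w → Function.Bijective fun f : X ⟶ Y => f ≫ w) (Y : A) :
    Function.Bijective fun f : X ⟶ Y => W.Q.map f := by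
  -- Colocality says that the functor represented by `X` inverts `W`, so it descends to a functor
  -- `Φ` on the localization. The maps `f ↦ W.Q.map f` descend to `τ'`, and evaluating `Φ` on the
  -- element `x` given by `𝟙 X` provides the inverse, as in the Yoneda lemma.
  have hW : W.IsInvertedBy (coyoneda.obj (op X)) := fun Y Z w hw => (isIso_iff_bijective _).2 (h w hw)
  let Φ := Localization.Construction.lift (coyoneda.obj (op X)) hW
  have fac : W.Q ⋙ Φ = coyoneda.obj (op X) := Localization.Construction.fac _ _
  let e : W.Q ⋙ Φ ≅ coyoneda.obj (op X) := eqToIso fac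
  let τ : W.Q ⋙ Φ ⟶ W.Q ⋙ coyoneda.obj (op (W.Q.obj X)) :=
    e.hom ≫ { app := fun Y => ↾fun f : X ⟶ Y => W.Q.map f }
  let τ' : Φ ⟶ coyoneda.obj (op (W.Q.obj X)) := Localization.Construction.natTransExtension τ
  have hτ : ∀ Y, τ'.app (W.Q.obj Y) = τ.app Y := fun Y => by
    exact NatTrans.congr_app (Localization.Construction.whiskerLeft_natTransExtension τ) Y
  let x : Φ.obj (W.Q.obj X) := e.inv.app X (𝟙 X)
  constructor
  · intro f f' hf
    have h₁ (f : X ⟶ Y) : Φ.map (W.Q.map f) x = e.inv.app Y f := by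
      refine (ConcreteCategory.congr_hom (e.inv.naturality f) (𝟙 X)).symm.trans ?_
      exact congrArg (e.inv.app Y) (Category.id_comp f)
    have h₂ : e.inv.app Y f = e.inv.app Y f' := by
      rw [← h₁, ← h₁]
      exact congrArg (fun g => Φ.map g x) hf
    have h₃ (f : X ⟶ Y) : e.hom.app Y (e.inv.app Y f) = f :=
      ConcreteCategory.congr_hom (NatTrans.congr_app e.inv_hom_id Y) f
    rw [← h₃ f, h₂, h₃]
  · intro g
    refine ⟨e.hom.app Y (Φ.map g x), ?_⟩
    refine (ConcreteCategory.congr_hom (hτ Y) (Φ.map g x)).symm.trans ?_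
    refine (ConcreteCategory.congr_hom (τ'.naturality g) x).trans ?_
    have h₁ : τ'.app (W.Q.obj X) x = 𝟙 _ := by
      refine (ConcreteCategory.congr_hom (hτ X) x).trans ?_
      refine Eq.trans ?_ (W.Q.map_id X)
      exact congrArg W.Q.map (ConcreteCategory.congr_hom (NatTrans.congr_app e.inv_hom_id X) (𝟙 X))
    refine (congrArg (fun f => f ≫ g) h₁).trans (Category.id_comp g)

end Colocal

variable {C : Type u} [Category.{u} C]

/-! ### Level-wise equivalences detected on the Grothendieck construction -/

section Groth

variable {F G : Cᵒᵖ ⥤ Cat.{u, u}}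

theorem Arr.isIso_congr {A : Type u} [Category.{u} A] {m n : Arr A} (h : m = n) (hm : IsIso m.hom) :
    IsIso n.hom := h ▸ hm

/-- A case of two-out-of-six: `g` is split epi by the first composite and split mono by the second.
-/
theorem isIso_of_comp_comp {A : Type u} [Category.{u} A] {a b c d : A} (f : a ⟶ b) (g : b ⟶ c)
    (h : c ⟶ d) (h₁ : IsIso (f ≫ g)) (h₂ : IsIso (g ≫ h)) : IsIso f := by
  have : IsSplitEpi g := ⟨⟨⟨inv (f ≫ g) ≫ f, by simp⟩⟩⟩
  have : IsSplitMono g := ⟨⟨⟨h ≫ inv (g ≫ h), by simp [← Category.assoc]⟩⟩⟩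
  have : IsIso g := isIso_of_mono_of_isSplitEpi g
  exact IsIso.of_isIso_comp_right f g

theorem Arr.Comp.isIso {A : Type u} [Category.{u} A] {m n q p r : Arr A} (h₁ : Arr.Comp m n p)
    (h₂ : Arr.Comp n q r) (hp : IsIso p.hom) (hr : IsIso r.hom) : IsIso m.hom := by
  obtain ⟨f, g⟩ := h₁
  obtain ⟨h⟩ := q
  have e := h₂.tgt_eq
  dsimp only at e
  subst e
  obtain rfl := (Arr.Comp.iff_of_hom _ _ _).1 h₂
  exact isIso_of_comp_comp f g h hp hr

variable (F) in
/-- The inclusion of the fibre over `c`. -/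
def fiberIncl (c : C) : F.obj (op c) ⥤ Groth F where
  obj x := ⟨c, x⟩
  map {x y} φ := Groth.Hom.mk (𝟙 c) (φ ≫ eqToHom (Groth.map_id_obj y).symm)
  map_id x := groth_hom_ext rfl
    ((Arr.mk_comp_eqToHom _ _).trans (Arr.mk_eqToHom (Groth.map_id_obj x).symm).symm)
  map_comp {x y z} φ ψ := by
    refine groth_hom_ext (Category.comp_id (𝟙 c)).symm ?_
    refine (Arr.mk_comp_eqToHom _ _).trans ?_
    refine (Arr.Comp.mk φ ψ).unique ?_
    have h := comp_mk_fiber (F := F) (X := ⟨c, x⟩) (Y := ⟨c, y⟩) (Z := ⟨c, z⟩)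
      (Groth.Hom.mk (𝟙 c) (φ ≫ eqToHom (Groth.map_id_obj y).symm))
      (Groth.Hom.mk (𝟙 c) (ψ ≫ eqToHom (Groth.map_id_obj z).symm))
    rw [pull_id] at h
    have h₁ : Arr.mk (φ ≫ eqToHom (Groth.map_id_obj y).symm) = Arr.mk φ := Arr.mk_comp_eqToHom _ _
    have h₂ : Arr.mk (ψ ≫ eqToHom (Groth.map_id_obj z).symm) = Arr.mk ψ := Arr.mk_comp_eqToHom _ _
    exact (h₁ ▸ h₂ ▸ h)

theorem mk_fiber_fiberIncl {c : C} {x y : F.obj (op c)} (φ : x ⟶ y) :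
    Arr.mk (Groth.Hom.fiber ((fiberIncl F c).map φ)) = Arr.mk φ :=
  Arr.mk_comp_eqToHom _ _

theorem fiberIncl_map (α : F ⟶ G) (c : C) {x y : F.obj (op c)} (φ : x ⟶ y) :
    (Groth.mapFunctor α).map ((fiberIncl F c).map φ) =
      (fiberIncl G c).map ((α.app (op c)).toFunctor.map φ) := by
  refine groth_hom_ext rfl ((mk_fiber_map α _).trans ?_)
  exact (congrArg (arrMap _) (mk_fiber_fiberIncl φ)).trans (mk_fiber_fiberIncl _).symm

/-- The component in the fibre of an isomorphism is an isomorphism. -/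
theorem isIso_fiber {X Y : Groth F} (e : X ≅ Y) : IsIso (Groth.Hom.fiber e.hom) := by
  -- The fibre components of `e.hom`, of the pullback of `e.inv` and of a further pullback of
  -- `e.hom` are successively composable, and both adjacent composites are invertible;
  -- two-out-of-six applies.
  have h₁ := (comp_mk_fiber e.hom e.inv)
  have h₂ := Comp.pull (comp_mk_fiber e.inv e.hom) (Groth.Hom.base e.hom)
  rw [e.hom_inv_id, mk_id_fiber] at h₁
  rw [e.inv_hom_id, mk_id_fiber] at h₂
  exact h₁.isIso h₂ (inferInstanceAs (IsIso (𝟙 _)))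
    (Functor.map_isIso (F.map (Groth.Hom.base e.hom).op).toFunctor (𝟙 _))

theorem faithful_fiberIncl (c : C) : (fiberIncl F c).Faithful := ⟨fun {_ _ φ ψ} h =>
  Arr.mk_inj.1 ((mk_fiber_fiberIncl φ).symm.trans
    ((congrArg (fun f => Arr.mk (Groth.Hom.fiber f)) h).trans (mk_fiber_fiberIncl ψ)))⟩

theorem isEquivalence_mapFunctor {α : F ⟶ G} (h : levelEq C α) :
    (Groth.mapFunctor α).IsEquivalence where
  faithful := ⟨fun {X Y f g} e => by
    have := h (op X.base)
    have e₁ : Groth.Hom.base f = Groth.Hom.base g :=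
      congrArg (fun f : (Groth.mapFunctor α).obj X ⟶ (Groth.mapFunctor α).obj Y =>
        Groth.Hom.base f) e
    refine groth_hom_ext e₁ ?_
    refine (faithful_iff_arr (F := (α.app (op X.base)).toFunctor)).1 inferInstance
      ⟨Groth.Hom.fiber f⟩ ⟨Groth.Hom.fiber g⟩ rfl
      (congrArg (fun b => (F.map b.op).toFunctor.obj Y.fiber) e₁) ?_
    exact (mk_fiber_map α f).symm.trans
      ((congrArg (fun f => Arr.mk (Groth.Hom.fiber f)) e).trans (mk_fiber_map α g))⟩
  full := ⟨fun {X Y} f => by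
    have := h (op X.base)
    obtain ⟨⟨φ⟩, h₁, h₂, h₃⟩ := (full_iff_arr
      (F := (α.app (op X.base)).toFunctor)).1 inferInstance X.fiber
      ((F.map (Groth.Hom.base f).op).toFunctor.obj Y.fiber) ⟨Groth.Hom.fiber f⟩ rfl
      (Groth.map_obj_aux α (Groth.Hom.base f) Y.fiber)
    dsimp only at h₁ h₂
    subst h₁ h₂
    let b : X.base ⟶ Y.base := Groth.Hom.base (X := (Groth.mapFunctor α).obj X) f
    exact ⟨Groth.Hom.mk b φ, groth_hom_ext rfl ((mk_fiber_map α _).trans h₃)⟩⟩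
  essSurj := ⟨fun Y => by
    have := h (op Y.base)
    exact ⟨⟨Y.base, (α.app (op Y.base)).toFunctor.objPreimage Y.fiber⟩,
      ⟨(fiberIncl G Y.base).mapIso ((α.app (op Y.base)).toFunctor.objObjPreimageIso Y.fiber)⟩⟩⟩

theorem levelEq_of_isEquivalence {α : F ⟶ G} (h : (Groth.mapFunctor α).IsEquivalence) :
    levelEq C α := fun c =>
  { faithful := ⟨fun {x y φ ψ} e => by
      have := faithful_fiberIncl (F := F) c.unop
      refine (fiberIncl F c.unop).map_injective ((Groth.mapFunctor α).map_injective ?_)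
      exact (fiberIncl_map α c.unop φ).trans ((congrArg (fiberIncl G c.unop).map e).trans
        (fiberIncl_map α c.unop ψ).symm)⟩
    full := by
      refine full_iff_arr.2 ?_
      rintro x y ⟨χ⟩ rfl rfl
      obtain ⟨f, hf⟩ := (Groth.mapFunctor α).map_surjective
        (X := (fiberIncl F c.unop).obj x) (Y := (fiberIncl F c.unop).obj y)
        ((fiberIncl G c.unop).map χ)
      have e₁ : Groth.Hom.base f = 𝟙 c.unop := congrArg (fun f => Groth.Hom.base f) hf
      refine ⟨⟨Groth.Hom.fiber f⟩, rfl, ?_, ?_⟩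
      · dsimp only
        rw [e₁]
        exact Groth.map_id_obj y
      · exact (mk_fiber_map α f).symm.trans
          ((congrArg (fun f => Arr.mk (Groth.Hom.fiber f)) hf).trans (mk_fiber_fiberIncl χ))
    essSurj := ⟨fun y => by
      -- The isomorphism from `(c, y)` to the image of `X` need not lie over an identity. Its fibre
      -- component is still invertible, so `y` is isomorphic to the image of `X.fiber` pulled back
      -- along the base component.
      let X := (Groth.mapFunctor α).objPreimage ⟨c.unop, y⟩
      let e := ((Groth.mapFunctor α).objObjPreimageIso ⟨c.unop, y⟩).symm
      have := isIso_fiber e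
      refine ⟨(F.map (Groth.Hom.base e.hom).op).toFunctor.obj X.fiber, ⟨?_⟩⟩
      exact eqToIso (Groth.map_obj_aux α _ _) ≪≫ (asIso (Groth.Hom.fiber e.hom)).symm⟩ }

end Groth

variable {C : Type u} [Category.{u} C]

/-! ### Cartesian morphisms without transports -/

section CartMarked

variable {A B : Type u} [Category.{u} A] [Category.{u} B] (p : A ⥤ B)

theorem isHomLift_iff {a b : A} {R : B} (f : R ⟶ p.obj b) (φ : a ⟶ b) :
    p.IsHomLift f φ ↔ Arr.mk (p.map φ) = Arr.mk f := by
  constructor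
  · intro h
    exact (Arr.mk_eq_mk_iff _ _).2 ⟨IsHomLift.domain_eq p f φ, rfl, IsHomLift.fac' p f φ⟩
  · intro h
    obtain ⟨h₁, h₂, h₃⟩ := (Arr.mk_eq_mk_iff _ _).1 h
    exact IsHomLift.of_fac' _ _ _ h₁ h₂.symm h₃

theorem isHomLift_map_iff {a b : A} (f : p.obj a ⟶ p.obj b) (φ : a ⟶ b) :
    p.IsHomLift f φ ↔ p.map φ = f :=
  (isHomLift_iff p f φ).trans Arr.mk_inj

theorem isCartesianMor_iff {a b : A} (g : a ⟶ b) : IsCartesianMor p g ↔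
    ∀ (z : A) (h : z ⟶ b) (f : p.obj z ⟶ p.obj a), p.map h = f ≫ p.map g →
      ∃! h' : z ⟶ a, p.map h' = f ∧ h' ≫ g = h := by
  constructor
  · intro hg z h f hf
    have : p.IsHomLift (f ≫ p.map g) h := (isHomLift_map_iff _ _ _).2 hf
    obtain ⟨k, ⟨h₁, h₂⟩, h₃⟩ := hg.universal_property' f h
    refine ⟨k, ⟨(isHomLift_map_iff p f k).1 h₁, h₂⟩, fun y hy => h₃ y ⟨?_, hy.2⟩⟩
    exact (isHomLift_map_iff p f y).2 hy.1
  · intro hg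
    refine { toIsHomLift := (isHomLift_map_iff p _ g).2 rfl, universal_property' := ?_ }
    intro z f h hh
    obtain ⟨k, ⟨h₁, h₂⟩, h₃⟩ := hg z h f ((isHomLift_map_iff _ _ _).1 hh)
    refine ⟨k, ⟨(isHomLift_map_iff p f k).2 h₁, h₂⟩, fun y hy => h₃ y ⟨?_, hy.2⟩⟩
    exact (isHomLift_map_iff p f y).1 hy.1

theorem isGrothendieckFibration_iff : IsGrothendieckFibration p ↔
    ∀ (a : A) (m : Arr B), m.tgt = p.obj a → ∃ n : Arr A, n.tgt = a ∧ Arr.map p n = m ∧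
      IsCartesianMor p n.hom := by
  constructor
  · rintro h a ⟨f⟩ rfl
    obtain ⟨a', g, hg⟩ := h f
    have h₁ := IsHomLift.domain_eq p f g
    subst h₁
    obtain rfl := (isHomLift_map_iff p f g).1 inferInstance
    exact ⟨⟨g⟩, rfl, rfl, hg⟩
  · intro h a c f
    obtain ⟨⟨g⟩, rfl, h₁, hg⟩ := h a ⟨f⟩ rfl
    obtain rfl : _ = c := congrArg Arr.src h₁
    obtain rfl := Arr.mk_inj.1 h₁
    exact ⟨_, g, hg⟩

end CartMarked

/-! ### Cartesian morphisms of the Grothendieck construction -/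

section Groth

variable (F : Cᵒᵖ ⥤ Cat.{u, u})

/-- Factoring `h` through `g` over `f` amounts to solving `χ ≫ ψ = h` in the fibre, up to transport,
where `ψ` is the pullback along `f` of the fibre component of `g`. As `ψ` is invertible there is
exactly one solution. -/
theorem groth_cartesian_of_isIso {X Y : Groth F} (g : X ⟶ Y) (hg : IsIso (Groth.Hom.fiber g)) :
    IsCartesianMor (Groth.forget F) g := by
  refine (isCartesianMor_iff _ _).2 fun Z h (f : Z.base ⟶ X.base) hf => ?_
  have hf' : Groth.Hom.base h = f ≫ Groth.Hom.base g := hf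
  obtain ⟨ψ, hψ⟩ : ∃ ψ, ψ = (F.map f.op).toFunctor.map (Groth.Hom.fiber g) := ⟨_, rfl⟩
  have : IsIso ψ := by
    rw [hψ]
    exact Functor.map_isIso (F.map f.op).toFunctor (Groth.Hom.fiber g)
  have e : (F.map (Groth.Hom.base h).op).toFunctor.obj Y.fiber =
      (F.map f.op).toFunctor.obj ((F.map (Groth.Hom.base g).op).toFunctor.obj Y.fiber) := by
    rw [hf']
    exact (Groth.map_comp_obj f (Groth.Hom.base g) Y.fiber).symm
  have key (χ : Z.fiber ⟶ (F.map f.op).toFunctor.obj X.fiber) :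
      (Groth.Hom.mk f χ : Z ⟶ X) ≫ g = h ↔ χ ≫ ψ = Groth.Hom.fiber h ≫ eqToHom e := by
    rw [← Arr.mk_inj (f := χ ≫ ψ), Arr.mk_comp_eqToHom]
    have h₁ : Arr.mk (Groth.Hom.fiber ((Groth.Hom.mk f χ : Z ⟶ X) ≫ g)) = Arr.mk (χ ≫ ψ) :=
      by
      rw [hψ]
      exact (comp_mk_fiber (Groth.Hom.mk f χ : Z ⟶ X) g).unique (.mk χ _)
    rw [← h₁]
    exact ⟨fun h => by rw [h], fun h => groth_hom_ext hf'.symm h⟩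
  refine ⟨Groth.Hom.mk f ((Groth.Hom.fiber h ≫ eqToHom e) ≫ inv ψ), ⟨rfl, (key _).2 ?_⟩, ?_⟩
  · rw [Category.assoc, IsIso.inv_hom_id, Category.comp_id]
  · rintro ⟨b, χ⟩ ⟨h₁, h₂⟩
    obtain rfl : b = f := h₁
    have := (key χ).1 h₂
    rw [← this, Category.assoc, IsIso.hom_inv_id, Category.comp_id]

/-- The cartesian lift of `f`. -/
def grothLift {c : C} (Y : Groth F) (f : c ⟶ Y.base) :
    (⟨c, (F.map f.op).toFunctor.obj Y.fiber⟩ : Groth F) ⟶ Y :=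
  Groth.Hom.mk f (𝟙 _)

/-- A cartesian morphism differs by an isomorphism from the canonical lift of its base, whose fibre
component is an identity; isomorphisms have invertible fibre components. -/
theorem isIso_of_cartesian {X Y : Groth F} (g : X ⟶ Y) (hg : IsCartesianMor (Groth.forget F) g) :
    IsIso (Groth.Hom.fiber g) := by
  let g₀ := grothLift F Y (Groth.Hom.base g)
  have h₀ : IsCartesianMor (Groth.forget F) g₀ :=
    groth_cartesian_of_isIso F g₀ (inferInstanceAs (IsIso (𝟙 _)))
  have : (Groth.forget F).IsStronglyCartesian (Groth.Hom.base g) g := hg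
  have : (Groth.forget F).IsStronglyCartesian (Groth.Hom.base g) g₀ := h₀
  let e := Functor.IsCartesian.domainUniqueUpToIso (Groth.forget F) (Groth.Hom.base g) g₀ g
  have he : e.hom ≫ g₀ = g := Functor.IsCartesian.fac (Groth.forget F) (Groth.Hom.base g) g₀ g
  have h₁ := comp_mk_fiber e.hom g₀
  rw [he] at h₁
  have := isIso_fiber e
  obtain h₂ := (Arr.Comp.iff_of_hom _ _ _).1 h₁
  have : IsIso ((F.map (Groth.Hom.base e.hom).op).toFunctor.map (Groth.Hom.fiber g₀)) :=
    Functor.map_isIso _ (𝟙 _)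
  exact Arr.isIso_congr h₂.symm (inferInstanceAs (IsIso (Groth.Hom.fiber e.hom ≫
    (F.map (Groth.Hom.base e.hom).op).toFunctor.map (Groth.Hom.fiber g₀))))

/-- The marked Grothendieck construction is a cart-marked Grothendieck fibration. -/
theorem isCartMarkedFibration_groth : IsCartMarkedFibration ((groth C).obj F) where
  isGrothendieckFibration := by
    refine (isGrothendieckFibration_iff _).2 ?_
    rintro Y ⟨f⟩ rfl
    exact ⟨⟨grothLift F Y f⟩, rfl, rfl,
      groth_cartesian_of_isIso F _ (inferInstanceAs (IsIso (𝟙 _)))⟩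
  marked_iff _ _ g := ⟨groth_cartesian_of_isIso F g, isIso_of_cartesian F g⟩

end Groth

/-! ### The unit at a cart-marked fibration -/

section Unit

variable {P : Over (MarkedCat.sharp C)} (hP : IsCartMarkedFibration P)

include hP

/-- A morphism from `idArrow P a` to `Y` is just a morphism `a ⟶ Y.right` of `P` over `Y.hom`, so
bijectivity of composition with `w` is the universal property of the cartesian morphism `w.right`.
-/
theorem idArrow_colocal (a : P.left) ⦃Y Z : StructuredArrow ((proj P).obj a) (proj P)⦄ (w : Y ⟶ Z)
    (hw : P.left.marked w.right) : Function.Bijective fun f : idArrow P a ⟶ Y => f ≫ w := by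
  have hw' := (isCartesianMor_iff _ _).1 ((hP.marked_iff _).1 hw)
  have e {Y : StructuredArrow ((proj P).obj a) (proj P)} (f : idArrow P a ⟶ Y) :
      (proj P).map f.right = Y.hom := (Category.id_comp _).symm.trans (StructuredArrow.w f)
  constructor
  · intro f g h
    have h₁ : f.right ≫ w.right = g.right ≫ w.right :=
      congrArg (fun k : idArrow P a ⟶ Z => k.right) h
    refine StructuredArrow.hom_ext _ _ ?_
    exact (hw' a (f.right ≫ w.right) Y.hom (by rw [Functor.map_comp, e])).unique
      ⟨e f, rfl⟩ ⟨e g, h₁.symm⟩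
  · intro g
    obtain ⟨k, ⟨h₁, h₂⟩, -⟩ := hw' a g.right Y.hom (by rw [e, StructuredArrow.w w])
    exact ⟨StructuredArrow.homMk k ((Category.id_comp _).trans h₁), StructuredArrow.hom_ext _ _ h₂⟩

/-- By colocality, a morphism of the localization from `idArrow P a` to the pullback of `idArrow P
b` along `f` comes from exactly one morphism of the comma category, that is, from one morphism `a ⟶
b` over `f`. This is full faithfulness. For essential surjectivity, an object `s : c ⟶ P a` is
identified with an `idArrow` by a cartesian lift of `s`, which is marked and so inverted. -/
theorem isEquivalence_unit : (fctr (unit P)).IsEquivalence where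
  faithful := ⟨fun {a b f g} h => by
    have h₁ : (proj P).map f = (proj P).map g :=
      congrArg (fun f : (unitFunctor P).obj a ⟶ (unitFunctor P).obj b => Groth.Hom.base f) h
    have h₂ : Arr.map (locQ P _) ⟨idArrowHom P f⟩ = Arr.map (locQ P _) ⟨idArrowHom P g⟩ :=
      congrArg (fun f : (unitFunctor P).obj a ⟶ (unitFunctor P).obj b =>
        Arr.mk (Groth.Hom.fiber f)) h
    let g' : idArrow P a ⟶ (StructuredArrow.map ((proj P).map f)).obj (idArrow P b) :=
      StructuredArrow.homMk g (by simp [h₁])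
    have h₃ : Arr.mk (idArrowHom P g) = Arr.mk g' := comma_arr_ext rfl rfl
    rw [h₃] at h₂
    have h₄ := (bijective_map_of_colocal (commaMarked P _) (idArrow_colocal hP a) _).1 (Arr.mk_inj.1 h₂)
    exact congrArg (fun k => StructuredArrow.Hom.right k) h₄⟩
  full := ⟨fun {a b} (f : (unitFunctor P).obj a ⟶ (unitFunctor P).obj b) => by
    obtain ⟨f, ψ⟩ := f
    obtain ⟨k, hk⟩ := (bijective_map_of_colocal (commaMarked P _) (idArrow_colocal hP a)
      ((StructuredArrow.map f).obj (idArrow P b))).2 ψ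
    have e : (proj P).map k.right = f :=
      (Category.id_comp _).symm.trans ((StructuredArrow.w k).trans (Category.comp_id _))
    refine ⟨k.right, ?_⟩
    refine groth_hom_ext (f := unitMap P k.right) (g := ⟨f, ψ⟩) e ?_
    have h : Arr.mk (idArrowHom P k.right) = Arr.mk k := comma_arr_ext rfl rfl
    exact (congrArg (Arr.map (locQ P _)) h).trans (congrArg Arr.mk hk)⟩
  essSurj := ⟨fun (X : Groth ((TPlus C).obj P)) => by
    obtain ⟨c, x⟩ := X
    obtain ⟨S, rfl⟩ := (Localization.Construction.objEquiv (comma P c).marked).surjective x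
    obtain ⟨⟨⟨⟩⟩, a, s⟩ := S
    change c ⟶ (proj P).obj a at s
    obtain ⟨⟨g⟩, rfl, h, hg⟩ := (isGrothendieckFibration_iff _).1 hP.isGrothendieckFibration a ⟨s⟩ rfl
    obtain rfl : _ = c := congrArg Arr.src h
    obtain rfl := Arr.mk_inj.1 h
    let k : idArrow P _ ⟶ StructuredArrow.mk ((proj P).map g) :=
      StructuredArrow.homMk g (Category.id_comp _)
    have : IsIso ((locQ P _).map k) := isIso_locQ_map P k ((hP.marked_iff _).2 hg)
    exact ⟨_, ⟨(fiberIncl _ _).mapIso (@asIso _ _ _ _ ((locQ P _).map k) this)⟩⟩⟩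

end Unit

/-! ### Weak equivalences of marked categories over the base -/

/-- The weak equivalences of `Cat⁺ / C♯`: the morphisms inverted by `T⁺` up to equivalence. -/
def weq (C : Type u) [Category.{u} C] : MorphismProperty (Over (MarkedCat.sharp C)) :=
  (levelEq C).inverseImage (TPlus C)

instance : (weq C).HasTwoOutOfThreeProperty :=
  inferInstanceAs ((levelEq C).inverseImage (TPlus C)).HasTwoOutOfThreeProperty

theorem levelEq_of_isIso {F G : Cᵒᵖ ⥤ Cat.{u, u}} (α : F ⟶ G) [IsIso α] : levelEq C α := fun c =>
  (Cat.equivOfIso (asIso (α.app c))).isEquivalence_functor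

/-- The unit at a Grothendieck construction is an equivalence, so by the triangle identity the image
of the counit under the Grothendieck construction is one too, and equivalences are detected there.
-/
theorem levelEq_counit (F : Cᵒᵖ ⥤ Cat.{u, u}) : levelEq C (counit F) := by
  refine levelEq_of_isEquivalence ?_
  have h := isEquivalence_unit (isCartMarkedFibration_groth F)
  have e : fctr (unit ((groth C).obj F)) ⋙ Groth.mapFunctor (counit F) = 𝟭 _ :=
    congrArg (fun f => fctr f) (right_triangle F)
  have : (fctr (unit ((groth C).obj F)) ⋙ Groth.mapFunctor (counit F)).IsEquivalence := by
    rw [e]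
    exact inferInstanceAs (𝟭 (Groth F)).IsEquivalence
  exact Functor.isEquivalence_of_comp_left (fctr (unit ((groth C).obj F))) _

/-- No fibrancy is needed: the other triangle identity exhibits the counit, a level-wise
equivalence, as a left inverse of the image of the unit. -/
theorem weq_unit (P : Over (MarkedCat.sharp C)) : weq C (unit P) :=
  (levelEq C).of_postcomp _ (counit _) (levelEq_counit _) (by
    rw [left_triangle]
    exact levelEq_of_isIso _)

theorem isEquivalence_iff_of_square {A₁ A₂ A₃ A₄ : Type u} [Category.{u} A₁] [Category.{u} A₂]
    [Category.{u} A₃] [Category.{u} A₄] {f : A₁ ⥤ A₂} {g : A₂ ⥤ A₄} {h : A₁ ⥤ A₃} {k : A₃ ⥤ A₄}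
    (e : f ⋙ g = h ⋙ k) (hg : g.IsEquivalence) (hh : h.IsEquivalence) :
    f.IsEquivalence ↔ k.IsEquivalence := by
  constructor
  · intro hf
    have : (h ⋙ k).IsEquivalence := e ▸ inferInstance
    exact Functor.isEquivalence_of_comp_left h k
  · intro hk
    have : (f ⋙ g).IsEquivalence := e ▸ inferInstance
    exact Functor.isEquivalence_of_comp_right f g

/-- In the naturality square of the unit, both vertical functors are equivalences. -/
theorem weq_iff_isEquivalence {P Q : Over (MarkedCat.sharp C)} (hP : IsCartMarkedFibration P)
    (hQ : IsCartMarkedFibration Q) (f : P ⟶ Q) : weq C f ↔ (fctr f).IsEquivalence := by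
  have h₁ := isEquivalence_unit hP
  have h₂ := isEquivalence_unit hQ
  have e : fctr f ⋙ fctr (unit Q) = fctr (unit P) ⋙ Groth.mapFunctor ((TPlus C).map f) :=
    congrArg (fun f => fctr f) (unit_naturality f)
  exact Iff.trans ⟨isEquivalence_mapFunctor, levelEq_of_isEquivalence⟩
    (isEquivalence_iff_of_square e h₂ h₁).symm

/-- The marked Grothendieck construction detects weak equivalences. -/
theorem weq_groth_map_iff {F G : Cᵒᵖ ⥤ Cat.{u, u}} (α : F ⟶ G) :
    weq C ((groth C).map α) ↔ levelEq C α :=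
  (weq_iff_isEquivalence (isCartMarkedFibration_groth F) (isCartMarkedFibration_groth G) _).trans
    ⟨levelEq_of_isEquivalence, isEquivalence_mapFunctor⟩

variable {C : Type u} [Category.{u} C]

theorem isEquivalence_locMap {A B : MarkedCat.{u}} (F : A ⟶ B) (hF : F.toFunctor.IsEquivalence)
    (h : B.marked ≤ A.marked.map F.toFunctor) : (MarkedCat.locMap F).IsEquivalence := by
  let Φ : LocalizerMorphism A.marked B.marked := ⟨F.toFunctor, fun _ _ f hf => F.map_marked f hf⟩
  have : Φ.functor.IsEquivalence := hF
  have : Φ.IsLocalizedEquivalence := LocalizerMorphism.IsLocalizedEquivalence.of_equivalence Φ h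
  have : CatCommSq Φ.functor A.marked.Q B.marked.Q (MarkedCat.locMap F) :=
    ⟨eqToIso (MarkedCat.Q_locMap F).symm⟩
  exact Φ.isEquivalence A.marked.Q B.marked.Q _

section Comma

variable {A : MarkedCat.{u}} {Q : Over (MarkedCat.sharp C)} (F : A ⟶ Q.left)
  (c : C)

/-- A composite as a morphism of the slice category. -/
abbrev overComp : Over.mk (F ≫ Q.hom) ⟶ Q := Over.homMk F

/-- An object of the comma category of `F ⋙ proj Q` isomorphic to a given one. -/
def commaLift {a : A} (X : StructuredArrow c (proj Q)) (α : F.toFunctor.obj a ≅ X.right) :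
    StructuredArrow c (proj (Over.mk (F ≫ Q.hom))) :=
  StructuredArrow.mk (Y := a) (X.hom ≫ (proj Q).map α.inv)

/-- `commaLift` is sent to the given object. -/
def commaLiftIso {a : A} (X : StructuredArrow c (proj Q)) (α : F.toFunctor.obj a ≅ X.right) :
    (commaMapFunctor (overComp F) c).obj (commaLift F c X α) ≅ X :=
  StructuredArrow.isoMk α (by
    change ((X.hom ≫ (proj Q).map α.inv) ≫ 𝟙 _) ≫ (proj Q).map α.hom = X.hom
    simp [← Functor.map_comp])

theorem isEquivalence_commaMapFunctor (hF : F.toFunctor.IsEquivalence) :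
    (commaMapFunctor (overComp F) c).IsEquivalence where
  faithful := ⟨fun h => StructuredArrow.hom_ext _ _ (F.toFunctor.map_injective
    (congrArg (fun k => StructuredArrow.Hom.right k) h))⟩
  full := ⟨fun {X Y} g => by
    obtain ⟨k, hk⟩ := F.toFunctor.map_surjective (X := X.right) (Y := Y.right) g.right
    have h := StructuredArrow.w g
    have h' : (X.hom ≫ 𝟙 _) ≫ (proj Q).map g.right = Y.hom ≫ 𝟙 _ := h
    refine ⟨StructuredArrow.homMk k ?_, StructuredArrow.hom_ext _ _ hk⟩
    change X.hom ≫ (proj Q).map (F.toFunctor.map k) = Y.hom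
    rw [hk]
    exact (congrArg (· ≫ (proj Q).map g.right) (Category.comp_id X.hom).symm).trans
      (h'.trans (Category.comp_id _))⟩
  essSurj := ⟨fun X => ⟨_, ⟨commaLiftIso F c X (F.toFunctor.objObjPreimageIso X.right)⟩⟩⟩

/-- `MorphismProperty.map` is closed under isomorphism, so the hypothesis only gives a marked
morphism of `A` whose image is isomorphic to `w.right`. The structure maps of the comma category are
transported along that isomorphism. -/
theorem comma_marked_le_map (h : Q.left.marked ≤ A.marked.map F.toFunctor) :
    (comma Q c).marked ≤
      (comma (Over.mk (F ≫ Q.hom)) c).marked.map (commaMapFunctor (overComp F) c) := by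
  intro X Y w hw
  obtain ⟨a, b, m, hm, ⟨e⟩⟩ := h _ hw
  let α : F.toFunctor.obj a ≅ X.right := Arrow.leftFunc.mapIso e
  let β : F.toFunctor.obj b ≅ Y.right := Arrow.rightFunc.mapIso e
  have e' : F.toFunctor.map m ≫ β.hom = α.hom ≫ w.right := (Arrow.w e.hom).symm
  have e'' : α.inv ≫ F.toFunctor.map m = w.right ≫ β.inv := by
    rw [Iso.inv_comp_eq, ← Category.assoc, Iso.eq_comp_inv, e']
  let k : commaLift F c X α ⟶ commaLift F c Y β := StructuredArrow.homMk m (by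
    change (X.hom ≫ (proj Q).map α.inv) ≫ (proj Q).map (F.toFunctor.map m) =
      Y.hom ≫ (proj Q).map β.inv
    rw [Category.assoc, ← Functor.map_comp, e'', Functor.map_comp, StructuredArrow.w_assoc])
  refine ⟨_, _, k, hm, ⟨Arrow.isoMk (commaLiftIso F c X α) (commaLiftIso F c Y β) ?_⟩⟩
  exact StructuredArrow.hom_ext _ _ e'.symm

theorem weq_overComp (hF : F.toFunctor.IsEquivalence)
    (h : Q.left.marked ≤ A.marked.map F.toFunctor) : weq C (overComp F) := fun c =>
  isEquivalence_locMap (commaMap (overComp F) c.unop) (isEquivalence_commaMapFunctor F c.unop hF)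
    (comma_marked_le_map F c.unop h)

end Comma

theorem weq_of_isEquivalence_aux {A : MarkedCat.{u}} (p : A ⟶ MarkedCat.sharp C)
    (Q : Over (MarkedCat.sharp C)) (F : A ⟶ Q.left) (e : F ≫ Q.hom = p)
    (hF : F.toFunctor.IsEquivalence) (h : Q.left.marked ≤ A.marked.map F.toFunctor) :
    weq C (Over.homMk F e : Over.mk p ⟶ Q) := by
  subst e
  exact weq_overComp F hF h

theorem weq_of_isEquivalence {P Q : Over (MarkedCat.sharp C)} (f : P ⟶ Q)
    (hf : (fctr f).IsEquivalence) (h : Q.left.marked ≤ P.left.marked.map (fctr f)) : weq C f :=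
  weq_of_isEquivalence_aux P.hom Q f.left (Over.w f) hf h

/-! ### Cofibrations, trivial fibrations and the mapping cylinder -/

/-- The injective-on-objects functors. -/
def cof (C : Type u) [Category.{u} C] : MorphismProperty (Over (MarkedCat.sharp C)) :=
  fun _ _ f => Function.Injective (fctr f).obj

/-- A marked functor reflects the marking. -/
def Reflects {P Q : Over (MarkedCat.sharp C)} (f : P ⟶ Q) : Prop :=
  ∀ m : Arr P.left, MarkedCat.IsMarked (MarkedCat.arrMap f.left m) → MarkedCat.IsMarked m

/-- The surjective-on-objects, fully faithful and mark reflecting functors. -/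
def tf (C : Type u) [Category.{u} C] : MorphismProperty (Over (MarkedCat.sharp C)) :=
  fun _ _ f => Function.Surjective (fctr f).obj ∧ (fctr f).Full ∧ (fctr f).Faithful ∧ Reflects f

theorem tf_le_weq : tf C ≤ weq C := by
  intro P Q f ⟨h₁, h₂, h₃, h₄⟩
  refine weq_of_isEquivalence f (isIsofibration_and_isEquivalence_iff.2 ⟨h₁, h₂, h₃⟩).2 ?_
  intro a b m hm
  obtain ⟨a, rfl⟩ := h₁ a
  obtain ⟨b, rfl⟩ := h₁ b
  obtain ⟨m, rfl⟩ := (fctr f).map_surjective m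
  exact ⟨_, _, m, h₄ ⟨m⟩ hm, ⟨Iso.refl _⟩⟩

theorem over_hom_ext {P Q : Over (MarkedCat.sharp C)} {f g : P ⟶ Q} (h : fctr f = fctr g) : f = g :=
  Over.OverMorphism.ext (MarkedCat.hom_ext h)

theorem fctr_congr {P Q : Over (MarkedCat.sharp C)} {f g : P ⟶ Q} (h : f = g) : fctr f = fctr g :=
  h ▸ rfl

/-- Injectivity on objects lets the value on the image of `i` be dictated by `u`, and surjectivity
of `p` provides a value elsewhere. Full faithfulness extends this to a functor, which preserves
markings because `p` reflects them. -/
theorem cof_le_tf_llp : cof C ≤ (tf C).llp := by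
  intro P Q i hi X Y p ⟨h₁, h₂, h₃, h₄⟩
  constructor
  intro u v sq
  have hw : fctr u ⋙ fctr p = fctr i ⋙ fctr v := fctr_congr sq.w
  have key (b : Q.left) : ∃ x : X.left, (fctr p).obj x = (fctr v).obj b ∧
      ∀ a : P.left, (fctr i).obj a = b → (fctr u).obj a = x := by
    by_cases hb : ∃ a, (fctr i).obj a = b
    · obtain ⟨a, rfl⟩ := hb
      exact ⟨_, Functor.congr_obj hw a, fun a' ha' => by rw [hi ha']⟩
    · obtain ⟨x, hx⟩ := h₁ ((fctr v).obj b)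
      exact ⟨x, hx, fun a ha => (hb ⟨a, ha⟩).elim⟩
  choose l hl hl' using key
  let L := liftFF (fctr p) (fctr v) l hl
  have hL : L ⋙ fctr p = fctr v := liftFF_comp _ _ _ _
  let L' : Q ⟶ X := Over.homMk
    { toFunctor := L
      map_marked := fun a b f hf => h₄ ⟨L.map f⟩ (by
        have h := Arr.map_congr hL ⟨f⟩
        exact (congrArg MarkedCat.IsMarked h).mpr (v.left.map_marked f hf)) }
    (MarkedCat.hom_ext (by
      change L ⋙ proj X = proj Q
      rw [← fctr_comp_proj p, ← Functor.assoc, hL, fctr_comp_proj]))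
  refine ⟨⟨⟨L', over_hom_ext ?_, over_hom_ext hL⟩⟩⟩
  refine faithful_functor_ext (fctr p) (fun a => (hl' _ a rfl).symm) ?_
  change fctr i ⋙ L ⋙ fctr p = _
  rw [hL, hw]

section Factorization

variable {P Q : Over (MarkedCat.sharp C)} (f : P ⟶ Q)

/-- The projection of the mapping cylinder. -/
abbrev cylπ : Ind (Sum.elim (fctr f).obj id : P.left ⊕ Q.left → Q.left) ⥤ Q.left := Ind.π _

/-- The inclusion in the mapping cylinder. -/
noncomputable abbrev cylι : P.left ⥤ Ind (Sum.elim (fctr f).obj id : P.left ⊕ Q.left → Q.left) :=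
  liftFF (cylπ f) (fctr f) Sum.inl (fun _ => rfl)

/-- The mapping cylinder of a morphism, with the morphisms and the marking of the target. -/
def cyl : Over (MarkedCat.sharp C) :=
  Over.mk (Y :=
    { carrier := Ind (Sum.elim (fctr f).obj id : P.left ⊕ Q.left → Q.left)
      marked := fun _ _ g => MarkedCat.IsMarked (Arr.map (cylπ f) ⟨g⟩)
      id_marked := fun _ => Q.left.id_marked _ })
    { toFunctor := cylπ f ⋙ proj Q
      map_marked := fun _ _ _ _ => trivial }

/-- The projection of the mapping cylinder. -/
def cylProj : cyl f ⟶ Q :=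
  Over.homMk
    { toFunctor := cylπ f
      map_marked := fun _ _ _ h => h }
    (MarkedCat.hom_ext rfl)

/-- The inclusion in the mapping cylinder. -/
noncomputable def cylIncl : P ⟶ cyl f :=
  Over.homMk
    { toFunctor := cylι f
      map_marked := fun a b g hg => by
        have h := Arr.map_congr (liftFF_comp (cylπ f) (fctr f) Sum.inl (fun _ => rfl)) ⟨g⟩
        exact (congrArg MarkedCat.IsMarked h).mpr (f.left.map_marked g hg) }
    (MarkedCat.hom_ext (by
      have h := liftFF_comp (cylπ f) (fctr f) Sum.inl (fun _ => rfl)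
      exact (congrArg (fun k => k ⋙ proj Q) h).trans (fctr_comp_proj f)))

theorem cylIncl_cylProj : cylIncl f ≫ cylProj f = f :=
  over_hom_ext (liftFF_comp (cylπ f) (fctr f) Sum.inl (fun _ => rfl))

theorem cof_cylIncl : cof C (cylIncl f) := fun _ _ h => Sum.inl_injective h

theorem tf_cylProj : tf C (cylProj f) :=
  ⟨fun x => ⟨Sum.inr x, rfl⟩, inferInstanceAs (cylπ f).Full, inferInstanceAs (cylπ f).Faithful,
    fun _ h => h⟩

end Factorization

instance : (cof C).HasFactorization (tf C) where
  nonempty_mapFactorizationData f := ⟨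
    { Z := cyl f
      i := cylIncl f
      p := cylProj f
      fac := cylIncl_cylProj f
      hi := cof_cylIncl f
      hp := tf_cylProj f }⟩

instance : (cof C).IsStableUnderRetracts where
  of_retract h hg := by
    intro a b hab
    have e := Functor.congr_obj (fctr_congr h.i_w)
    have e' := Functor.congr_obj (fctr_congr h.retract_left)
    have := hg ((e a).trans ((congrArg (fctr h.i.right).obj hab).trans (e b).symm))
    exact (e' a).symm.trans ((congrArg (fctr h.r.left).obj this).trans (e' b))

instance : (tf C).IsStableUnderRetracts where
  of_retract h hg :=
    ⟨surjective_of_retract _ _ _ (fctr_congr h.retract_right) (fctr_congr h.r_w) hg.1,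
    full_of_retract _ _ _ _ (fctr_congr h.retract_left) (fctr_congr h.retract_right)
      (fctr_congr h.i_w) (fctr_congr h.r_w) hg.2.1,
    faithful_of_retract _ _ _ (fctr_congr h.retract_left) (fctr_congr h.i_w) hg.2.2.1, fun m hm => by
      have h₁ := hg.2.2.2 (MarkedCat.arrMap h.i.left.left m) (by
        have e := Arr.map_congr (fctr_congr h.i_w) m
        exact (congrArg MarkedCat.IsMarked e).mpr (hm.map _))
      have e := Arr.map_congr (fctr_congr h.retract_left) m
      exact (congrArg MarkedCat.IsMarked e).mp (h₁.map h.r.left.left)⟩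

instance : (cof C).IsWeakFactorizationSystem (tf C) :=
  MorphismProperty.IsWeakFactorizationSystem.mk' _ _ fun _ _ hi hp => cof_le_tf_llp _ hi _ hp

theorem tf_groth_map {F G : Cᵒᵖ ⥤ Cat.{u, u}} {α : F ⟶ G} (h : (levelIsofib C ⊓ levelEq C) α) :
    tf C ((groth C).map α) := by
  have e := isEquivalence_mapFunctor h.2
  refine ⟨fun Y => ?_, e.full, e.faithful, fun ⟨g⟩ hg => ?_⟩
  · obtain ⟨x, hx⟩ := (levelTF_iff.1 h).1 (op (Groth.base Y)) (Groth.fiber Y)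
    exact ⟨⟨Groth.base Y, x⟩, congrArg (Groth.mk (Groth.base Y)) hx⟩
  · rename_i X Y
    have := h.2 (op (Groth.base X))
    have h' : IsIso ((α.app (op (Groth.base X))).toFunctor.map (Groth.Hom.fiber g)) :=
      Arr.isIso_congr (mk_fiber_map α g) hg
    exact isIso_of_reflects_iso (Groth.Hom.fiber g) (α.app (op (Groth.base X))).toFunctor

/-! ### Trivial cofibrations as a left lifting class -/

/-- The trivial cofibrations of `Cat⁺ / C♯`. -/
abbrev tcof (C : Type u) [Category.{u} C] : MorphismProperty (Over (MarkedCat.sharp C)) :=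
  cof C ⊓ weq C

/-- The image of level-wise isofibrations by the marked Grothendieck construction. -/
inductive grothIsofib (C : Type u) [Category.{u} C] :
    ∀ {P Q : Over (MarkedCat.sharp C)}, (P ⟶ Q) → Prop
  | mk {F G : Cᵒᵖ ⥤ Cat.{u, u}} (α : F ⟶ G) (h : levelIsofib C α) : grothIsofib C ((groth C).map α)

/-- Morphisms detecting the trivial cofibrations by the left lifting property. -/
def detect (C : Type u) [Category.{u} C] : MorphismProperty (Over (MarkedCat.sharp C)) :=
  fun _ _ f => tf C f ∨ grothIsofib C f

theorem hasLiftingProperty_groth_iff {P Q : Over (MarkedCat.sharp C)} {F G : Cᵒᵖ ⥤ Cat.{u, u}}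
    (i : P ⟶ Q) (α : F ⟶ G) :
    HasLiftingProperty i ((groth C).map α) ↔ HasLiftingProperty ((TPlus C).map i) α :=
  ((adjunction C).hasLiftingProperty_iff i α).symm

/-- The adjunction translates lifting of `i` against a Grothendieck construction into lifting of its
image under `TPlus`. Lifting against the class `tf` makes that image a projective cofibration, and
lifting against isofibrations makes it a level-wise equivalence; `levelIsofib_llp` ties the two
together. -/
theorem tcof_eq : tcof C = (detect C).llp := by
  refine le_antisymm (fun P Q i hi X Y p hp => ?_) (fun P Q i hi => ⟨?_, ?_⟩)
  · obtain hp | ⟨α, h⟩ := hp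
    · exact cof_le_tf_llp i hi.1 p hp
    · refine (hasLiftingProperty_groth_iff i α).2 ?_
      have : (levelIsofib C).llp ((TPlus C).map i) := by
        refine levelIsofib_llp.ge _ ⟨fun F G β hβ => ?_, hi.2⟩
        exact (hasLiftingProperty_groth_iff i β).1 (cof_le_tf_llp i hi.1 _ (tf_groth_map hβ))
      exact this α h
  · rw [← MorphismProperty.llp_eq_of_wfs (cof C) (tf C)]
    exact fun _ _ p hp => hi p (Or.inl hp)
  · exact levelEq_of_llp _ fun F G α h => (hasLiftingProperty_groth_iff i α).1
      (hi _ (Or.inr ⟨α, h⟩))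

open Limits

/-! ### Subobjects -/

section Sub

variable {A : Type u} [Category.{u} A]

/-- A set of arrows closed under the operations of a category. -/
structure ArrClosed (S : Set (Arr A)) : Prop where
  src : ∀ ⦃m⦄, m ∈ S → .id m.src ∈ S
  tgt : ∀ ⦃m⦄, m ∈ S → .id m.tgt ∈ S
  comp : ∀ ⦃m n p⦄, Arr.Comp m n p → m ∈ S → n ∈ S → p ∈ S

/-- The subcategory on a closed set of arrows. -/
structure Sub {S : Set (Arr A)} (_hS : ArrClosed S) : Type u where
  obj : A
  mem : .id obj ∈ S

variable {S : Set (Arr A)} (hS : ArrClosed S)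

instance : Category.{u} (Sub hS) where
  Hom a b := { f : a.obj ⟶ b.obj // Arr.mk f ∈ S }
  id a := ⟨𝟙 a.obj, a.mem⟩
  comp f g := ⟨f.1 ≫ g.1, hS.comp (.mk f.1 g.1) f.2 g.2⟩
  id_comp _ := Subtype.ext (Category.id_comp _)
  comp_id _ := Subtype.ext (Category.comp_id _)
  assoc _ _ _ := Subtype.ext (Category.assoc _ _ _)

/-- The inclusion of a subcategory. -/
def Sub.ι : Sub hS ⥤ A where
  obj a := a.obj
  map f := f.1

theorem Sub.arr_ι_injective : Function.Injective (Arr.map (Sub.ι hS)) := by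
  rintro ⟨f⟩ ⟨g⟩ h
  rename_i a b a' b'
  obtain ⟨a, ha⟩ := a
  obtain ⟨b, hb⟩ := b
  obtain ⟨a', ha'⟩ := a'
  obtain ⟨b', hb'⟩ := b'
  obtain ⟨f, hf⟩ := f
  obtain ⟨g, hg⟩ := g
  obtain rfl : a = a' := congrArg Arr.src h
  obtain rfl : b = b' := congrArg Arr.tgt h
  obtain rfl : f = g := Arr.mk_inj.1 h
  rfl

theorem Sub.arr_ι_mem (m : Arr (Sub hS)) : Arr.map (Sub.ι hS) m ∈ S := m.hom.2

theorem Sub.exists_arr {m : Arr A} (hm : m ∈ S) : ∃ n, Arr.map (Sub.ι hS) n = m :=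
  ⟨⟨(⟨m.hom, hm⟩ : (⟨m.src, hS.src hm⟩ : Sub hS) ⟶ ⟨m.tgt, hS.tgt hm⟩)⟩, rfl⟩

/-- The lift of a functor to a subcategory. -/
def Sub.lift {B : Type u} [Category.{u} B] (F : B ⥤ A) (h : ∀ m, Arr.map F m ∈ S) : B ⥤ Sub hS where
  obj b := ⟨F.obj b, Arr.map_id F b ▸ h (.id b)⟩
  map f := ⟨F.map f, h ⟨f⟩⟩
  map_id _ := Subtype.ext (F.map_id _)
  map_comp _ _ := Subtype.ext (F.map_comp _ _)

end Sub

variable {C : Type u} [Category.{u} C]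

section SubOver

variable (X : Over (MarkedCat.sharp C)) {S : Set (Arr X.left)} (hS : ArrClosed S)

/-- The subobject on a closed set of arrows. -/
def sub : Over (MarkedCat.sharp C) :=
  Over.mk (Y :=
    { carrier := Sub hS
      marked := fun _ _ f => MarkedCat.IsMarked (Arr.map (Sub.ι hS) ⟨f⟩)
      id_marked := fun _ => X.left.id_marked _ })
    { toFunctor := Sub.ι hS ⋙ proj X
      map_marked := fun _ _ _ _ => trivial }

/-- The inclusion of a subobject. -/
def subι : sub X hS ⟶ X :=
  Over.homMk
    { toFunctor := Sub.ι hS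
      map_marked := fun _ _ _ h => h }
    (MarkedCat.hom_ext rfl)

/-- Injectivity on arrows. -/
def ArrInj {P Q : Over (MarkedCat.sharp C)} (f : P ⟶ Q) : Prop :=
  Function.Injective (MarkedCat.arrMap f.left)

theorem ArrInj.cancel {P Q R : Over (MarkedCat.sharp C)} {f : P ⟶ Q} (hf : ArrInj f) {g h : R ⟶ P}
    (e : g ≫ f = h ≫ f) : g = h :=
  over_hom_ext (Arr.functor_ext fun m => hf (Arr.map_congr (fctr_congr e) m))

theorem arrInj_subι : ArrInj (subι X hS) := Sub.arr_ι_injective hS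

variable {X}

/-- The lift of a morphism to a subobject. -/
def subLift {Z : Over (MarkedCat.sharp C)} (f : Z ⟶ X) (h : ∀ m, MarkedCat.arrMap f.left m ∈ S) :
    Z ⟶ sub X hS :=
  Over.homMk
    { toFunctor := Sub.lift hS (fctr f) h
      map_marked := fun _ _ g hg => f.left.map_marked g hg }
    (MarkedCat.hom_ext (fctr_comp_proj f))

theorem subLift_ι {Z : Over (MarkedCat.sharp C)} (f : Z ⟶ X)
    (h : ∀ m, MarkedCat.arrMap f.left m ∈ S) : subLift hS f h ≫ subι X hS = f :=
  over_hom_ext rfl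

/-- The inclusion between subobjects. -/
def subMap {S' : Set (Arr X.left)} (hS' : ArrClosed S') (h : S ⊆ S') : sub X hS ⟶ sub X hS' :=
  subLift hS' (subι X hS) fun m => h (Sub.arr_ι_mem hS m)

theorem subMap_ι {S' : Set (Arr X.left)} (hS' : ArrClosed S') (h : S ⊆ S') :
    subMap hS hS' h ≫ subι X hS' = subι X hS :=
  subLift_ι _ _ _

end SubOver

/-- A cocone of monomorphisms which is jointly surjective on arrows is a filtered colimit. -/
theorem nonempty_isColimit {J : Type u} [SmallCategory J] [IsFiltered J]
    {F : J ⥤ Over (MarkedCat.sharp C)} (c : Cocone F) (h₁ : ∀ j, ArrInj (c.ι.app j))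
    (h₂ : ∀ j, Reflects (c.ι.app j))
    (h₃ : ∀ m : Arr c.pt.left, ∃ j n, MarkedCat.arrMap (c.ι.app j).left n = m) :
    Nonempty (IsColimit c) := by
  have h : MarkedCat.IsArrColimit ((Over.forget _).mapCocone c) :=
    { arr :=
        { surj := h₃
          inj := fun j m n e => ⟨j, 𝟙 j, congrArg _ (h₁ j e)⟩ }
      marked := fun m hm => by
        obtain ⟨j, n, rfl⟩ := h₃ m
        exact ⟨j, n, h₂ j n hm, rfl⟩ }
  exact ⟨isColimitOfReflects (Over.forget _) h.isColimit⟩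

/-- The value of `T⁺` at `c`. -/
noncomputable abbrev evalT (c : C) : Over (MarkedCat.sharp C) ⥤ Cat.{u, u} :=
  TPlus C ⋙ (evaluation _ _).obj (op c)

instance (c : C) : PreservesColimits (evalT c) := by
  have : PreservesColimits (TPlus C) := (adjunction C).leftAdjoint_preservesColimits
  infer_instance

theorem isArrColimit_evalT {J : Type u} [SmallCategory J] [IsFiltered J]
    {F : J ⥤ Over (MarkedCat.sharp C)} {c : Cocone F} (h : IsColimit c) (x : C) :
    IsArrColimit ((evalT x).mapCocone c) :=
  .of_isColimit (isColimitOfPreserves _ h)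

open Limits

/-! ### Equivalences and filtered colimits -/

section FilteredEquivalence

variable {J : Type u} [SmallCategory J]

theorem objι_w {F : J ⥤ Cat.{u, u}} (c : Cocone F) {j k : J} (h : j ⟶ k) (a : F.obj j) :
    objι c k ((F.map h).toFunctor.obj a) = objι c j a :=
  congrArg Arr.src ((congrArg (arrι c k) (arrMap_mk_id _ _).symm).trans (arrι_w c h (.id a)))

theorem obj_map_comp (F : J ⥤ Cat.{u, u}) {j k l : J} (h : j ⟶ k) (h' : k ⟶ l) (a : F.obj j) :
    (F.map (h ≫ h')).toFunctor.obj a = (F.map h').toFunctor.obj ((F.map h).toFunctor.obj a) := by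
  rw [F.map_comp]
  rfl

theorem eq_obj_mono {F : J ⥤ Cat.{u, u}} {i : J} {x y : F.obj i} {j k : J} (h : i ⟶ j) (h' : j ⟶ k)
    (e : (F.map h).toFunctor.obj x = (F.map h).toFunctor.obj y) :
    (F.map (h ≫ h')).toFunctor.obj x = (F.map (h ≫ h')).toFunctor.obj y := by
  rw [obj_map_comp, obj_map_comp, e]

theorem eq_arr_mono {F : J ⥤ Cat.{u, u}} {i : J} {x y : Arr (F.obj i)} {j k : J} (h : i ⟶ j)
    (h' : j ⟶ k)
    (e : arrMap (F.map h) x = arrMap (F.map h) y) :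
    arrMap (F.map (h ≫ h')) x = arrMap (F.map (h ≫ h')) y := by
  rw [arrMap_map_comp, arrMap_map_comp, e]

theorem comp_arr_mono {F : J ⥤ Cat.{u, u}} {i : J} {x y z : Arr (F.obj i)} {j k : J} (h : i ⟶ j)
    (h' : j ⟶ k)
    (e : Arr.Comp (arrMap (F.map h) x) (arrMap (F.map h) y) (arrMap (F.map h) z)) :
    Arr.Comp (arrMap (F.map (h ≫ h')) x) (arrMap (F.map (h ≫ h')) y)
      (arrMap (F.map (h ≫ h')) z) := by
  rw [arrMap_map_comp, arrMap_map_comp, arrMap_map_comp]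
  exact e.arrMap _

variable {F G : J ⥤ Cat.{u, u}} (φ : F ⟶ G)

theorem arr_naturality {i j : J} (h : i ⟶ j) (m : Arr (F.obj i)) :
    arrMap (φ.app j) (arrMap (F.map h) m) = arrMap (G.map h) (arrMap (φ.app i) m) := by
  rw [← arrMap_comp, φ.naturality, arrMap_comp]

theorem obj_naturality {i j : J} (h : i ⟶ j) (a : F.obj i) :
    (φ.app j).toFunctor.obj ((F.map h).toFunctor.obj a) =
      (G.map h).toFunctor.obj ((φ.app i).toFunctor.obj a) :=
  Functor.congr_obj (congrArg Cat.Hom.toFunctor (φ.naturality h)) a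

/-- The data of the conditions for `φ` to be an equivalence at stage `i`. -/
abbrev Prob (i : J) : Type u :=
  G.obj i ⊕ (F.obj i × F.obj i × Arr (G.obj i)) ⊕ (Arr (F.obj i) × Arr (F.obj i))

/-- A condition at stage `i` holds at stage `j`. -/
def Solved {i j : J} (h : i ⟶ j) : Prob (F := F) (G := G) i → Prop
  | Sum.inl b => ∃ (a : F.obj j) (m n : Arr (G.obj j)), m.src = (φ.app j).toFunctor.obj a ∧
      m.tgt = (G.map h).toFunctor.obj b ∧ Arr.Comp m n (.id m.src) ∧ Arr.Comp n m (.id m.tgt)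
  -- Matching endpoints are a hypothesis here rather than part of the data, so that `Prob` stays a
  -- plain sum of products whose cardinality is easy to bound.
  | Sum.inr (Sum.inl (a, a', m)) => (φ.app i).toFunctor.obj a = m.src →
      (φ.app i).toFunctor.obj a' = m.tgt → ∃ n : Arr (F.obj j),
        n.src = (F.map h).toFunctor.obj a ∧ n.tgt = (F.map h).toFunctor.obj a' ∧
          arrMap (φ.app j) n = arrMap (G.map h) m
  | Sum.inr (Sum.inr (m, n)) => m.src = n.src → m.tgt = n.tgt →
      arrMap (φ.app i) m = arrMap (φ.app i) n → arrMap (F.map h) m = arrMap (F.map h) n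

variable {φ}

theorem Solved.trans {i j k : J} {h : i ⟶ j} {p : Prob (F := F) (G := G) i} (hp : Solved φ h p)
    (h' : j ⟶ k) : Solved φ (h ≫ h') p := by
  obtain b | ⟨a, a', m⟩ | ⟨m, n⟩ := p
  · obtain ⟨a, m, n, h₁, h₂, h₃, h₄⟩ := hp
    refine ⟨(F.map h').toFunctor.obj a, arrMap (G.map h') m, arrMap (G.map h') n, ?_, ?_, ?_, ?_⟩
    · rw [obj_naturality, ← h₁]
      rfl
    · rw [obj_map_comp, ← h₂]
      rfl
    · have := h₃.arrMap (G.map h')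
      rwa [arrMap_mk_id] at this
    · have := h₄.arrMap (G.map h')
      rwa [arrMap_mk_id] at this
  · intro e₁ e₂
    obtain ⟨n, h₁, h₂, h₃⟩ := hp e₁ e₂
    refine ⟨arrMap (F.map h') n, ?_, ?_, ?_⟩
    · rw [obj_map_comp, ← h₁]
      rfl
    · rw [obj_map_comp, ← h₂]
      rfl
    · rw [arr_naturality, h₃, arrMap_map_comp]
  · intro e₁ e₂ e₃
    rw [arrMap_map_comp, arrMap_map_comp, hp e₁ e₂ e₃]

variable {d : Cocone F} {e : Cocone G} (hd : IsArrColimit d) (he : IsArrColimit e) {Φ : d.pt ⟶ e.pt}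
  (hΦ : ∀ j, d.ι.app j ≫ Φ = φ.app j ≫ e.ι.app j)

include hΦ in
theorem arrMap_arrι (j : J) (m : Arr (F.obj j)) :
    arrMap Φ (arrι d j m) = arrι e j (arrMap (φ.app j) m) :=
  congrArg (fun f : F.obj j ⟶ e.pt => arrMap f m) (hΦ j)

include hΦ in
theorem obj_objι (j : J) (a : F.obj j) :
    Φ.toFunctor.obj (objι d j a) = objι e j ((φ.app j).toFunctor.obj a) :=
  congrArg (fun f : F.obj j ⟶ e.pt => f.toFunctor.obj a) (hΦ j)

variable [IsFiltered J]

theorem exists_and_stage {i : J} {P Q : ∀ j, (i ⟶ j) → Prop}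
    (hP : ∀ {j k} (h : i ⟶ j) (h' : j ⟶ k), P j h → P k (h ≫ h'))
    (hQ : ∀ {j k} (h : i ⟶ j) (h' : j ⟶ k), Q j h → Q k (h ≫ h'))
    (h₁ : ∃ j h, P j h) (h₂ : ∃ j h, Q j h) : ∃ j h, P j h ∧ Q j h := by
  obtain ⟨j, h, p⟩ := h₁
  obtain ⟨k, h', q⟩ := h₂
  obtain ⟨l, f, g, e⟩ := IsFiltered.span h h'
  exact ⟨l, h ≫ f, hP h f p, e ▸ hQ h' g q⟩

theorem IsArrColimit.surj_above {F : J ⥤ Cat.{u, u}} {c : Cocone F} (hc : IsArrColimit c) (i : J)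
    (m : Arr c.pt) : ∃ (j : J) (_ : i ⟶ j) (n : Arr (F.obj j)), arrι c j n = m := by
  obtain ⟨j, n, rfl⟩ := hc.surj m
  exact ⟨_, IsFiltered.leftToMax i j, arrMap (F.map (IsFiltered.rightToMax i j)) n, arrι_w _ _ _⟩

theorem IsArrColimit.obj_surj_above {F : J ⥤ Cat.{u, u}} {c : Cocone F} (hc : IsArrColimit c)
    (i : J)
    (x : c.pt) : ∃ (j : J) (_ : i ⟶ j) (a : F.obj j), objι c j a = x := by
  obtain ⟨j, h, n, e⟩ := hc.surj_above i (.id x)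
  exact ⟨j, h, n.src, congrArg Arr.src e⟩

-- Each single condition involves finitely many arrows and finitely many equations. A solution in
-- the colimit therefore exists at some stage, and the equations hold at a later one.
include hd he hΦ in
theorem exists_solved (h : Φ.toFunctor.IsEquivalence) {i : J} (p : Prob (F := F) (G := G) i) :
    ∃ (j : J) (h : i ⟶ j), Solved φ h p := by
  obtain b | ⟨a, a', m⟩ | ⟨m, n⟩ := p
  · let θ := Φ.toFunctor.objObjPreimageIso (objι e i b)
    obtain ⟨j, h₁, a, ha⟩ := hd.obj_surj_above i (Φ.toFunctor.objPreimage (objι e i b))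
    obtain ⟨k, h₂, m, hm⟩ := he.surj_above j ⟨θ.hom⟩
    obtain ⟨l, h₃, n, hn⟩ := he.surj_above k ⟨θ.inv⟩
    let m' := arrMap (G.map h₃) m
    have hm' : arrι e l m' = ⟨θ.hom⟩ := (arrι_w _ _ _).trans hm
    let a' := (F.map (h₂ ≫ h₃)).toFunctor.obj a
    let b' := (G.map (h₁ ≫ h₂ ≫ h₃)).toFunctor.obj b
    have e₁ : objι e l m'.src = objι e l ((φ.app l).toFunctor.obj a') := by
      rw [← obj_objι hΦ, objι_w, ha]
      exact congrArg Arr.src hm'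
    have e₂ : objι e l m'.tgt = objι e l b' := by
      rw [objι_w]
      exact congrArg Arr.tgt hm'
    have e₃ : Arr.Comp (arrι e l m') (arrι e l n) (arrι e l (.id m'.src)) := by
      rw [arrι_mk_id, show objι e l m'.src = _ from congrArg Arr.src hm', hm', hn]
      exact (Arr.Comp.iff_of_hom _ _ _).2 (congrArg Arr.mk θ.hom_inv_id.symm)
    have e₄ : Arr.Comp (arrι e l n) (arrι e l m') (arrι e l (.id m'.tgt)) := by
      rw [arrι_mk_id, show objι e l m'.tgt = _ from congrArg Arr.tgt hm', hm', hn]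
      exact (Arr.Comp.iff_of_hom _ _ _).2 (congrArg Arr.mk θ.inv_hom_id.symm)
    -- Four requirements must hold at one stage: the two endpoints of `m'` and the two identities
    -- saying that `n` is inverse to it.
    obtain ⟨o, g, ⟨g₁, g₂⟩, g₃, g₄⟩ := exists_and_stage
      (fun h h' p => ⟨eq_obj_mono h h' p.1, eq_obj_mono h h' p.2⟩)
      (fun h h' p => ⟨comp_arr_mono h h' p.1, comp_arr_mono h h' p.2⟩)
      (exists_and_stage eq_obj_mono eq_obj_mono (he.obj_stage e₁) (he.obj_stage e₂))
      (exists_and_stage comp_arr_mono comp_arr_mono (he.comp_stage e₃) (he.comp_stage e₄))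
    refine ⟨o, (h₁ ≫ h₂ ≫ h₃) ≫ g, (F.map g).toFunctor.obj a', arrMap (G.map g) m',
      arrMap (G.map g) n, ?_, ?_, ?_, ?_⟩
    · rw [obj_naturality]
      exact g₁
    · rw [obj_map_comp]
      exact g₂
    · rwa [arrMap_mk_id] at g₃
    · rwa [arrMap_mk_id] at g₄
  · suffices (φ.app i).toFunctor.obj a = m.src → (φ.app i).toFunctor.obj a' = m.tgt →
        ∃ (j : J) (h : i ⟶ j), Solved φ h (Sum.inr (Sum.inl (a, a', m))) by
      by_cases e₁ : (φ.app i).toFunctor.obj a = m.src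
      · by_cases e₂ : (φ.app i).toFunctor.obj a' = m.tgt
        · exact this e₁ e₂
        · exact ⟨i, 𝟙 i, fun _ h => (e₂ h).elim⟩
      · exact ⟨i, 𝟙 i, fun h => (e₁ h).elim⟩
    intro e₁ e₂
    obtain ⟨N, hN₁, hN₂, hN₃⟩ := full_iff_arr.1 h.full (objι d i a) (objι d i a') (arrι e i m)
      ((obj_objι hΦ i a).trans (congrArg (objι e i) e₁))
      ((obj_objι hΦ i a').trans (congrArg (objι e i) e₂))
    obtain ⟨k, h₁, n, rfl⟩ := hd.surj_above i N
    have e₃ : objι d k n.src = objι d k ((F.map h₁).toFunctor.obj a) := by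
      rw [objι_w]
      exact hN₁
    have e₄ : objι d k n.tgt = objι d k ((F.map h₁).toFunctor.obj a') := by
      rw [objι_w]
      exact hN₂
    have e₅ : arrι e k (arrMap (φ.app k) n) = arrι e k (arrMap (G.map h₁) m) := by
      rw [arrι_w, ← arrMap_arrι hΦ]
      exact hN₃
    obtain ⟨l, g, ⟨g₁, g₂⟩, g₃⟩ := exists_and_stage (i := k)
      (fun h h' p => ⟨eq_obj_mono h h' p.1, eq_obj_mono h h' p.2⟩) eq_arr_mono
      (exists_and_stage eq_obj_mono eq_obj_mono (hd.obj_stage e₃) (hd.obj_stage e₄))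
      (he.inj _ _ _ e₅)
    refine ⟨l, h₁ ≫ g, fun _ _ => ⟨arrMap (F.map g) n, ?_, ?_, ?_⟩⟩
    · rw [obj_map_comp]
      exact g₁
    · rw [obj_map_comp]
      exact g₂
    · rw [arr_naturality, g₃, arrMap_map_comp]
  · by_cases hmn : m.src = n.src ∧ m.tgt = n.tgt ∧ arrMap (φ.app i) m = arrMap (φ.app i) n
    · obtain ⟨e₁, e₂, e₃⟩ := hmn
      obtain ⟨j, h, e⟩ := hd.inj i m n (faithful_iff_arr.1 h.faithful _ _
        (congrArg (objι d i) e₁) (congrArg (objι d i) e₂)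
        ((arrMap_arrι hΦ i m).trans ((congrArg (arrι e i) e₃).trans (arrMap_arrι hΦ i n).symm)))
      exact ⟨j, h, fun _ _ _ => e⟩
    · exact ⟨i, 𝟙 i, fun e₁ e₂ e₃ => (hmn ⟨e₁, e₂, e₃⟩).elim⟩

-- Any arrow or object of a colimit comes from a stage, where it poses one of the conditions. It is
-- here that the stage `j` has to work for all problems of stage `i`, or at least for the one met.
include hd he hΦ in
theorem isEquivalence_of_solved
    (h : ∀ i, ∃ (j : J) (h : i ⟶ j), ∀ p, Solved φ h p) : Φ.toFunctor.IsEquivalence where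
  faithful := by
    refine faithful_iff_arr.2 fun m n h₁ h₂ h₃ => ?_
    obtain ⟨i, m, rfl⟩ := hd.surj m
    obtain ⟨j, g, n, rfl⟩ := hd.surj_above i n
    rw [← arrι_w d g m] at h₁ h₂ h₃ ⊢
    generalize arrMap (F.map g) m = m at h₁ h₂ h₃
    have h₃' : arrι e j (arrMap (φ.app j) m) = arrι e j (arrMap (φ.app j) n) := by
      rw [← arrMap_arrι hΦ, ← arrMap_arrι hΦ]
      exact h₃
    obtain ⟨k, g, ⟨g₁, g₂⟩, g₃⟩ := exists_and_stage (i := j)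
      (fun h h' p => ⟨eq_obj_mono h h' p.1, eq_obj_mono h h' p.2⟩) eq_arr_mono
      (exists_and_stage eq_obj_mono eq_obj_mono (hd.obj_stage (a := m.src) (b := n.src) h₁)
        (hd.obj_stage (a := m.tgt) (b := n.tgt) h₂)) (he.inj _ _ _ h₃')
    rw [← arr_naturality, ← arr_naturality] at g₃
    obtain ⟨l, g', hl⟩ := h k
    have := hl (Sum.inr (Sum.inr (arrMap (F.map g) m, arrMap (F.map g) n))) g₁ g₂ g₃
    rw [← arrι_w d g m, ← arrι_w d g n, ← arrι_w d g', ← arrι_w d g', this]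
  full := by
    refine full_iff_arr.2 fun x x' m h₁ h₂ => ?_
    obtain ⟨i, m, rfl⟩ := he.surj m
    obtain ⟨j, g, a, rfl⟩ := hd.obj_surj_above i x
    obtain ⟨k, g', a', rfl⟩ := hd.obj_surj_above j x'
    rw [← arrι_w e (g ≫ g') m] at h₁ h₂ ⊢
    rw [← objι_w d g' a] at h₁ ⊢
    generalize arrMap (G.map (g ≫ g')) m = m at h₁ h₂
    generalize (F.map g').toFunctor.obj a = a at h₁
    have h₁' : objι e k ((φ.app k).toFunctor.obj a) = objι e k m.src := by
      rw [← obj_objι hΦ]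
      exact h₁
    have h₂' : objι e k ((φ.app k).toFunctor.obj a') = objι e k m.tgt := by
      rw [← obj_objι hΦ]
      exact h₂
    obtain ⟨l, f, f₁, f₂⟩ := exists_and_stage eq_obj_mono eq_obj_mono (he.obj_stage h₁')
      (he.obj_stage h₂')
    rw [← obj_naturality] at f₁ f₂
    obtain ⟨o, f', ho⟩ := h l
    obtain ⟨n, n₁, n₂, n₃⟩ := ho (Sum.inr (Sum.inl ((F.map f).toFunctor.obj a,
      (F.map f).toFunctor.obj a', arrMap (G.map f) m))) f₁ f₂
    refine ⟨arrι d o n, ?_, ?_, ?_⟩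
    · refine (congrArg (objι d o) n₁).trans ?_
      rw [objι_w, objι_w]
    · refine (congrArg (objι d o) n₂).trans ?_
      rw [objι_w, objι_w]
    · refine (arrMap_arrι hΦ o n).trans ?_
      rw [n₃, arrι_w, arrι_w]
  essSurj := ⟨fun y => by
    obtain ⟨i, m, hm⟩ := he.surj (.id y)
    obtain ⟨j, g, hj⟩ := h i
    obtain ⟨a, n, n', h₁, h₂, h₃, h₄⟩ := hj (Sum.inl m.src)
    have hn : IsIso n.hom := h₃.isIso h₄ (inferInstanceAs (IsIso (𝟙 _)))
      (inferInstanceAs (IsIso (𝟙 _)))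
    have hn' : IsIso (arrι e j n).hom := isIso_arr_map _ hn
    have e₁ : (arrι e j n).src = Φ.toFunctor.obj (objι d j a) :=
      (congrArg (objι e j) h₁).trans (obj_objι hΦ j a).symm
    have e₂ : (arrι e j n).tgt = y := by
      refine (congrArg (objι e j) h₂).trans ?_
      rw [objι_w]
      exact congrArg Arr.src hm
    exact ⟨objι d j a, ⟨eqToIso e₁.symm ≪≫ @asIso _ _ _ _ _ hn' ≪≫ eqToIso e₂⟩⟩⟩

end FilteredEquivalence

open Cardinal

/-! ### Cardinality bounds -/

section Cardinality

variable {κ : Cardinal.{u}}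

theorem card_iUnion_le (hκ : ℵ₀ ≤ κ) {ι Z : Type u} (hι : #ι ≤ κ) {f : ι → Set Z} (hf :
    ∀ i, #(f i) ≤ κ) :
    #(⋃ i, f i) ≤ κ :=
  (mk_iUnion_le f).trans (mul_le_of_le hκ hι (ciSup_le' hf))

theorem card_union_le (hκ : ℵ₀ ≤ κ) {Z : Type u} {S T : Set Z} (hS : #S ≤ κ) (hT : #T ≤ κ) :
    #(S ∪ T : Set Z) ≤ κ :=
  (mk_union_le S T).trans (add_le_of_le hκ hS hT)

/-- Every small set is contained in a small set which is closed under a small family of binary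
operations. -/
theorem exists_closed (hκ : ℵ₀ ≤ κ) {ι Z : Type u} (hι : #ι ≤ κ) (op : ι → Z → Z → Z) {S : Set Z}
    (hS : #S ≤ κ) : ∃ T : Set Z, S ⊆ T ∧ #T ≤ κ ∧ ∀ i, ∀ x ∈ T, ∀ y ∈ T, op i x y ∈ T := by
  -- Countably many rounds suffice, since any two elements of the union lie in a common round, and
  -- each round adds at most `κ` elements.
  let F : ℕ → Set Z := fun n => Nat.rec (motive := fun _ => Set Z) S
    (fun _ R => R ∪ ⋃ i, Set.image2 (op i) R R) n
  have hF : Monotone F := monotone_nat_of_le_succ fun n => Set.subset_union_left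
  have hF' : ∀ n, #(F n : Set Z) ≤ κ := fun n => by
    induction n with
    | zero => exact hS
    | succ n ih =>
      exact card_union_le hκ ih
        (card_iUnion_le hκ hι fun i => mk_image2_le.trans (mul_le_of_le hκ ih ih))
  refine ⟨⋃ n : ULift.{u} ℕ, F n.down, fun x hx => Set.mem_iUnion.2 ⟨⟨0⟩, hx⟩,
    card_iUnion_le hκ (by simpa using hκ) fun n => hF' _, fun i x hx y hy => ?_⟩
  obtain ⟨⟨m⟩, hm⟩ := Set.mem_iUnion.1 hx
  obtain ⟨⟨n⟩, hn⟩ := Set.mem_iUnion.1 hy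
  exact Set.mem_iUnion.2 ⟨⟨max m n + 1⟩, Or.inr (Set.mem_iUnion.2 ⟨i, x, hF (le_max_left m n) hm, y,
    hF (le_max_right m n) hn, rfl⟩)⟩

/-! ### Cardinality of localizations -/

section Localization

variable {A : Type u} [Category.{u} A]

open Classical in
/-- The composite of two arrows, if they are composable. -/
noncomputable def compArr (m n : Arr A) : Arr A :=
  if h : m.tgt = n.src then (Arr.Comp.exists h).choose else m

theorem comp_compArr {m n : Arr A} (h : m.tgt = n.src) : Arr.Comp m n (compArr m n) := by
  rw [compArr, dif_pos h]
  exact (Arr.Comp.exists h).choose_spec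

theorem Arr.Comp.eq_compArr {m n p : Arr A} (h : Arr.Comp m n p) : p = compArr m n :=
  h.unique (comp_compArr h.tgt_eq)

theorem Arr.Comp.exists_right {x y z : A} {f : x ⟶ y} {g : y ⟶ z} {m p : Arr A} (h :
    Arr.Comp m ⟨f ≫ g⟩ p) :
    ∃ q, Arr.Comp m ⟨f⟩ q ∧ Arr.Comp q ⟨g⟩ p := by
  obtain ⟨k⟩ := m
  obtain rfl : _ = x := h.tgt_eq
  refine ⟨_, .mk k f, ?_⟩
  rw [Arr.Comp.iff_of_hom] at h ⊢
  rw [h, Category.assoc]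

variable {W : MorphismProperty A}

/-- The generating arrows of a localization. -/
noncomputable def letter : Arr A ⊕ { m : Arr A // W m.hom } → Arr W.Localization
  | Sum.inl m => Arr.map W.Q m
  | Sum.inr m => ⟨Localization.Construction.wInv m.1.hom m.2⟩

variable (W) in
/-- The composite of a word of generating arrows. -/
noncomputable def evalWord (w : A × List (Arr A ⊕ { m : Arr A // W m.hom })) : Arr W.Localization :=
  w.2.foldl (fun m x => compArr m (letter x)) (.id (W.Q.obj w.1))

/-- The morphisms whose right composition preserves values of words form a class closed under
composition. It contains the images of `W.Q` and the formal inverses, since these append one letter,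
and hence contains every morphism. -/
theorem mem_range_evalWord {m n p : Arr W.Localization} (h : Arr.Comp m n p)
    (hm : m ∈ Set.range (evalWord W)) : p ∈ Set.range (evalWord W) := by
  let P : MorphismProperty W.Localization := fun _ _ f => ∀ m p, Arr.Comp m ⟨f⟩ p →
    m ∈ Set.range (evalWord W) → p ∈ Set.range (evalWord W)
  have hP : P.IsStableUnderComposition := ⟨fun f g hf hg m p h hm => by
    obtain ⟨q, h₁, h₂⟩ := h.exists_right
    exact hg _ _ h₂ (hf _ _ h₁ hm)⟩
  have key (x) : P (letter (W := W) x).hom := by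
    rintro _ p h ⟨⟨a, l⟩, rfl⟩
    refine ⟨(a, l ++ [x]), ?_⟩
    rw [h.eq_compArr]
    exact List.foldl_append
  have := Localization.Construction.morphismProperty_eq_top P (fun _ _ f => key (Sum.inl ⟨f⟩))
    (fun _ _ f hf => key (Sum.inr ⟨⟨f⟩, hf⟩))
  have h' : P n.hom := this ▸ trivial
  exact h' _ _ h hm

theorem surjective_evalWord : Function.Surjective (evalWord W) := by
  intro m
  refine mem_range_evalWord ((Arr.Comp.iff_of_hom _ _ _).2 (congrArg Arr.mk (Category.id_comp m.hom).symm))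
    ⟨(m.src.as.obj, []), rfl⟩

theorem card_le_card_arr (A : Type u) [Category.{u} A] : #A ≤ #(Arr A) :=
  mk_le_of_injective (f := Arr.id) fun _ _ => Arr.id_inj.1

/-- Every arrow is the value of a finite word in at most `κ` letters, preceded by a starting object.
-/
theorem card_arr_localization (hκ : ℵ₀ ≤ κ) (h : #(Arr A) ≤ κ) : #(Arr W.Localization) ≤ κ := by
  refine (mk_le_of_surjective surjective_evalWord).trans ?_
  rw [mk_prod, lift_id, lift_id]
  refine mul_le_of_le hκ ((card_le_card_arr A).trans h) ((mk_list_le_max _).trans (max_le hκ ?_))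
  rw [mk_sum, lift_id, lift_id]
  exact add_le_of_le hκ h ((mk_subtype_le _).trans h)

end Localization

variable {C : Type u} [Category.{u} C]

theorem card_evalT (hκ : ℵ₀ ≤ κ) (hC : #(Arr C) ≤ κ) {P : Over (MarkedCat.sharp C)} (hP :
    #(Arr P.left) ≤ κ) (c : C) :
    #(Arr ((evalT c).obj P)) ≤ κ := by
  refine card_arr_localization (A := StructuredArrow c (proj P)) hκ ?_
  refine (mk_le_of_injective (f := fun m : Arr (StructuredArrow c (proj P)) =>
    ((⟨m.hom.right⟩, ⟨m.src.hom⟩) : Arr P.left × Arr C)) ?_).trans ?_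
  · intro m n h
    exact comma_arr_ext (congrArg Prod.fst h) (congrArg Prod.snd h)
  · rw [mk_prod, lift_id, lift_id]
    exact mul_le_of_le hκ hP hC

end Cardinality

/-! ### Small subobjects of a morphism -/

section SmallPairs

variable {C : Type u} [Category.{u} C] {X Y : Over (MarkedCat.sharp C)} (w : X ⟶ Y)

/-- A set of arrows of the source and the target of `w` defining a subobject of `w`. -/
structure PairClosed (S : Set (Arr X.left ⊕ Arr Y.left)) : Prop where
  left : ArrClosed (Sum.inl ⁻¹' S)
  right : ArrClosed (Sum.inr ⁻¹' S)
  map : ∀ ⦃m⦄, Sum.inl m ∈ S → Sum.inr (MarkedCat.arrMap w.left m) ∈ S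

/-- The operations defining `PairClosed`. -/
noncomputable def pairOp : ULift.{u} (Fin 4) → Arr X.left ⊕ Arr Y.left → Arr X.left ⊕ Arr Y.left →
    Arr X.left ⊕ Arr Y.left
  | ⟨0⟩, Sum.inl m, _ => Sum.inl (.id m.src)
  | ⟨0⟩, Sum.inr m, _ => Sum.inr (.id m.src)
  | ⟨1⟩, Sum.inl m, _ => Sum.inl (.id m.tgt)
  | ⟨1⟩, Sum.inr m, _ => Sum.inr (.id m.tgt)
  | ⟨2⟩, Sum.inl m, Sum.inl n => Sum.inl (compArr m n)
  | ⟨2⟩, Sum.inr m, Sum.inr n => Sum.inr (compArr m n)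
  | ⟨2⟩, Sum.inl m, Sum.inr _ => Sum.inl m
  | ⟨2⟩, Sum.inr m, Sum.inl _ => Sum.inr m
  | ⟨3⟩, Sum.inl m, _ => Sum.inr (MarkedCat.arrMap w.left m)
  | ⟨3⟩, Sum.inr m, _ => Sum.inr m

variable {κ : Cardinal.{u}}

theorem exists_pairClosed (hκ : ℵ₀ ≤ κ) {S : Set (Arr X.left ⊕ Arr Y.left)} (hS : #S ≤ κ) :
    ∃ T, S ⊆ T ∧ PairClosed w T ∧ #T ≤ κ := by
  obtain ⟨T, hST, hT, h⟩ := exists_closed hκ (by simpa using (natCast_lt_aleph0 (n := 4)).le.trans hκ) (pairOp w) hS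
  refine ⟨T, hST, ?_, hT⟩
  exact
    { left :=
        { src := fun m hm => h ⟨0⟩ _ hm _ hm
          tgt := fun m hm => h ⟨1⟩ _ hm _ hm
          comp := fun m n p e hm hn => e.eq_compArr ▸ h ⟨2⟩ _ hm _ hn }
      right :=
        { src := fun m hm => h ⟨0⟩ _ hm _ hm
          tgt := fun m hm => h ⟨1⟩ _ hm _ hm
          comp := fun m n p e hm hn => e.eq_compArr ▸ h ⟨2⟩ _ hm _ hn }
      map := fun m hm => h ⟨3⟩ _ hm _ hm }

variable (κ) in
/-- The subobjects of `w` of cardinality at most `κ`. -/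
structure Small : Type u where
  val : Set (Arr X.left ⊕ Arr Y.left)
  closed : PairClosed w val
  card : #val ≤ κ

instance : Preorder (Small w κ) := .lift Small.val

variable {w}

theorem Small.exists_above (hκ : ℵ₀ ≤ κ) {S : Set (Arr X.left ⊕ Arr Y.left)} (hS : #S ≤ κ) :
    ∃ T : Small w κ, S ⊆ T.val :=
  let ⟨T, h, h', h''⟩ := exists_pairClosed w hκ hS
  ⟨⟨T, h', h''⟩, h⟩

theorem Small.exists_upper_bound (hκ : ℵ₀ ≤ κ) {ι : Type u} (hι : #ι ≤ κ) (S : ι → Small w κ) :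
    ∃ T, ∀ i, S i ≤ T :=
  let ⟨T, h⟩ := Small.exists_above hκ (card_iUnion_le hκ hι fun i => (S i).card)
  ⟨T, fun i => (Set.subset_iUnion (fun i => (S i).val) i).trans h⟩

theorem Small.isDirected (hκ : ℵ₀ ≤ κ) : IsDirectedOrder (Small w κ) :=
  ⟨fun S T =>
    let ⟨R, h⟩ := Small.exists_above hκ (card_union_le hκ S.card T.card)
    ⟨R, Set.subset_union_left.trans h, Set.subset_union_right.trans h⟩⟩

/-- The source of a subobject of `w`. -/
abbrev Small.src (S : Small w κ) : Over (MarkedCat.sharp C) := sub X S.closed.left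

/-- The target of a subobject of `w`. -/
abbrev Small.tgt (S : Small w κ) : Over (MarkedCat.sharp C) := sub Y S.closed.right

/-- The subobject of `w` as a morphism. -/
def Small.hom (S : Small w κ) : S.src ⟶ S.tgt :=
  subLift _ (subι X S.closed.left ≫ w) fun m => S.closed.map (Sub.arr_ι_mem S.closed.left m)

theorem Small.hom_ι (S : Small w κ) : S.hom ≫ subι Y S.closed.right = subι X S.closed.left ≫ w :=
  subLift_ι _ _ _

theorem card_arr_sub {X : Over (MarkedCat.sharp C)} {S : Set (Arr X.left)} (hS : ArrClosed S)
    (h : #S ≤ κ) :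
    #(Arr (sub X hS).left) ≤ κ :=
  (mk_le_of_injective (f := fun m => (⟨_, Sub.arr_ι_mem hS m⟩ : S))
    fun _ _ h => Sub.arr_ι_injective hS (congrArg Subtype.val h)).trans h

theorem Small.card_src (S : Small w κ) : #(Arr S.src.left) ≤ κ :=
  card_arr_sub _ ((mk_preimage_of_injective _ _ Sum.inl_injective).trans S.card)

theorem Small.card_tgt (S : Small w κ) : #(Arr S.tgt.left) ≤ κ :=
  card_arr_sub _ ((mk_preimage_of_injective _ _ Sum.inr_injective).trans S.card)

variable (w κ)

/-- The sources of the subobjects of `w`. -/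
def srcFunctor : Small w κ ⥤ Over (MarkedCat.sharp C) where
  obj S := S.src
  map {S T} h := subMap S.closed.left T.closed.left (Set.preimage_mono h.le)
  map_id S := (arrInj_subι X S.closed.left).cancel (subMap_ι _ _ _)
  map_comp {_ _ R} _ _ := (arrInj_subι X R.closed.left).cancel rfl

/-- The targets of the subobjects of `w`. -/
def tgtFunctor : Small w κ ⥤ Over (MarkedCat.sharp C) where
  obj S := S.tgt
  map {S T} h := subMap S.closed.right T.closed.right (Set.preimage_mono h.le)
  map_id S := (arrInj_subι Y S.closed.right).cancel (subMap_ι _ _ _)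
  map_comp {_ _ R} _ _ := (arrInj_subι Y R.closed.right).cancel rfl

/-- The subobjects of `w` as a natural transformation. -/
def smallHom : srcFunctor w κ ⟶ tgtFunctor w κ where
  app S := S.hom
  naturality {_ T} _ := (arrInj_subι Y T.closed.right).cancel rfl

/-- The sources of the subobjects of `w` as a cocone. -/
def srcCocone : Limits.Cocone (srcFunctor w κ) where
  pt := X
  ι :=
    { app := fun S => subι X S.closed.left
      naturality := fun _ _ _ => rfl }

/-- The targets of the subobjects of `w` as a cocone. -/
def tgtCocone : Limits.Cocone (tgtFunctor w κ) where
  pt := Y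
  ι :=
    { app := fun S => subι Y S.closed.right
      naturality := fun _ _ _ => rfl }

variable {w κ}

theorem isFiltered_small (hκ : ℵ₀ ≤ κ) : IsFiltered (Small w κ) := by
  have := Small.isDirected (w := w) hκ
  have : Nonempty (Small w κ) := ⟨(Small.exists_above hκ (S := ∅) (by simp)).choose⟩
  infer_instance

theorem reflects_subι {S : Set (Arr X.left)} (hS : ArrClosed S) : Reflects (subι X hS) :=
  fun _ h => h

theorem exists_small_singleton (hκ : ℵ₀ ≤ κ) (z : Arr X.left ⊕ Arr Y.left) : ∃ T :
    Small w κ, z ∈ T.val :=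
  let ⟨T, h⟩ := Small.exists_above hκ (S := {z}) (by simpa using one_le_aleph0.trans hκ)
  ⟨T, h rfl⟩

theorem nonempty_isColimit_srcCocone (hκ : ℵ₀ ≤ κ) : Nonempty (Limits.IsColimit
    (srcCocone w κ)) := by
  have := isFiltered_small (w := w) hκ
  refine nonempty_isColimit _ (fun S => arrInj_subι X S.closed.left)
    (fun S => reflects_subι S.closed.left) fun m => ?_
  obtain ⟨T, hT⟩ := exists_small_singleton (w := w) hκ (.inl m)
  exact ⟨T, Sub.exists_arr T.closed.left hT⟩

theorem nonempty_isColimit_tgtCocone (hκ : ℵ₀ ≤ κ) : Nonempty (Limits.IsColimit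
    (tgtCocone w κ)) := by
  have := isFiltered_small (w := w) hκ
  refine nonempty_isColimit _ (fun S => arrInj_subι Y S.closed.right)
    (fun S => reflects_subι S.closed.right) fun m => ?_
  obtain ⟨T, hT⟩ := exists_small_singleton (w := w) hκ (.inr m)
  exact ⟨T, Sub.exists_arr T.closed.right hT⟩

theorem arrInj_subMap {S S' : Set (Arr X.left)} (hS : ArrClosed S) (hS' : ArrClosed S') (h :
    S ⊆ S') :
    ArrInj (subMap hS hS' h) := fun _ _ e =>
  arrInj_subι X hS (congrArg (MarkedCat.arrMap (subι X hS').left) e)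

theorem exists_arr_subMap {S S' : Set (Arr X.left)} (hS : ArrClosed S) (hS' : ArrClosed S') (h :
    S ⊆ S')
    (m : Arr (sub X hS').left) (hm : MarkedCat.arrMap (subι X hS').left m ∈ S) :
    ∃ n, MarkedCat.arrMap (subMap hS hS' h).left n = m := by
  obtain ⟨n, hn⟩ := Sub.exists_arr hS hm
  exact ⟨n, arrInj_subι X hS' hn⟩

variable {I : Type u} [Preorder I] [IsDirectedOrder I] [Nonempty I] {K : I → Small w κ} (hK :
    Monotone K)
  {T : Small w κ} (hT : T.val = ⋃ i, (K i).val)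

include hT in
omit [Preorder I] [IsDirectedOrder I] [Nonempty I] in
theorem Small.le_of_eq_iUnion (i : I) : K i ≤ T :=
  (Set.subset_iUnion (fun i => (K i).val) i).trans hT.ge

/-- The cocone of a directed union. -/
def unionCocone : Limits.Cocone hK.functor where
  pt := T
  ι := { app := fun i => homOfLE (Small.le_of_eq_iUnion hT i) }

theorem nonempty_isColimit_src : Nonempty (Limits.IsColimit
    ((srcFunctor w κ).mapCocone (unionCocone hK hT))) := by
  refine nonempty_isColimit _ (fun i => arrInj_subMap (K i).closed.left T.closed.left
    (Set.preimage_mono (Small.le_of_eq_iUnion hT i)))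
    (fun i => fun _ h => h) fun m => ?_
  have hm : Sum.inl (MarkedCat.arrMap (subι X T.closed.left).left m) ∈ T.val :=
    Sub.arr_ι_mem T.closed.left m
  obtain ⟨i, hi⟩ := Set.mem_iUnion.1 (hT.le hm)
  exact ⟨i, exists_arr_subMap (K i).closed.left T.closed.left
    (Set.preimage_mono (Small.le_of_eq_iUnion hT i)) m hi⟩

theorem nonempty_isColimit_tgt : Nonempty (Limits.IsColimit
    ((tgtFunctor w κ).mapCocone (unionCocone hK hT))) := by
  refine nonempty_isColimit _ (fun i => arrInj_subMap (K i).closed.right T.closed.right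
    (Set.preimage_mono (Small.le_of_eq_iUnion hT i)))
    (fun i => fun _ h => h) fun m => ?_
  have hm : Sum.inr (MarkedCat.arrMap (subι Y T.closed.right).left m) ∈ T.val :=
    Sub.arr_ι_mem T.closed.right m
  obtain ⟨i, hi⟩ := Set.mem_iUnion.1 (hT.le hm)
  exact ⟨i, exists_arr_subMap (K i).closed.right T.closed.right
    (Set.preimage_mono (Small.le_of_eq_iUnion hT i)) m hi⟩

omit [IsDirectedOrder I] [Nonempty I] in
theorem pairClosed_iUnion [IsDirectedOrder I] {K : I → Small w κ} (hK : Monotone K) : PairClosed w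
    (⋃ i, (K i).val) where
  left :=
    { src := fun m hm => by
        obtain ⟨i, hi⟩ := Set.mem_iUnion.1 hm
        exact Set.mem_iUnion.2 ⟨i, (K i).closed.left.src hi⟩
      tgt := fun m hm => by
        obtain ⟨i, hi⟩ := Set.mem_iUnion.1 hm
        exact Set.mem_iUnion.2 ⟨i, (K i).closed.left.tgt hi⟩
      comp := fun m n p e hm hn => by
        obtain ⟨i, hi⟩ := Set.mem_iUnion.1 hm
        obtain ⟨j, hj⟩ := Set.mem_iUnion.1 hn
        obtain ⟨k, hik, hjk⟩ := exists_ge_ge i j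
        exact Set.mem_iUnion.2 ⟨k, (K k).closed.left.comp e (hK hik hi) (hK hjk hj)⟩ }
  right :=
    { src := fun m hm => by
        obtain ⟨i, hi⟩ := Set.mem_iUnion.1 hm
        exact Set.mem_iUnion.2 ⟨i, (K i).closed.right.src hi⟩
      tgt := fun m hm => by
        obtain ⟨i, hi⟩ := Set.mem_iUnion.1 hm
        exact Set.mem_iUnion.2 ⟨i, (K i).closed.right.tgt hi⟩
      comp := fun m n p e hm hn => by
        obtain ⟨i, hi⟩ := Set.mem_iUnion.1 hm
        obtain ⟨j, hj⟩ := Set.mem_iUnion.1 hn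
        obtain ⟨k, hik, hjk⟩ := exists_ge_ge i j
        exact Set.mem_iUnion.2 ⟨k, (K k).closed.right.comp e (hK hik hi) (hK hjk hj)⟩ }
  map m hm := by
    obtain ⟨i, hi⟩ := Set.mem_iUnion.1 hm
    exact Set.mem_iUnion.2 ⟨i, (K i).closed.map hi⟩

variable (w κ) in
/-- The comparison between the localizations of the subobjects of `w`. -/
noncomputable abbrev smallEval (x : C) : srcFunctor w κ ⋙ evalT x ⟶ tgtFunctor w κ ⋙ evalT x :=
  Functor.whiskerRight (smallHom w κ) (evalT x)

/-- The conditions posed by `S`, over all objects of `C`, number at most `κ`. Each is solved in a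
small subobject above `S`, because `w` is the filtered colimit of its small subobjects and `TPlus`
preserves colimits; a common small upper bound solves them all. -/
theorem exists_solving (hκ : ℵ₀ ≤ κ) (hC : #(Arr C) ≤ κ) (hw : weq C w) (S : Small w κ) :
    ∃ (T : Small w κ) (h : S ≤ T), ∀ x p, Solved (smallEval w κ x) (homOfLE h) p := by
  have := isFiltered_small (w := w) hκ
  obtain ⟨hs⟩ := nonempty_isColimit_srcCocone (w := w) hκ
  obtain ⟨ht⟩ := nonempty_isColimit_tgtCocone (w := w) hκ
  have key (x : C) (p : Prob (F := srcFunctor w κ ⋙ evalT x) (G := tgtFunctor w κ ⋙ evalT x) S) :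
      ∃ (T : Small w κ) (h : S ⟶ T), Solved (smallEval w κ x) h p :=
    exists_solved (isArrColimit_evalT hs x) (isArrColimit_evalT ht x) (Φ := (evalT x).map w)
      (fun T => by
        refine ((evalT x).map_comp _ _).symm.trans (Eq.trans ?_ ((evalT x).map_comp _ _))
        exact congrArg (evalT x).map T.hom_ι.symm) (hw (op x)) p
  choose T h hT using key
  have hcard : #(Σ x : C, Prob (F := srcFunctor w κ ⋙ evalT x) (G := tgtFunctor w κ ⋙ evalT x) S) ≤ κ := by
    have h₁ (x : C) := card_evalT hκ hC S.card_src x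
    have h₂ (x : C) := card_evalT hκ hC S.card_tgt x
    have h₃ (x : C) := (card_le_card_arr _).trans (h₁ x)
    have h₄ (x : C) := (card_le_card_arr _).trans (h₂ x)
    rw [mk_sigma]
    refine (sum_le_mk_mul_iSup _).trans (mul_le_of_le hκ ((card_le_card_arr C).trans hC)
      (ciSup_le' fun x => ?_))
    simp only [mk_sum, mk_prod, lift_id]
    exact add_le_of_le hκ (h₄ x) (add_le_of_le hκ (mul_le_of_le hκ (h₃ x)
      (mul_le_of_le hκ (h₃ x) (h₂ x))) (mul_le_of_le hκ (h₁ x) (h₁ x)))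
  obtain ⟨R, hR⟩ := Small.exists_upper_bound hκ hcard fun q => T q.1 q.2
  obtain ⟨R', hR'⟩ := Small.exists_above hκ (card_union_le hκ S.card R.card)
  refine ⟨R', Set.subset_union_left.trans hR', fun x p => ?_⟩
  exact (hT x p).trans (homOfLE ((hR ⟨x, p⟩).trans (Set.subset_union_right.trans hR')))

/-- Every small subobject of a weak equivalence is contained in a small weak equivalence. -/
theorem exists_small_weq (hκ : ℵ₀ ≤ κ) (hC : #(Arr C) ≤ κ) (hw : weq C w) (S : Small w κ) :
    ∃ T : Small w κ, S ≤ T ∧ weq C T.hom := by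
  choose N hN h using exists_solving hκ hC hw
  -- Each term solves all conditions of the preceding one, so the union of the chain, which is still
  -- small, is a weak equivalence.
  let K : ULift.{u} ℕ → Small w κ := fun n => Nat.rec (motive := fun _ => Small w κ) S (fun _ => N) n.down
  have hK' (n : ℕ) : K ⟨n⟩ ≤ K ⟨n + 1⟩ := hN _
  have hK : Monotone K := fun m n h => monotone_nat_of_le_succ (f := fun n => K ⟨n⟩) hK' h
  let T : Small w κ := ⟨_, pairClosed_iUnion hK, card_iUnion_le hκ (by simpa using hκ) fun n => (K n).card⟩
  have hT : T.val = ⋃ i, (K i).val := rfl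
  refine ⟨T, Small.le_of_eq_iUnion hT ⟨0⟩, fun x => ?_⟩
  obtain ⟨hs⟩ := nonempty_isColimit_src hK hT
  obtain ⟨ht⟩ := nonempty_isColimit_tgt hK hT
  refine isEquivalence_of_solved (isArrColimit_evalT hs x.unop) (isArrColimit_evalT ht x.unop)
    (φ := Functor.whiskerRight (Functor.whiskerLeft hK.functor (smallHom w κ)) (evalT x.unop))
    (Φ := (evalT x.unop).map T.hom) (fun n => ?_) fun n => ?_
  · refine ((evalT x.unop).map_comp _ _).symm.trans (Eq.trans ?_ ((evalT x.unop).map_comp _ _))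
    exact congrArg (evalT x.unop).map
      ((smallHom w κ).naturality (homOfLE (Small.le_of_eq_iUnion hT n)))
  · have hs := h (K n) x.unop
    refine ⟨⟨n.down + 1⟩, homOfLE (Nat.le_succ n.down), fun p => ?_⟩
    -- `Solved` computes only on constructors; after the case split the conditions for the chain are
    -- literally those for the whole system of subobjects.
    obtain p | p | p := p
    exacts [hs (Sum.inl p), hs (Sum.inr (Sum.inl p)), hs (Sum.inr (Sum.inr p))]

end SmallPairs

open Cardinal

/-! ### A set of generating trivial cofibrations -/

section Representatives

variable {C : Type u} [Category.{u} C]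

/-- Seen as a cocone on a one-point diagram, `f` satisfies the criterion for filtered colimits of
subobjects, and the leg of a colimit at a terminal index is an isomorphism. -/
theorem isIso_of_bijective {P Q : Over (MarkedCat.sharp C)} (f : P ⟶ Q)
    (h : Function.Bijective (MarkedCat.arrMap f.left)) (h' : Reflects f) : IsIso f := by
  let c : Limits.Cocone ((Functor.const PUnit.{u + 1}).obj P) :=
    { pt := Q
      ι := { app := fun _ => f } }
  have := IsFiltered.of_isTerminal PUnit.{u + 1} Limits.isTerminalTop
  obtain ⟨hc⟩ := nonempty_isColimit c (fun _ => h.1) (fun _ => h') fun m =>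
    ⟨⟨⟩, h.2 m⟩
  exact hc.isIso_ι_app_of_isTerminal ⊤ Limits.isTerminalTop

/-- The transport of a single-sorted category along a bijection. -/
@[simps]
def SSCat.transport {M N : Type u} (S : SSCat M) (e : M ≃ N) : SSCat N where
  s n := e (S.s (e.symm n))
  t n := e (S.t (e.symm n))
  comp m n p := S.comp (e.symm m) (e.symm n) (e.symm p)
  ss _ := by simp [S.ss]
  ts _ := by simp [S.ts]
  st _ := by simp [S.st]
  tt _ := by simp [S.tt]
  comp_t h := by simpa using S.comp_t h
  comp_s h := by simpa using S.comp_s h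
  comp_t' h := by simpa using S.comp_t' h
  comp_exists h := by
    obtain ⟨p, hp⟩ := S.comp_exists (e.injective h)
    exact ⟨e p, by simpa using hp⟩
  comp_unique h h' := e.symm.injective (S.comp_unique h h')
  s_comp _ := by simpa using S.s_comp _
  comp_id _ := by simpa using S.comp_id _
  assoc h h' h'' := S.assoc h h' h''

theorem SSCat.isMap_transport {M N : Type u} (S : SSCat M) (e : M ≃ N) : IsMap S
    (S.transport e) e where
  s _ := by simp
  t _ := by simp
  comp h := by simpa using h

variable (C) in
/-- The data of an object of `Cat⁺ / C♯` whose arrows form a subset of `K`. -/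
structure SmallData (K : Type u) : Type u where
  carrier : Set K
  cat : SSCat carrier
  map : carrier → Arr C
  isMap : SSCat.IsMap cat (.ofCat C) map
  marked : Set carrier
  s_mem : ∀ m, cat.s m ∈ marked

/-- The object of `Cat⁺ / C♯` given by the data. -/
noncomputable def SmallData.obj {K : Type u} (D : SmallData C K) : Over (MarkedCat.sharp C) :=
  Over.mk (Y :=
    { carrier := D.cat.Obj
      marked := fun _ _ f => D.cat.arrEquiv ⟨f⟩ ∈ D.marked
      id_marked := fun x => (congrArg (· ∈ D.marked) x.prop).mp (D.s_mem x.val) })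
    { toFunctor := D.isMap.functor ⋙ SSCat.unpack C
      map_marked := fun _ _ _ _ => trivial }

/-- The single-sorted structure on the arrows is moved along an injection into `K`. All structure
then lives on a subset of a fixed set, so such data form a set in the same universe. -/
theorem exists_smallData {K : Type u} {P : Over (MarkedCat.sharp C)} (hP : #(Arr P.left) ≤ #K) :
    ∃ D : SmallData C K, Nonempty (P ≅ D.obj) := by
  obtain ⟨j⟩ := (Cardinal.le_def _ _).1 hP
  let e : Arr P.left ≃ Set.range j := Equiv.ofInjective j j.injective
  let S : SSCat (Set.range j) := (SSCat.ofCat P.left).transport e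
  let D : SmallData C K :=
    { carrier := Set.range j
      cat := S
      map := fun m => Arr.map (proj P) (e.symm m)
      isMap :=
        { s := fun m => by
            refine (congrArg (Arr.map (proj P)) (e.symm_apply_apply _)).trans ?_
            exact Arr.map_id (proj P) _
          t := fun m => by
            refine (congrArg (Arr.map (proj P)) (e.symm_apply_apply _)).trans ?_
            exact Arr.map_id (proj P) _
          comp := fun h => Arr.Comp.map h (proj P) }
      marked := { m | MarkedCat.IsMarked (e.symm m) }
      s_mem := fun m => (congrArg MarkedCat.IsMarked (e.symm_apply_apply _)).mpr
        (MarkedCat.isMarked_id _) }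
  let f : P ⟶ D.obj := Over.homMk
    { toFunctor := SSCat.pack P.left ⋙ (SSCat.isMap_transport (.ofCat P.left) e).functor
      map_marked := fun a b g hg =>
        (congrArg MarkedCat.IsMarked (e.symm_apply_apply ⟨g⟩)).mpr hg }
    (MarkedCat.hom_ext (Arr.functor_ext fun m => by
      refine (SSCat.map_unpack (D.isMap.functor.map _)).trans ?_
      exact congrArg (Arr.map (proj P)) (e.symm_apply_apply m)))
  have hf : Function.Bijective (MarkedCat.arrMap f.left) := by
    have : S.arrEquiv ∘ MarkedCat.arrMap f.left = e := rfl
    have h : Function.Bijective (S.arrEquiv ∘ MarkedCat.arrMap f.left) := this ▸ e.bijective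
    exact (Function.Bijective.of_comp_iff' S.arrEquiv.bijective _).1 h
  have := isIso_of_bijective f hf fun m hm =>
    (congrArg MarkedCat.IsMarked (e.symm_apply_apply m)).mp hm
  exact ⟨D, ⟨asIso f⟩⟩

variable (C) in
/-- The generating trivial cofibrations. -/
noncomputable def gen (K : Type u) : MorphismProperty (Over (MarkedCat.sharp C)) :=
  .ofHoms fun x : Σ D D' : SmallData C K, { f : D.obj ⟶ D'.obj // tcof C f } => x.2.2.1

instance (K : Type u) : MorphismProperty.IsSmall.{u} (gen C K) :=
  MorphismProperty.isSmall_ofHoms _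

theorem gen_le_tcof (K : Type u) : gen C K ≤ tcof C :=
  (MorphismProperty.ofHoms_le_iff _ _).2 fun x => x.2.2.2

instance : (tcof C).RespectsIso := by
  rw [tcof_eq]
  infer_instance

theorem hasLiftingProperty_of_gen {K : Type u} {P Q X Y : Over (MarkedCat.sharp C)}
    (hP : #(Arr P.left) ≤ #K) (hQ : #(Arr Q.left) ≤ #K) {f : P ⟶ Q} (hf : tcof C f) {p : X ⟶ Y}
    (hp : (gen C K).rlp p) : HasLiftingProperty f p := by
  obtain ⟨D, ⟨e⟩⟩ := exists_smallData hP
  obtain ⟨D', ⟨e'⟩⟩ := exists_smallData hQ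
  have h : tcof C (e.inv ≫ f ≫ e'.hom) :=
    (MorphismProperty.cancel_left_of_respectsIso _ _ _).2
      ((MorphismProperty.cancel_right_of_respectsIso _ _ _).2 hf)
  have := hp _ (MorphismProperty.ofHoms.mk (⟨D, D', _, h⟩ :
    Σ D D' : SmallData C K, { f : D.obj ⟶ D'.obj // tcof C f }))
  exact HasLiftingProperty.of_arrow_iso_left
    (Arrow.isoMk e.symm e'.symm : Arrow.mk (e.inv ≫ f ≫ e'.hom) ≅ Arrow.mk f) p

theorem card_cyl {κ : Cardinal.{u}} (hκ : ℵ₀ ≤ κ) {P Q : Over (MarkedCat.sharp C)}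
    (hP : #(Arr P.left) ≤ κ) (hQ : #(Arr Q.left) ≤ κ) (f : P ⟶ Q) : #(Arr (cyl f).left) ≤ κ := by
  refine (mk_le_of_injective (f := fun m : Arr (cyl f).left =>
    (((m.src, m.tgt), Arr.map (cylπ f) m) : ((P.left ⊕ Q.left) × (P.left ⊕ Q.left)) × Arr Q.left))
    fun m n h => ?_).trans ?_
  · exact faithful_iff_arr.1 (inferInstanceAs (cylπ f).Faithful) m n
      (congrArg (fun x => x.1.1) h) (congrArg (fun x => x.1.2) h) (congrArg Prod.snd h)
  · simp only [mk_prod, mk_sum, lift_id]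
    have := add_le_of_le hκ ((card_le_card_arr _).trans hP) ((card_le_card_arr _).trans hQ)
    exact mul_le_of_le hκ (mul_le_of_le hκ this this) hQ

section

variable {A A' B B' Z : Type u} [Category.{u} A] [Category.{u} B] [Category.{u} A']
    [Category.{u} B']
  [Category.{u} Z] {p : A ⥤ B} {j : A' ⥤ A} {k : B' ⥤ B} {i : A' ⥤ Z} {q : Z ⥤ B'} {l : Z ⥤ A}
  (h₁ : i ⋙ l = j) (h₂ : l ⋙ p = q ⋙ k)

theorem obj_injective_of_arr {F : A ⥤ B} (h : Function.Injective (Arr.map F)) :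
    Function.Injective F.obj := fun a b e =>
  congrArg Arr.src (h ((Arr.map_id F a).trans ((congrArg Arr.id e).trans (Arr.map_id F b).symm)))

-- In the application `j` and `k` include a small piece of `p`, that piece factors as `i` followed
-- by the trivial fibration `q`, and `l` is the lift. Fullness of `q` then yields preimages in `A`,
-- though not necessarily in the small piece.
include h₁ h₂ in
theorem exists_arr_of_full (hk : Function.Injective (Arr.map k)) (hq : q.Full) (a b : A') (m :
    Arr B')
    (ha : p.obj (j.obj a) = (Arr.map k m).src) (hb : p.obj (j.obj b) = (Arr.map k m).tgt) :
    ∃ n : Arr A, n.src = j.obj a ∧ n.tgt = j.obj b ∧ Arr.map p n = Arr.map k m := by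
  subst h₁
  obtain ⟨n, e₁, e₂, rfl⟩ := full_iff_arr.1 hq (i.obj a) (i.obj b) m
    (obj_injective_of_arr hk ((Functor.congr_obj h₂ (i.obj a)).symm.trans ha))
    (obj_injective_of_arr hk ((Functor.congr_obj h₂ (i.obj b)).symm.trans hb))
  exact ⟨Arr.map l n, congrArg l.obj e₁, congrArg l.obj e₂, Arr.map_congr h₂ n⟩

include h₁ h₂ in
theorem arr_eq_of_faithful (hj : Function.Injective (Arr.map j)) (hk : Function.Injective
    (Arr.map k))
    (hq : q.Faithful) (m n : Arr A') (e₁ : (Arr.map j m).src = (Arr.map j n).src)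
    (e₂ : (Arr.map j m).tgt = (Arr.map j n).tgt)
    (e₃ : Arr.map p (Arr.map j m) = Arr.map p (Arr.map j n)) : Arr.map j m = Arr.map j n := by
  have h := faithful_iff_arr.1 hq (Arr.map i m) (Arr.map i n)
    (congrArg i.obj (obj_injective_of_arr hj e₁)) (congrArg i.obj (obj_injective_of_arr hj e₂))
  subst h₁
  exact congrArg (Arr.map l) (h (hk ((Arr.map_congr h₂ (Arr.map i m)).symm.trans
    (e₃.trans (Arr.map_congr h₂ (Arr.map i n))))))

end

variable {K : Type u} (hκ : ℵ₀ ≤ #K) (hC : #(Arr C) ≤ #K)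
  {X Y : Over (MarkedCat.sharp C)} {p : X ⟶ Y}

-- Enlarge `S` to a small weak equivalence `T`. The inclusion of its source in its mapping cylinder
-- is then a small trivial cofibration, against which `p` lifts; the lift is `l`.
include hκ hC in
theorem exists_small_lift (hp : weq C p) (hp' : (gen C K).rlp p) {S : Set (Arr X.left ⊕ Arr Y.left)}
    (hS : #S ≤ #K) : ∃ (T : Small p #K) (Z : Over (MarkedCat.sharp C)) (i : T.src ⟶ Z) (q : Z ⟶ T.tgt)
      (l : Z ⟶ X), S ⊆ T.val ∧ tf C q ∧ i ≫ q = T.hom ∧ i ≫ l = subι X T.closed.left ∧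
        l ≫ p = q ≫ subι Y T.closed.right := by
  obtain ⟨T₀, h₀⟩ := Small.exists_above (w := p) hκ hS
  obtain ⟨T, hT, h⟩ := exists_small_weq hκ hC hp T₀
  have hi : tcof C (cylIncl T.hom) := by
    refine ⟨cof_cylIncl _, (weq C).of_postcomp _ (cylProj T.hom) (tf_le_weq _ (tf_cylProj _)) ?_⟩
    rwa [cylIncl_cylProj]
  have := hasLiftingProperty_of_gen T.card_src (card_cyl hκ T.card_src T.card_tgt T.hom) hi hp'
  have sq : CommSq (subι X T.closed.left) (cylIncl T.hom) p (cylProj T.hom ≫ subι Y T.closed.right) :=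
    ⟨by rw [← Category.assoc, cylIncl_cylProj, T.hom_ι]⟩
  exact ⟨T, _, _, _, sq.lift, h₀.trans hT, tf_cylProj _, cylIncl_cylProj _, sq.fac_left, sq.fac_right⟩

theorem arrMap_congr {P Q : Over (MarkedCat.sharp C)} {f g : P ⟶ Q} (h : f = g) (m : Arr P.left) :
    MarkedCat.arrMap f.left m = MarkedCat.arrMap g.left m := by
  rw [h]

-- Each clause of the conclusion concerns finitely many arrows. These are placed in a small piece,
-- the question is answered by the trivial fibration `q`, and the answer is carried to `X` by `l`.
include hκ hC in
theorem tf_of_gen (hp : weq C p) (hp' : (gen C K).rlp p) : tf C p := by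
  have hfin (l : List (Arr X.left ⊕ Arr Y.left)) : #{ z | z ∈ l } ≤ #K :=
    (l.finite_toSet.lt_aleph0.le).trans hκ
  refine ⟨fun y => ?_, full_iff_arr.2 fun a b m ha hb => ?_, faithful_iff_arr.2 fun m n h₁ h₂ h₃ => ?_,
    fun m hm => ?_⟩
  · obtain ⟨T, Z, i, q, l, hT, hq, h₁, h₂, h₃⟩ := exists_small_lift hκ hC hp hp' (hfin [.inr (.id y)])
    obtain ⟨m, hm⟩ := Sub.exists_arr T.closed.right (m := .id y) (hT (by simp))
    obtain ⟨z, hz⟩ := hq.1 m.src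
    refine ⟨(fctr l).obj z, ?_⟩
    refine (Functor.congr_obj (fctr_congr h₃) z).trans ?_
    refine (congrArg (fctr (subι Y T.closed.right)).obj hz).trans ?_
    exact congrArg Arr.src hm
  · obtain ⟨T, Z, i, q, l, hT, hq, h₁, h₂, h₃⟩ := exists_small_lift hκ hC hp hp'
      (hfin [.inl (.id a), .inl (.id b), .inr m])
    obtain ⟨a', ha'⟩ := Sub.exists_arr T.closed.left (m := .id a) (hT (by simp))
    obtain ⟨b', hb'⟩ := Sub.exists_arr T.closed.left (m := .id b) (hT (by simp))
    obtain ⟨m', rfl⟩ := Sub.exists_arr T.closed.right (m := m) (hT (by simp))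
    obtain rfl := congrArg Arr.src ha'
    obtain rfl := congrArg Arr.src hb'
    exact exists_arr_of_full (fctr_congr h₂) (fctr_congr h₃) (arrInj_subι Y T.closed.right) hq.2.1
      a'.src b'.src m' ha hb
  · obtain ⟨T, Z, i, q, l, hT, hq, e₁, e₂, e₃⟩ := exists_small_lift hκ hC hp hp'
      (hfin [.inl m, .inl n])
    obtain ⟨m', rfl⟩ := Sub.exists_arr T.closed.left (m := m) (hT (by simp))
    obtain ⟨n', rfl⟩ := Sub.exists_arr T.closed.left (m := n) (hT (by simp))
    exact arr_eq_of_faithful (fctr_congr e₂) (fctr_congr e₃) (arrInj_subι X T.closed.left)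
      (arrInj_subι Y T.closed.right) hq.2.2.1 m' n' h₁ h₂ h₃
  · obtain ⟨T, Z, i, q, l, hT, hq, e₁, e₂, e₃⟩ := exists_small_lift hκ hC hp hp'
      (hfin [.inl m])
    obtain ⟨m', rfl⟩ := Sub.exists_arr T.closed.left (m := m) (hT (by simp))
    have h₁ : MarkedCat.IsMarked (MarkedCat.arrMap T.hom.left m') := by
      refine reflects_subι T.closed.right _ ?_
      exact (congrArg MarkedCat.IsMarked (arrMap_congr T.hom_ι m')).mpr hm
    have h₂ : MarkedCat.IsMarked (MarkedCat.arrMap i.left m') := by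
      refine hq.2.2.2 _ ?_
      exact (congrArg MarkedCat.IsMarked (arrMap_congr e₁ m')).mpr h₁
    exact (congrArg MarkedCat.IsMarked (arrMap_congr e₂ m')).mp (h₂.map l.left)

end Representatives

open Cardinal Limits

/-! ### The small object argument -/

section SmallObject

variable {C : Type u} [Category.{u} C]

/-! ### Presentability of small objects -/

section Presentable

variable {J : Type u} [PartialOrder J] [IsDirectedOrder J] [Nonempty J] {κ : Cardinal.{u}}
  (hJ : ∀ ⦃ι : Type u⦄, #ι ≤ κ → ∀ f : ι → J, ∃ j, ∀ i, f i ≤ j)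

omit [Nonempty J] in
include hJ in
theorem exists_common_stage {ι : Type u} (hι : #ι ≤ κ) {i₀ : J} {P : ι → ∀ j, (i₀ ⟶ j) → Prop}
    (hP : ∀ i {j k} (h : i₀ ⟶ j) (h' : j ⟶ k), P i j h → P i k (h ≫ h'))
    (h : ∀ i, ∃ j h, P i j h) : ∃ j h, ∀ i, P i j h := by
  choose f hf hf' using h
  obtain ⟨j, hj⟩ := hJ hι f
  obtain ⟨k, h₁, h₂⟩ := exists_ge_ge i₀ j
  exact ⟨k, homOfLE h₁, fun i => hP i (hf i) (homOfLE ((hj i).trans h₂)) (hf' i)⟩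

variable {F : J ⥤ Over (MarkedCat.sharp C)} {c : Cocone F}
  (hc : MarkedCat.IsArrColimit ((Over.forget _).mapCocone c)) {A : Over (MarkedCat.sharp C)}
  (hA : #(Arr A.left) ≤ κ)

-- Each arrow of `A` gets a representative at some stage, a marked one if the arrow is marked, and a
-- single stage `j` bounds all of these. The representatives need not yet respect identities and
-- composition there, but only at most `κ` equations are missing.
include hJ hc hA in
theorem exists_factor_stage (hκ : ℵ₀ ≤ κ) (g : A ⟶ c.pt) : ∃ (j : J) (f :
    A ⟶ F.obj j), f ≫ c.ι.app j = g := by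
  let F' : J ⥤ Cat.{u, u} := (F ⋙ Over.forget _) ⋙ MarkedCat.toCat
  let c' : Cocone F' := MarkedCat.toCat.mapCocone ((Over.forget _).mapCocone c)
  have key (m : Arr A.left) : ∃ (j : J) (n : Arr (F'.obj j)), arrι c' j n = MarkedCat.arrMap g.left m ∧
      (MarkedCat.IsMarked m → MarkedCat.IsMarked (A := (F.obj j).left) n) := by
    by_cases hm : MarkedCat.IsMarked m
    · obtain ⟨j, n, h, h'⟩ := hc.marked _ (hm.map g.left)
      exact ⟨j, n, h', fun _ => h⟩
    · obtain ⟨j, n, h⟩ := hc.arr.surj (MarkedCat.arrMap g.left m)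
      exact ⟨j, n, h, fun h => (hm h).elim⟩
  choose a n hn hn' using key
  obtain ⟨j, hj⟩ := hJ hA a
  let n₀ (m : Arr A.left) : Arr (F'.obj j) := arrMap (F'.map (homOfLE (hj m))) (n m)
  have hn₀ (m) : arrι c' j (n₀ m) = MarkedCat.arrMap g.left m := (arrι_w _ _ _).trans (hn m)
  have hid (x : A.left) (y : F'.obj j) (h : objι c' j y = (fctr g).obj x) :
      arrι c' j (n₀ (.id x)) = arrι c' j (.id y) := by
    rw [hn₀, arrι_mk_id, h]
    exact Arr.map_id (fctr g) x
  -- All equations, one group for each triple of arrows, hold together at stage `k`, where the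
  -- representatives define a functor.
  obtain ⟨k, h, hk⟩ := exists_common_stage hJ (ι := Arr A.left × Arr A.left × Arr A.left) (i₀ := j)
    (P := fun x k h =>
      (arrMap (F'.map h) (n₀ (.id x.1.src)) = arrMap (F'.map h) (.id (n₀ x.1).src) ∧
        arrMap (F'.map h) (n₀ (.id x.1.tgt)) = arrMap (F'.map h) (.id (n₀ x.1).tgt)) ∧
      (Arr.Comp x.1 x.2.1 x.2.2 → Arr.Comp (arrMap (F'.map h) (n₀ x.1))
        (arrMap (F'.map h) (n₀ x.2.1)) (arrMap (F'.map h) (n₀ x.2.2))))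
    (by
      simp only [mk_prod, lift_id]
      exact mul_le_of_le hκ hA (mul_le_of_le hκ hA hA))
    (fun x _ _ h h' p => ⟨⟨eq_arr_mono h h' p.1.1, eq_arr_mono h h' p.1.2⟩,
      fun e => comp_arr_mono h h' (p.2 e)⟩)
    (fun x => by
      refine exists_and_stage (fun h h' p => ⟨eq_arr_mono h h' p.1, eq_arr_mono h h' p.2⟩)
        (fun h h' p e => comp_arr_mono h h' (p e))
        (exists_and_stage eq_arr_mono eq_arr_mono
          (hc.arr.inj _ _ _ (hid _ _ (congrArg Arr.src (hn₀ x.1))))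
          (hc.arr.inj _ _ _ (hid _ _ (congrArg Arr.tgt (hn₀ x.1))))) ?_
      by_cases e : Arr.Comp x.1 x.2.1 x.2.2
      · have e' : Arr.Comp (arrι c' j (n₀ x.1)) (arrι c' j (n₀ x.2.1)) (arrι c' j (n₀ x.2.2)) := by
          rw [hn₀, hn₀, hn₀]
          exact e.map (fctr g)
        obtain ⟨k, h, h'⟩ := hc.arr.comp_stage e'
        exact ⟨k, h, fun _ => h'⟩
      · exact ⟨j, 𝟙 j, fun h => (e h).elim⟩)
  let φ (m : Arr A.left) : Arr (F.obj k).left := arrMap (F'.map h) (n₀ m)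
  have hφ : SSCat.IsMap (.ofCat A.left) (.ofCat (F.obj k).left) φ :=
    { s := fun m => (hk (m, m, m)).1.1.trans (arrMap_mk_id _ _)
      t := fun m => (hk (m, m, m)).1.2.trans (arrMap_mk_id _ _)
      comp := fun {m n p} e => (hk (m, n, p)).2 e }
  have hφ' (m) : MarkedCat.arrMap (c.ι.app k).left (φ m) = MarkedCat.arrMap g.left m :=
    (arrι_w c' h (n₀ m)).trans (hn₀ m)
  have hφ'' (m) : Arr.map (functorOfArr φ hφ) m = φ m := functorOfArr_map φ hφ m
  refine ⟨k, Over.homMk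
    { toFunctor := functorOfArr φ hφ
      map_marked := fun _ _ f hf => by
        have h₁ : MarkedCat.IsMarked (φ ⟨f⟩) := by
          have h₂ : MarkedCat.IsMarked (A := (F.obj (a ⟨f⟩)).left) (n ⟨f⟩) := hn' ⟨f⟩ hf
          exact (h₂.map (F.map (homOfLE (hj ⟨f⟩))).left).map (F.map h).left
        exact (congrArg MarkedCat.IsMarked (hφ'' ⟨f⟩)).mpr h₁ }
    (MarkedCat.hom_ext (Arr.functor_ext fun m => ?_)), over_hom_ext (Arr.functor_ext fun m => ?_)⟩
  · refine (congrArg (Arr.map (proj (F.obj k))) (hφ'' m)).trans ?_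
    refine (Arr.map_congr (fctr_comp_proj (c.ι.app k)) (φ m)).symm.trans ?_
    exact (congrArg (Arr.map (proj c.pt)) (hφ' m)).trans (Arr.map_congr (fctr_comp_proj g) m)
  · exact (congrArg (MarkedCat.arrMap (c.ι.app k).left) (hφ'' m)).trans (hφ' m)

omit [Nonempty J] in
include hJ hc hA in
theorem exists_eq_stage {j : J} {f g : A ⟶ F.obj j} (e : f ≫ c.ι.app j = g ≫ c.ι.app j) :
    ∃ (k : J) (h : j ⟶ k), f ≫ F.map h = g ≫ F.map h := by
  let F' : J ⥤ Cat.{u, u} := (F ⋙ Over.forget _) ⋙ MarkedCat.toCat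
  obtain ⟨k, h, hk⟩ := exists_common_stage hJ hA (i₀ := j) (P := fun m k h =>
    arrMap (F'.map h) (MarkedCat.arrMap f.left m) = arrMap (F'.map h) (MarkedCat.arrMap g.left m))
    (fun m _ _ h h' p => eq_arr_mono h h' p) fun m => hc.arr.inj _ _ _ (arrMap_congr e m)
  exact ⟨k, h, over_hom_ext (Arr.functor_ext hk)⟩

include hJ hA in
theorem preservesColimit_coyoneda (hκ : ℵ₀ ≤ κ) (F : J ⥤ Over (MarkedCat.sharp C)) :
    PreservesColimit F (coyoneda.obj (op A)) where
  preserves {c} hc := by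
    have hc' : MarkedCat.IsArrColimit ((Over.forget _).mapCocone c) :=
      .of_isColimit (isColimitOfPreserves _ hc)
    refine ⟨Types.FilteredColimit.isColimitOf' _ _ (fun g => ?_) fun j f g e => ?_⟩
    · obtain ⟨j, f, h⟩ := exists_factor_stage hJ hc' hA hκ g
      exact ⟨j, f, h.symm⟩
    · exact exists_eq_stage hJ hc' hA e

end Presentable

instance : HasColimits (Over (MarkedCat.sharp C)) := inferInstance

theorem hasSmallObjectArgument_gen {K : Type u} (hK : ℵ₀ ≤ #K) :
    MorphismProperty.HasSmallObjectArgument.{u} (gen C K) := by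
  -- The successor cardinal is regular, and "less than `μ`" means "at most `#K`", which is exactly
  -- the bound on the arrows of the sources of the generators.
  let μ := Order.succ #K
  have hμ : Fact μ.IsRegular := ⟨isRegular_succ hK⟩
  have : Nonempty μ.ord.ToType := by
    rw [← Cardinal.mk_ne_zero_iff, Cardinal.mk_ord_toType]
    exact hμ.out.ne_zero
  let _ : OrderBot μ.ord.ToType := WellFoundedLT.toOrderBot _
  refine ⟨μ, hμ, inferInstance, ?_⟩
  exact
    { preservesColimit := fun i hi f hf => by
        refine preservesColimit_coyoneda (κ := #K) (fun ι hι g => ?_) ?_ hK _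
        · have h : HasCardinalLT ι μ :=
            (hasCardinalLT_iff_cardinal_mk_lt _ _).2 (Order.lt_succ_of_le hι)
          exact ⟨IsCardinalFiltered.max g h, fun i => (IsCardinalFiltered.toMax g h i).le⟩
        · obtain ⟨D, _, _⟩ := hi
          exact (mk_congr D.cat.arrEquiv).le.trans (mk_set_le _) }

/-! ### The model structure for Grothendieck fibrations -/

variable (C) in
/-- A set which is large enough to index the arrows of generating trivial cofibrations. -/
def Bound : Type u := max ℵ₀ #(Arr C) |>.out

theorem aleph0_le_bound : ℵ₀ ≤ #(Bound C) := (le_max_left _ _).trans (mk_out _).ge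

theorem card_le_bound : #(Arr C) ≤ #(Bound C) := (le_max_right _ _).trans (mk_out _).ge

variable (C) in
/-- The fibrations of `Cat⁺ / C♯`. -/
def fib : MorphismProperty (Over (MarkedCat.sharp C)) := (gen C (Bound C)).rlp

instance : MorphismProperty.HasSmallObjectArgument.{u} (gen C (Bound C)) :=
  hasSmallObjectArgument_gen aleph0_le_bound

/-- One inclusion is the cardinality argument `tf_of_gen`; the other holds because the generators
are cofibrations. -/
theorem fib_inf_weq : fib C ⊓ weq C = tf C := by
  refine le_antisymm (fun _ _ p hp => tf_of_gen aleph0_le_bound card_le_bound hp.2 hp.1) ?_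
  exact le_inf (fun _ _ p hp _ _ i hi => cof_le_tf_llp _ (gen_le_tcof _ _ hi).1 _ hp) tf_le_weq

theorem detect_le_fib : detect C ≤ fib C := by
  rw [fib, ← MorphismProperty.le_llp_iff_le_rlp, ← tcof_eq]
  exact gen_le_tcof _

/-- Retract argument: factor a trivial cofibration by the small object argument. The second factor
is a fibration and a weak equivalence, hence in `tf`, so the given map lifts against it and is a
retract of the first factor. -/
theorem fib_llp : (fib C).llp = tcof C := by
  have h : (fib C).llp ≤ tcof C := by
    rw [tcof_eq]
    exact MorphismProperty.antitone_llp detect_le_fib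
  refine le_antisymm h fun P Q f hf => ?_
  obtain ⟨d⟩ := MorphismProperty.HasFactorization.nonempty_mapFactorizationData
    (W₁ := (gen C (Bound C)).rlp.llp) (W₂ := (gen C (Bound C)).rlp) f
  have hp : tf C d.p := by
    rw [← fib_inf_weq]
    exact ⟨d.hp, (weq C).of_precomp d.i _ (h _ d.hi).2 (by rw [d.fac]; exact hf.2)⟩
  have := cof_le_tf_llp f hf.1 _ hp
  exact MorphismProperty.of_retract (RetractArrow.ofLeftLiftingProperty d.fac) d.hi

theorem fib_eq : fib C = (tcof C).rlp := by
  rw [← fib_llp, fib, MorphismProperty.rlp_llp_rlp]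

instance : (tcof C).HasFactorization (fib C) := by
  rw [← fib_llp]
  exact inferInstanceAs ((gen C (Bound C)).rlp.llp.HasFactorization (gen C (Bound C)).rlp)

instance : (tcof C).IsStableUnderRetracts := by
  rw [← fib_llp]
  infer_instance

instance : (fib C).IsStableUnderRetracts := inferInstanceAs (gen C
    (Bound C)).rlp.IsStableUnderRetracts

instance : (tcof C).IsWeakFactorizationSystem (fib C) :=
  MorphismProperty.IsWeakFactorizationSystem.mk' _ _ fun _ _ hi hp => fib_llp.ge _ hi _ hp

instance : (cof C).IsWeakFactorizationSystem (fib C ⊓ weq C) := by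
  rw [fib_inf_weq]
  infer_instance

/-- The model structure for Grothendieck fibrations on `Cat⁺ / C♯`. -/
noncomputable abbrev grfibModel (C : Type u) [Category.{u} C] : ModelCategory (Over
    (MarkedCat.sharp C)) :=
  letI : CategoryWithFibrations (Over (MarkedCat.sharp C)) := ⟨fib C⟩
  letI : CategoryWithCofibrations (Over (MarkedCat.sharp C)) := ⟨cof C⟩
  letI : CategoryWithWeakEquivalences (Over (MarkedCat.sharp C)) := ⟨weq C⟩
  haveI : (weakEquivalences (Over (MarkedCat.sharp C))).HasTwoOutOfThreeProperty :=
    inferInstanceAs (weq C).HasTwoOutOfThreeProperty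
  haveI : MorphismProperty.IsWeakFactorizationSystem (cofibrations (Over (MarkedCat.sharp C)))
      (trivialFibrations (Over (MarkedCat.sharp C))) :=
    inferInstanceAs ((cof C).IsWeakFactorizationSystem (fib C ⊓ weq C))
  haveI : MorphismProperty.IsWeakFactorizationSystem (trivialCofibrations (Over (MarkedCat.sharp C)))
      (fibrations (Over (MarkedCat.sharp C))) :=
    inferInstanceAs ((tcof C).IsWeakFactorizationSystem (fib C))
  .mk' _

end SmallObject

/-! ### Fibrant objects -/

section Cartesian

variable {A B D : Type u} [Category.{u} A] [Category.{u} B] [Category.{u} D]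

/-- Cartesian arrows. -/
def IsCartesianArr (p : A ⥤ D) (m : Arr A) : Prop := IsCartesianMor p m.hom

theorem IsCartesianArr.of_map {F : A ⥤ B} {q : B ⥤ D} {p : A ⥤ D} (e : F ⋙ q = p) [F.Full]
    [F.Faithful]
    {m : Arr A} (h : IsCartesianArr q (Arr.map F m)) : IsCartesianArr p m := by
  subst e
  refine (isCartesianMor_iff _ _).2 fun z h' f hf => ?_
  obtain ⟨k, ⟨h₁, h₂⟩, h₃⟩ := (isCartesianMor_iff _ _).1 h (F.obj z) (F.map h') f hf
  refine ⟨F.preimage k, ⟨?_, F.map_injective ?_⟩, fun y hy => F.map_injective ?_⟩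
  · exact (congrArg q.map (F.map_preimage k)).trans h₁
  · rw [F.map_comp, F.map_preimage, h₂]
  · rw [F.map_preimage]
    exact h₃ _ ⟨hy.1, by rw [← F.map_comp, hy.2]⟩

theorem IsCartesianArr.map {F : A ⥤ B} {q : B ⥤ D} {p : A ⥤ D} (e : F ⋙ q = p) [F.Full] [F.Faithful]
    (hF : Function.Surjective F.obj) {m : Arr A} (h : IsCartesianArr p m) :
    IsCartesianArr q (Arr.map F m) := by
  subst e
  refine (isCartesianMor_iff _ _).2 fun z h' f hf => ?_
  obtain ⟨z, rfl⟩ := hF z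
  obtain ⟨h', rfl⟩ := F.map_surjective h'
  obtain ⟨k, ⟨h₁, h₂⟩, h₃⟩ := (isCartesianMor_iff _ _).1 h z h' f hf
  refine ⟨F.map k, ⟨h₁, by rw [← F.map_comp, h₂]⟩, fun y hy => ?_⟩
  obtain ⟨y, rfl⟩ := F.map_surjective y
  exact congrArg F.map (h₃ y ⟨hy.1, F.map_injective (by rw [F.map_comp, hy.2])⟩)

theorem isCartesianArr_iff {p : A ⥤ D} {m : Arr A} : IsCartesianArr p m ↔
    ∀ (h : Arr A) (f : Arr D), h.tgt = m.tgt → Arr.Comp f (Arr.map p m) (Arr.map p h) →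
      ∃! k : Arr A, Arr.map p k = f ∧ Arr.Comp k m h := by
  obtain ⟨g⟩ := m
  rename_i a b
  refine (isCartesianMor_iff _ _).trans ⟨fun H h f e hf => ?_, fun H z h f e => ?_⟩
  · obtain ⟨h⟩ := h
    obtain rfl : _ = b := e
    obtain ⟨f⟩ := f
    obtain rfl : _ = p.obj a := hf.tgt_eq
    obtain rfl : p.obj _ = _ := hf.src_eq
    obtain ⟨k, ⟨h₁, h₂⟩, h₃⟩ := H _ h f (Arr.mk_inj.1 ((Arr.Comp.iff_of_hom _ _ _).1 hf))
    refine ⟨⟨k⟩, ⟨congrArg Arr.mk h₁, (Arr.Comp.iff_of_hom _ _ _).2 (congrArg Arr.mk h₂.symm)⟩, ?_⟩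
    rintro ⟨y⟩ ⟨e₁, e₂⟩
    obtain rfl : _ = a := e₂.tgt_eq
    obtain rfl := e₂.src_eq
    exact congrArg Arr.mk (h₃ y ⟨Arr.mk_inj.1 e₁,
      (Arr.mk_inj.1 ((Arr.Comp.iff_of_hom _ _ _).1 e₂)).symm⟩)
  · obtain ⟨⟨k⟩, ⟨h₁, h₂⟩, h₃⟩ := H ⟨h⟩ ⟨f⟩ rfl
      ((Arr.Comp.iff_of_hom _ _ _).2 (congrArg Arr.mk e))
    obtain rfl : _ = a := h₂.tgt_eq
    obtain rfl : z = _ := h₂.src_eq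
    refine ⟨k, ⟨Arr.mk_inj.1 h₁, (Arr.mk_inj.1 ((Arr.Comp.iff_of_hom _ _ _).1 h₂)).symm⟩,
      fun y hy => Arr.mk_inj.1 (h₃ ⟨y⟩ ⟨congrArg Arr.mk hy.1,
        (Arr.Comp.iff_of_hom _ _ _).2 (congrArg Arr.mk hy.2.symm)⟩)⟩

/-- Factor in `B` after applying `i` and bring the factorization back by `r`. For uniqueness, apply
`i` to a competing factorization. -/
theorem IsCartesianArr.of_retract {i : A ⥤ B} {r : B ⥤ A} {p : A ⥤ D} {q : B ⥤ D} (e : i ⋙ r = 𝟭 A)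
    (hi : i ⋙ q = p) (hr : r ⋙ p = q) {m : Arr A} (h : IsCartesianArr q (Arr.map i m)) :
    IsCartesianArr p m := by
  have e' (m) : Arr.map r (Arr.map i m) = m := Arr.map_congr e m
  have hi' (m) : Arr.map q (Arr.map i m) = Arr.map p m := Arr.map_congr hi m
  have hr' (m) : Arr.map p (Arr.map r m) = Arr.map q m := Arr.map_congr hr m
  refine isCartesianArr_iff.2 fun n f hn hf => ?_
  obtain ⟨k, ⟨h₁, h₂⟩, h₃⟩ := isCartesianArr_iff.1 h (Arr.map i n) f (congrArg i.obj hn)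
    (by rwa [hi', hi'])
  refine ⟨Arr.map r k, ⟨(hr' k).trans h₁, ?_⟩, fun y hy => ?_⟩
  · have := h₂.map r
    rwa [e', e'] at this
  · rw [← h₃ (Arr.map i y) ⟨(hi' y).trans hy.1, hy.2.map i⟩, e']

theorem isStronglyCartesian_congr {p : A ⥤ D} {a b : A} {g : a ⟶ b} {x y x' y' : D} {f : x ⟶ y}
    {f' : x' ⟶ y'} (e : Arr.mk f = Arr.mk f') (h : p.IsStronglyCartesian f g) :
    p.IsStronglyCartesian f' g := by
  cases e
  exact h

theorem IsCartesianArr.comp {p : A ⥤ D} {a b c : A} {f : a ⟶ b} {g : b ⟶ c} (hf :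
    IsCartesianMor p f)
    (hg : IsCartesianMor p g) : IsCartesianMor p (f ≫ g) := by
  have : p.IsStronglyCartesian (p.map f ≫ p.map g) (f ≫ g) := inferInstance
  rwa [← p.map_comp] at this

theorem isCartesianMor_of_isIso (p : A ⥤ D) {a b : A} (f : a ⟶ b) [IsIso f] : IsCartesianMor p f :=
  inferInstance

/-- A cartesian lift of an isomorphism is an isomorphism. -/
theorem isIsofibration_of_isGrothendieckFibration {p : A ⥤ D} (hp : IsGrothendieckFibration p) :
    IsIsofibration p := by
  refine isIsofibration_iff.2 fun a d g => ?_
  obtain ⟨n, rfl, h, hn⟩ := (isGrothendieckFibration_iff p).1 hp a ⟨g.hom⟩ rfl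
  have : IsIso (p.map n.hom) := Arr.isIso_congr h.symm (inferInstanceAs (IsIso g.hom))
  have := Functor.IsStronglyCartesian.isIso_of_base_isIso p (p.map n.hom) n.hom
  exact ⟨n.src, asIso n.hom, h⟩

theorem arr_conj_eq {a b a' b' : A} {θ : a ≅ b} {θ' : a' ≅ b'} (h : Arr.mk θ.hom = .id b)
    (h' : Arr.mk θ'.hom = .id b') (f : b ⟶ b') : Arr.mk (θ.hom ≫ f ≫ θ'.inv) = Arr.mk f := by
  obtain rfl : a = b := congrArg Arr.src h
  obtain rfl : a' = b' := congrArg Arr.src h'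
  have h₁ : θ' = Iso.refl a' := Iso.ext (Arr.mk_inj.1 h')
  rw [Arr.mk_inj.1 h, h₁]
  simp

end Cartesian

variable {C : Type u} [Category.{u} C]

namespace IsCartMarkedFibration

variable {P Q : Over (MarkedCat.sharp C)}

theorem isMarked_iff (hP : IsCartMarkedFibration P) {m : Arr P.left} :
    MarkedCat.IsMarked m ↔ IsCartesianArr (proj P) m := hP.marked_iff _

theorem isMarked_conj (hP : IsCartMarkedFibration P) {a b a' b' : P.left} (θ : a ≅ b) (θ' : a' ≅ b')
    {f : b ⟶ b'} (hf : P.left.marked f) : P.left.marked (θ.hom ≫ f ≫ θ'.inv) :=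
  (hP.marked_iff _).2 (IsCartesianArr.comp (isCartesianMor_of_isIso _ _)
    (IsCartesianArr.comp ((hP.marked_iff _).1 hf) (isCartesianMor_of_isIso _ _)))

theorem reflects (hP : IsCartMarkedFibration P) (hQ : IsCartMarkedFibration Q) (f : P ⟶ Q)
    [(fctr f).Full] [(fctr f).Faithful] : Reflects f := fun _ hm =>
  hP.isMarked_iff.2 (.of_map (fctr_comp_proj f) (hQ.isMarked_iff.1 hm))

theorem of_tf (hQ : IsCartMarkedFibration Q) {f : P ⟶ Q} (hf : tf C f) :
    IsCartMarkedFibration P := by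
  obtain ⟨h₁, h₂, h₃, h₄⟩ := hf
  refine ⟨(isGrothendieckFibration_iff _).2 fun a m hm => ?_, fun a' a g => ?_⟩
  · obtain ⟨n, hn, rfl, hn'⟩ := (isGrothendieckFibration_iff _).1 hQ.isGrothendieckFibration
      ((fctr f).obj a) m (hm.trans (Functor.congr_obj (fctr_comp_proj f) a).symm)
    obtain ⟨z, hz⟩ := h₁ n.src
    obtain ⟨n, -, e, rfl⟩ := full_iff_arr.1 h₂ z a n hz hn.symm
    exact ⟨n, e, (Arr.map_congr (fctr_comp_proj f) n).symm, IsCartesianArr.of_map (fctr_comp_proj f) hn'⟩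
  · have e : MarkedCat.IsMarked (Arr.mk g) ↔ MarkedCat.IsMarked (MarkedCat.arrMap f.left ⟨g⟩) :=
      ⟨fun h => h.map _, h₄ _⟩
    refine e.trans (hQ.isMarked_iff.trans ?_)
    exact ⟨IsCartesianArr.of_map (m := ⟨g⟩) (fctr_comp_proj f),
      IsCartesianArr.map (m := ⟨g⟩) (fctr_comp_proj f) h₁⟩

/-- Retracts of cart-marked Grothendieck fibrations. -/
theorem of_retract (hQ : IsCartMarkedFibration Q) (i : P ⟶ Q) (r : Q ⟶ P) (e : i ≫ r = 𝟙 P) :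
    IsCartMarkedFibration P := by
  have e' : fctr i ⋙ fctr r = 𝟭 _ := fctr_congr e
  have hi := fctr_comp_proj i
  have hr := fctr_comp_proj r
  have hm {m : Arr P.left} (h : MarkedCat.IsMarked m) : IsCartesianArr (proj P) m := by
    exact .of_retract e' hi hr (hQ.isMarked_iff.1 (h.map i.left))
  have hl (a : P.left) (m : Arr C) (hm : m.tgt = (proj P).obj a) :
      ∃ n : Arr P.left, n.tgt = a ∧ Arr.map (proj P) n = m ∧ MarkedCat.IsMarked n := by
    obtain ⟨n, h₁, h₂, h₃⟩ := (isGrothendieckFibration_iff _).1 hQ.isGrothendieckFibration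
      ((fctr i).obj a) m (hm.trans (Functor.congr_obj hi a).symm)
    refine ⟨Arr.map (fctr r) n, ?_, (Arr.map_congr hr n).trans h₂,
      MarkedCat.IsMarked.map (hQ.isMarked_iff.2 h₃) r.left⟩
    exact (congrArg (fctr r).obj h₁).trans (Functor.congr_obj e' a)
  refine ⟨(isGrothendieckFibration_iff _).2 fun a m h => ?_, fun a' a g => ⟨fun h => hm (m := ⟨g⟩) h, fun h => ?_⟩⟩
  · obtain ⟨n, h₁, h₂, h₃⟩ := hl a m h
    exact ⟨n, h₁, h₂, hm h₃⟩
  -- A cartesian `g` equals a marked lift `g₀` up to an isomorphism `φ`. Isomorphisms are not known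
  -- to be marked in `P`, so the composite is formed in `Q`, where it is cartesian and hence marked,
  -- and `r` brings it back.
  · obtain ⟨⟨g₀⟩, rfl, h₁, h₂⟩ := hl a ⟨(proj P).map g⟩ rfl
    have := isStronglyCartesian_congr h₁ (hm h₂)
    have hg : (proj P).IsStronglyCartesian ((proj P).map g) g := h
    let φ := Functor.IsCartesian.domainUniqueUpToIso (proj P) ((proj P).map g) g₀ g
    have hφ : φ.hom ≫ g₀ = g := Functor.IsCartesian.fac (proj P) ((proj P).map g) g₀ g
    have h₃ : Q.left.marked ((fctr i).map φ.hom ≫ (fctr i).map g₀) :=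
      (hQ.marked_iff _).2 (IsCartesianArr.comp (isCartesianMor_of_isIso _ _)
        ((hQ.marked_iff _).1 (i.left.map_marked _ h₂)))
    rw [← (fctr i).map_comp, hφ] at h₃
    have h₄ : MarkedCat.IsMarked (Arr.map (fctr r) (Arr.map (fctr i) ⟨g⟩)) := r.left.map_marked _ h₃
    exact (congrArg MarkedCat.IsMarked (Arr.map_congr e' ⟨g⟩)).mp h₄

end IsCartMarkedFibration

/-! ### Lifting up to equivalence -/

section Lift

variable {A B X W Y : Over (MarkedCat.sharp C)} {i : A ⟶ B} {u : A ⟶ X} {v : B ⟶ W} {w : X ⟶ W}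
  {q : W ⟶ Y}

/-- Lifting of injective-on-objects functors along isofibrations, up to equivalence. -/
theorem exists_lift (hi : cof C i) (hw : (fctr w).IsEquivalence) (hw' : Reflects w)
    (hW : IsCartMarkedFibration W) (hq : IsIsofibration (fctr w ⋙ fctr q)) (sq : u ≫ w = i ≫ v) :
    ∃ L : B ⟶ X, i ≫ L = u ∧ L ≫ w ≫ q = v ≫ q := by
  have sq' : fctr u ⋙ fctr w = fctr i ⋙ fctr v := fctr_congr sq
  -- On the image of `i` the isomorphism `θ` is an identity, so the lift will restrict strictly to
  -- `u`. Elsewhere an arbitrary preimage under `w` is corrected along the isofibration so that `θ`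
  -- lies over an identity of `Y`.
  have key (b : B.left) : ∃ (x : X.left) (θ : (fctr w).obj x ≅ (fctr v).obj b),
      Arr.mk ((fctr q).map θ.hom) = .id ((fctr q).obj ((fctr v).obj b)) ∧
      ∀ a, (fctr i).obj a = b → x = (fctr u).obj a ∧ Arr.mk θ.hom = .id ((fctr v).obj b) := by
    by_cases hb : ∃ a, (fctr i).obj a = b
    · obtain ⟨a, rfl⟩ := hb
      have e := Functor.congr_obj sq' a
      have h : Arr.mk (eqToIso e).hom = .id ((fctr v).obj ((fctr i).obj a)) := by
        have := Arr.mk_eqToHom_comp e (𝟙 _) rfl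
        simpa using this
      refine ⟨(fctr u).obj a, eqToIso e, ?_, fun a' ha' => ⟨by rw [hi ha'], h⟩⟩
      exact (congrArg (Arr.map (fctr q)) h).trans (Arr.map_id _ _)
    · let θ := (fctr w).objObjPreimageIso ((fctr v).obj b)
      obtain ⟨x, f, hf⟩ := isIsofibration_iff.1 hq ((fctr q).mapIso θ.symm)
      refine ⟨x, (fctr w).mapIso f ≪≫ θ, ?_, fun a ha => (hb ⟨a, ha⟩).elim⟩
      have h := Arr.mk_comp_congr hf (rfl : Arr.mk ((fctr q).map θ.hom) = _)
      refine (congrArg Arr.mk ((fctr q).map_comp _ _)).trans (h.trans (congrArg Arr.mk ?_))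
      exact ((fctr q).mapIso θ).inv_hom_id
  choose x θ hθ hθ' using key
  -- Conjugating `v` by `θ` puts its values strictly in the image of `w` without changing the
  -- composite with `q`; marks survive because composing a cartesian morphism with isomorphisms
  -- keeps it cartesian.
  let V : B.left ⥤ W.left := conj (fctr v) (fun b => (fctr w).obj (x b)) θ
  let L : B.left ⥤ X.left := liftFF (fctr w) V x fun _ => rfl
  have hL : L ⋙ fctr w = V := liftFF_comp _ _ _ _
  have hV : V ⋙ fctr q = fctr v ⋙ fctr q := Arr.functor_ext fun m => by
    have h := arr_conj_eq (θ := (fctr q).mapIso (θ m.src)) (θ' := (fctr q).mapIso (θ m.tgt))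
      (hθ _) (hθ _) ((fctr q).map ((fctr v).map m.hom))
    refine Eq.trans (congrArg Arr.mk ?_) h
    exact ((fctr q).map_comp _ _).trans (congrArg _ ((fctr q).map_comp _ _))
  have hLq : L ⋙ fctr w ⋙ fctr q = fctr v ⋙ fctr q := (congrArg (· ⋙ fctr q) hL).trans hV
  have hwq : fctr w ⋙ fctr q ⋙ proj Y = proj X := fctr_comp_proj (w ≫ q)
  let L' : B ⟶ X := Over.homMk
    { toFunctor := L
      map_marked := fun a b f hf => hw' ⟨L.map f⟩
        ((congrArg MarkedCat.IsMarked (Arr.map_congr hL ⟨f⟩)).mpr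
          (hW.isMarked_conj (θ a) (θ b) (v.left.map_marked f hf))) }
    (MarkedCat.hom_ext (by
      change L ⋙ proj X = proj B
      rw [← hwq]
      exact (congrArg (· ⋙ proj Y) hLq).trans (fctr_comp_proj (v ≫ q))))
  refine ⟨L', over_hom_ext ?_, over_hom_ext hLq⟩
  refine faithful_functor_ext (fctr w) (fun a => (hθ' _ a rfl).1) ?_
  refine (congrArg (fctr i ⋙ ·) hL).trans (Eq.trans ?_ sq'.symm)
  exact Arr.functor_ext fun m => arr_conj_eq (hθ' _ m.src rfl).2 (hθ' _ m.tgt rfl).2 _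

end Lift

/-! ### Fibrant objects and fibrations between them -/

section Fibrant

/-- Extension along trivial cofibrations. -/
def HasExtension (P : Over (MarkedCat.sharp C)) : Prop :=
  ∀ ⦃A B : Over (MarkedCat.sharp C)⦄ (i : A ⟶ B), tcof C i → ∀ u : A ⟶ P, ∃ v, i ≫ v = u

theorem fib_iff_hasExtension {P T : Over (MarkedCat.sharp C)} (hT : Limits.IsTerminal T) (p :
    P ⟶ T) :
    fib C p ↔ HasExtension P := by
  rw [fib_eq]
  refine ⟨fun h A B i hi u => ?_, fun h A B i hi => ⟨fun {u v} sq => ?_⟩⟩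
  · have := h i hi
    have sq : CommSq u i p (hT.from B) := ⟨hT.hom_ext _ _⟩
    exact ⟨sq.lift, sq.fac_left⟩
  · obtain ⟨l, hl⟩ := h i hi u
    exact ⟨⟨⟨l, hl, hT.hom_ext _ _⟩⟩⟩

/-- The constant presheaf on the terminal category. -/
def pointPsh (C : Type u) [Category.{u} C] : Cᵒᵖ ⥤ Cat.{u, u} :=
  (Functor.const _).obj (Cat.of (Discrete PUnit.{u + 1}))

/-- The constant presheaf on the terminal category is terminal. -/
def isTerminalPointPsh : Limits.IsTerminal (pointPsh C) :=
  .ofUniqueHom (fun F =>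
    { app := fun _ => (Functor.star _).toCatHom
      naturality := fun _ _ _ => Cat.ext (Functor.punit_ext' _ _) })
    fun F α => by
      refine NatTrans.ext (funext fun c => Cat.ext ?_)
      exact Functor.punit_ext' (α.app c).toFunctor _

theorem arr_point_eq (m n : Arr (Discrete PUnit.{u + 1})) : m = n := by
  obtain @⟨a, b, f⟩ := m
  obtain @⟨a', b', g⟩ := n
  obtain ⟨⟨⟩⟩ := a
  obtain ⟨⟨⟩⟩ := b
  obtain ⟨⟨⟩⟩ := a'
  obtain ⟨⟨⟩⟩ := b'
  exact Arr.mk_inj.2 (Subsingleton.elim f g)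

theorem levelIsofib_to_point {F : Cᵒᵖ ⥤ Cat.{u, u}} (α : F ⟶ pointPsh C) : levelIsofib C α :=
  fun _ => isIsofibration_iff.2 fun a _ _ => ⟨a, Iso.refl a, arr_point_eq _ _⟩

/-- Every presheaf is fibrant, and the right adjoint preserves the terminal object as well as
fibrations. -/
theorem hasExtension_groth (F : Cᵒᵖ ⥤ Cat.{u, u}) : HasExtension ((groth C).obj F) := by
  have h : Limits.IsTerminal ((groth C).obj (pointPsh C)) :=
    have := (adjunction C).rightAdjoint_preservesLimits
    isTerminalPointPsh.isTerminalObj (groth C)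
  exact (fib_iff_hasExtension h ((groth C).map (isTerminalPointPsh.from F))).1
    (detect_le_fib _ (.inr ⟨_, levelIsofib_to_point _⟩))

/-- An extension exists after composing with the unit, since its target is a Grothendieck
construction. The unit is an equivalence, so the extension can be moved back to `P`. -/
theorem IsCartMarkedFibration.hasExtension {P : Over (MarkedCat.sharp C)} (hP :
    IsCartMarkedFibration P) :
    HasExtension P := by
  intro A B i hi u
  obtain ⟨v, hv⟩ := hasExtension_groth _ i hi (u ≫ unit P)
  have hu := isEquivalence_unit hP
  have hG := isCartMarkedFibration_groth ((TPlus C).obj P)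
  -- Taking for `q` the projection to the base makes `fctr w ⋙ fctr q` the fibration `proj P`, which
  -- is an isofibration.
  obtain ⟨L, hL, -⟩ := exists_lift (Y := Over.mk (𝟙 (MarkedCat.sharp C)))
    (q := Over.homMk ((groth C).obj ((TPlus C).obj P)).hom) hi.1 hu (hP.reflects hG _) hG
    (by
      have h : IsIsofibration (proj P) := isIsofibration_of_isGrothendieckFibration hP.isGrothendieckFibration
      rwa [← fctr_comp_proj (unit P)] at h) hv.symm
  exact ⟨L, hL⟩

/-- The inclusion of `P` in the mapping cylinder of its unit is a trivial cofibration, so it has a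
retraction. The cylinder is cart-marked because its projection to a Grothendieck construction is in
`tf`. -/
theorem isCartMarkedFibration_of_hasExtension {P : Over (MarkedCat.sharp C)} (hP : HasExtension P) :
    IsCartMarkedFibration P := by
  have hi : tcof C (cylIncl (unit P)) := by
    refine ⟨cof_cylIncl _, (weq C).of_postcomp _ (cylProj (unit P)) (tf_le_weq _ (tf_cylProj _)) ?_⟩
    rw [cylIncl_cylProj]
    exact weq_unit P
  obtain ⟨r, hr⟩ := hP _ hi (𝟙 P)
  exact ((isCartMarkedFibration_groth _).of_tf (tf_cylProj (unit P))).of_retract _ r hr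

theorem hasExtension_iff {P : Over (MarkedCat.sharp C)} :
    HasExtension P ↔ IsCartMarkedFibration P :=
  ⟨isCartMarkedFibration_of_hasExtension, IsCartMarkedFibration.hasExtension⟩

theorem HasExtension.of_fib {P Q : Over (MarkedCat.sharp C)} (hQ : HasExtension Q) {p : P ⟶ Q}
    (hp : fib C p) : HasExtension P := by
  intro A B i hi u
  obtain ⟨v, hv⟩ := hQ i hi (u ≫ p)
  rw [fib_eq] at hp
  have := hp i hi
  have sq : CommSq u i p v := ⟨hv.symm⟩
  exact ⟨sq.lift, sq.fac_left⟩

/-- Factor `p` as a trivial cofibration `d.i` followed by a fibration `d.p`. The middle object is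
fibrant, so `d.i` is an equivalence, and lifting up to equivalence gives a retraction of `d.i` over
`Q`. Thus `p` is a retract of `d.p`. -/
theorem fib_of_isIsofibration {P Q : Over (MarkedCat.sharp C)} (hP : IsCartMarkedFibration P)
    (hQ : IsCartMarkedFibration Q) {p : P ⟶ Q} (hp : IsIsofibration (fctr p)) : fib C p := by
  obtain ⟨d⟩ := MorphismProperty.HasFactorization.nonempty_mapFactorizationData
    (W₁ := tcof C) (W₂ := fib C) p
  have hZ := isCartMarkedFibration_of_hasExtension (hQ.hasExtension.of_fib d.hp)
  have hi := (weq_iff_isEquivalence hP hZ d.i).1 d.hi.2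
  have hp' : IsIsofibration (fctr d.i ⋙ fctr d.p) := by
    rw [← d.fac] at hp
    exact hp
  obtain ⟨L, h₁, h₂⟩ := exists_lift (u := 𝟙 P) (v := 𝟙 d.Z) (q := d.p) d.hi.1 hi (hP.reflects hZ _) hZ
    hp' (by simp)
  rw [d.fac, Category.id_comp] at h₂
  exact MorphismProperty.of_retract
    ({ i := Arrow.homMk d.i (𝟙 Q), r := Arrow.homMk L (𝟙 Q)
       retract := by ext <;> simp [h₁] } : RetractArrow p d.p) d.hp

/-! ### Adding one isomorphic object -/

section IsoExtension

variable {P Q : Over (MarkedCat.sharp C)} (p : P ⟶ Q) {a : P.left} {d : Q.left} (g : d ≅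
    (fctr p).obj a)

/-- The objects of `P` and a copy of `a`. -/
abbrev addObj (a : P.left) : Option P.left → P.left := fun o => o.elim a id

/-- The functor extending `p` by `d`. -/
def addFunctor : Ind (addObj a) ⥤ Q.left :=
  conj (Ind.π (addObj a) ⋙ fctr p) (fun o : Option P.left => o.elim d (fctr p).obj) fun
    | none => g
    | some _ => Iso.refl _

/-- The object obtained from `P` by adding an object isomorphic to `a` over `d`. -/
def addOver : Over (MarkedCat.sharp C) :=
  Over.mk (Y :=
    { carrier := Ind (addObj a)
      marked := fun _ _ f => MarkedCat.IsMarked (Arr.map (Ind.π (addObj a)) ⟨f⟩)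
      id_marked := fun _ => P.left.id_marked _ })
    { toFunctor := addFunctor p g ⋙ proj Q
      map_marked := fun _ _ _ _ => trivial }

/-- The inclusion of `P` as a functor. -/
noncomputable abbrev addIncl (a : P.left) : P.left ⥤ Ind (addObj a) :=
  liftFF (Ind.π (addObj a)) (𝟭 _) some fun _ => rfl

theorem addIncl_π (a : P.left) : addIncl a ⋙ Ind.π (addObj a) = 𝟭 _ := liftFF_comp _ _ _ _

theorem addIncl_addFunctor : addIncl a ⋙ addFunctor p g = fctr p := Arr.functor_ext fun m => by
  refine (arr_conj_eq (θ := Iso.refl ((fctr p).obj m.src)) (θ' := Iso.refl ((fctr p).obj m.tgt)) rfl rfl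
    ((Ind.π (addObj a) ⋙ fctr p).map ((addIncl a).map m.hom))).trans ?_
  exact congrArg (Arr.map (fctr p)) (Arr.map_congr (addIncl_π a) m)

theorem isEquivalence_addIncl (a : P.left) : (addIncl a).IsEquivalence := by
  have hs : Function.Surjective (Ind.π (addObj a)).obj := fun x => ⟨(some x : Option P.left), rfl⟩
  have h : (Ind.π (addObj a)).IsEquivalence :=
    (isIsofibration_and_isEquivalence_iff.2 ⟨hs, inferInstance, inferInstance⟩).2
  have h' : (addIncl a ⋙ Ind.π (addObj a)).IsEquivalence := by
    rw [addIncl_π]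
    infer_instance
  exact Functor.isEquivalence_of_comp_right _ (Ind.π (addObj a))

/-- The inclusion of `P`. -/
noncomputable def addInclOver : P ⟶ addOver p g :=
  Over.homMk
    { toFunctor := addIncl a
      map_marked := fun _ _ f hf =>
        (congrArg MarkedCat.IsMarked (Arr.map_congr (addIncl_π a) ⟨f⟩)).mpr hf }
    (MarkedCat.hom_ext ((congrArg (· ⋙ proj Q) (addIncl_addFunctor p g)).trans (fctr_comp_proj p)))

/-- The isomorphism between objects with the same image. -/
def addIso (a : P.left) {x y : Option P.left} (h : addObj a x = addObj a y) : @Iso (Ind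
    (addObj a)) _ x y where
  hom := (eqToHom h : addObj a x ⟶ addObj a y)
  inv := (eqToHom h.symm : addObj a y ⟶ addObj a x)
  hom_inv_id := eqToHom_trans (C := P.left) _ _
  inv_hom_id := eqToHom_trans (C := P.left) _ _

/-- The new object is a copy of `a`, so the inclusion is an equivalence, and every marked morphism
is isomorphic to one between old objects. -/
theorem tcof_addInclOver : tcof C (addInclOver p g) := by
  refine ⟨fun _ _ h => Option.some_injective _ h, weq_of_isEquivalence _ (isEquivalence_addIncl a) ?_⟩
  intro x y f hf
  refine ⟨_, _, _, hf, ⟨?_⟩⟩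
  have h := Arr.mk_inj.1 (Arr.map_congr (addIncl_π a) ⟨(Ind.π (addObj a)).map f⟩)
  exact Arrow.isoMk (addIso a (x := some (addObj a x)) (y := x) rfl)
    (addIso a (x := some (addObj a y)) (y := y) rfl)
    ((Category.id_comp (obj := P.left) _).trans (h.symm.trans (Category.comp_id (obj := P.left) _).symm))

/-- The projection extending `p`. -/
def addProj (hQ : IsCartMarkedFibration Q) : addOver p g ⟶ Q :=
  Over.homMk
    { toFunctor := addFunctor p g
      map_marked := fun _ _ _ hf => hQ.isMarked_conj _ _ (p.left.map_marked _ hf) }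
    (MarkedCat.hom_ext rfl)

end IsoExtension

/-- An isomorphism `g` from `d` to the image of `a` extends `p` to a copy of `a` placed over `d`. A
lift against this trivial cofibration sends the isomorphism between the copy and `a` to a lift of
`g`. -/
theorem isIsofibration_of_fib {P Q : Over (MarkedCat.sharp C)} (hQ : IsCartMarkedFibration Q)
    {p : P ⟶ Q}
    (hp : fib C p) : IsIsofibration (fctr p) := by
  refine isIsofibration_iff.2 fun a d g => ?_
  rw [fib_eq] at hp
  have := hp _ (tcof_addInclOver p g)
  have sq : CommSq (𝟙 P) (addInclOver p g) p (addProj p g hQ) :=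
    ⟨(Category.id_comp p).trans (over_hom_ext (addIncl_addFunctor p g).symm)⟩
  let φ := addIso a (x := none) (y := some a) rfl
  have e₁ : addIncl a ⋙ fctr sq.lift = 𝟭 _ := fctr_congr sq.fac_left
  have e₂ : fctr sq.lift ⋙ fctr p = addFunctor p g := fctr_congr sq.fac_right
  have e₃ : (fctr sq.lift).obj (some a : Option P.left) = a := Functor.congr_obj e₁ a
  refine ⟨_, (fctr sq.lift).mapIso φ ≪≫ eqToIso e₃, ?_⟩
  refine (congrArg (Arr.map (fctr p)) (Arr.mk_comp_eqToHom ((fctr sq.lift).map φ.hom) e₃)).trans ?_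
  refine (Arr.map_congr e₂ ⟨φ.hom⟩).trans (congrArg Arr.mk ?_)
  change g.hom ≫ (fctr p).map (𝟙 a) ≫ 𝟙 _ = g.hom
  rw [CategoryTheory.Functor.map_id, Category.comp_id, Category.comp_id]

end Fibrant

variable {C : Type u} [Category.{u} C]

/-! ### The Quillen equivalence -/

theorem isFibrant_grfibModel_iff (P : Over (MarkedCat.sharp C)) :
    letI := grfibModel C
    IsFibrant P ↔ IsCartMarkedFibration P := by
  let := grfibModel C
  refine (isFibrant_iff P).trans (Iff.trans ?_ hasExtension_iff)
  exact (fibration_iff _).trans (fib_iff_hasExtension Limits.terminalIsTerminal _)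

theorem isGrfibModelStructure_grfibModel : IsGrfibModelStructure (grfibModel C) :=
  letI := grfibModel C
  { cofibration_iff := fun F => cofibration_iff F
    isFibrant_iff := isFibrant_grfibModel_iff
    weakEquivalence_iff := fun {P Q} F hP hQ =>
      (HomotopicalAlgebra.weakEquivalence_iff F).trans (weq_iff_isEquivalence
        ((isFibrant_grfibModel_iff P).1 hP) ((isFibrant_grfibModel_iff Q).1 hQ) F)
    fibration_iff := fun {P Q} F hP hQ =>
      (HomotopicalAlgebra.fibration_iff F).trans
        ⟨isIsofibration_of_fib ((isFibrant_grfibModel_iff Q).1 hQ),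
          fib_of_isIsofibration ((isFibrant_grfibModel_iff P).1 hP)
            ((isFibrant_grfibModel_iff Q).1 hQ)⟩ }

/-- The transpose is the unit, always a weak equivalence, followed by the Grothendieck construction
of `f`, which detects level-wise equivalences. Neither cofibrancy nor fibrancy plays a role. -/
theorem weq_homEquiv_iff {P : Over (MarkedCat.sharp C)} {F : Cᵒᵖ ⥤ Cat.{u, u}}
    (f : (TPlus C).obj P ⟶ F) : weq C ((adjunction C).homEquiv P F f) ↔ levelEq C f := by
  rw [Adjunction.homEquiv_unit, ← weq_groth_map_iff]
  exact (weq C).precomp_iff (unit P) _ (weq_unit P)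

theorem isQuillenEquivalence_adjunction :
    letI := projModel C
    letI := grfibModel C
    IsQuillenEquivalence (adjunction C) :=
  letI := projModel C
  letI := grfibModel C
  { fibration := fun p hp =>
      (fibration_iff _).2 (detect_le_fib _ (.inr ⟨p, (fibration_iff p).1 hp⟩))
    trivialFibration := fun p hp hp' => by
      have h := fib_inf_weq.ge _
        (tf_groth_map (α := p) ⟨(fibration_iff p).1 hp, (weakEquivalence_iff p).1 hp'⟩)
      exact ⟨(fibration_iff _).2 h.1, (weakEquivalence_iff _).2 h.2⟩
    weakEquivalence_iff := fun P F f _ _ =>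
      ((weakEquivalence_iff f).trans (weq_homEquiv_iff f).symm).trans (weakEquivalence_iff ((adjunction C).homEquiv P F f)).symm }

end MarkedGrothendieck

theorem theoremB (C : Type u) [Category.{u} C] :
    ∃ (projMS : ModelCategory (Cᵒᵖ ⥤ Cat.{u, u}))
      (grfibMS : ModelCategory (Over (MarkedGrothendieck.MarkedCat.sharp C))),
      MarkedGrothendieck.IsProjectiveModelStructure projMS ∧
      MarkedGrothendieck.IsGrfibModelStructure grfibMS ∧
      ∃ adj : MarkedGrothendieck.TPlus C ⊣ MarkedGrothendieck.groth C,
        MarkedGrothendieck.IsQuillenEquivalence adj := by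
  exact ⟨MarkedGrothendieck.projModel C, MarkedGrothendieck.grfibModel C,
    MarkedGrothendieck.isProjectiveModelStructure_projModel,
    MarkedGrothendieck.isGrfibModelStructure_grfibModel, MarkedGrothendieck.adjunction C,
    MarkedGrothendieck.isQuillenEquivalence_adjunction⟩
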